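/- **Setting.** Let $D\subseteq(0,\infty)\times\mathbb R$ be open, such that for each $\rho$ the slice $\{\varepsilon:(\rho,\varepsilon)\in D\}$ is connected. Consider smooth fields $\rho$ (mass density), $\mathbf v$ (velocity), $\varepsilon$ (specific internal energy) of $(t,\mathbf x)\in\mathbb R\times\mathbb R^3$, put $\mathbf L=\operatorname{sym}\nabla\mathbf v$, and let the state variables be $z=(\rho,\varepsilon,\nabla\rho,\mathbf L,\nabla\varepsilon,\nabla\nabla\rho)$ with $(\rho,\varepsilon)\in D$. Let $p,\alpha_1,\dots,\alpha_6,q_1,q_2,s_0,\dots,s_5$ be smooth functions of $(\rho,\varepsilon)\in D$, and let $$\mathbf T=(-p+\alpha_1\Delta\rho+\alpha_2|\nabla\rho|^2)\mathbf I+\alpha_3\nabla\rho\otimes\nabla\rho+\alpha_4\nabla\nabla\rho+\alpha_5(\nabla\cdot\mathbf v)\mathbf I+\alpha_6\mathbf L,\qquad \mathbf q=q_1\nabla\varepsilon+q_2\nabla\rho,$$ $$s=s_0+s_1|\nabla\rho|^2+s_2\nabla\rho\cdot\nabla\varepsilon+s_3|\nabla\varepsilon|^2+s_4\nabla\cdot\mathbf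 v+s_5\Delta\rho .$$ Let the entropy flux $\mathbf J=\mathbf J(z)$ be a smooth vector-valued function of the state variables, isotropic with respect to the full orthogonal group $O(3)$. Assume that $\partial s_0/\partial\varepsilon\neq0$ on $D$ and that $\alpha_1+\alpha_4$ does not vanish identically on any nonempty open subset of $D$. Write $$\mathcal E^{(1)}=\partial_t\rho+\nabla\cdot(\rho\mathbf v),\quad \mathcal E^{(2)}=\rho(\partial_t\mathbf v+(\mathbf v\cdot\nabla)\mathbf v)-\nabla\cdot\mathbf T,\quad \mathcal E^{(3)}=\rho(\partial_t\varepsilon+\mathbf v\cdot\nabla\varepsilon)-\mathbf T\cdot\nabla\mathbf v+\nabla\cdot\mathbf q .$$ **Hypothesis (extended Liu entropy inequality).** There are functions $\lambda^{(1)},\boldsymbol\lambda^{(2)},\lambda^{(3)},\boldsymbol\Lambda^{(1)},\boldsymbol\Lambda^{(2)},\boldsymbol\Lambda^{(3)},\boldsymbol\Theta^{(1)}$ of the state variables (scalars, vectors and second-order tensors as the contractions require) such that, for all smooth fields $\rho,\mathbf v,\varepsilon$ on $\mathbb R\times\mathbb R^3$ (not required to satisfy any field equation) and at every point $(t,\mathbf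 x)$ where $(\rho,\varepsilon)\in D$, $$\rho(\partial_ts+\mathbf v\cdot\nabla s)+\nabla\cdot\mathbf J-\lambda^{(1)}\mathcal E^{(1)}-\boldsymbol\lambda^{(2)}\cdot\mathcal E^{(2)}-\lambda^{(3)}\mathcal E^{(3)}-\boldsymbol\Lambda^{(1)}\cdot\nabla\mathcal E^{(1)}-\boldsymbol\Lambda^{(2)}\cdot\nabla\mathcal E^{(2)}-\boldsymbol\Lambda^{(3)}\cdot\nabla\mathcal E^{(3)}-\boldsymbol\Theta^{(1)}\cdot\nabla\nabla\mathcal E^{(1)}\ \ge\ 0 .$$ **Conclusion.** On $D$ one has $s_2=s_3=s_4=s_5=0$, and $s_1$ is a smooth function of $\rho$ alone, so that $s=s_0(\rho,\varepsilon)+s_1(\rho)|\nabla\rho|^2$. Moreover $$\mathbf J=\mathbf q\,\frac{\partial s_0}{\partial\varepsilon}+2\rho^2s_1(\rho)(\nabla\cdot\mathbf v)\nabla\rho,$$ $$p=-\rho^2\frac{\partial s_0}{\partial\rho}\Big(\frac{\partial s_0}{\partial\varepsilon}\Big)^{-1},\quad \alpha_1=-2\rho^2s_1\Big(\frac{\partial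 s_0}{\partial\varepsilon}\Big)^{-1},\quad \alpha_2=-\rho\,(\rho s_1'+2s_1)\Big(\frac{\partial s_0}{\partial\varepsilon}\Big)^{-1},\quad \alpha_3=2\rho s_1\Big(\frac{\partial s_0}{\partial\varepsilon}\Big)^{-1},\quad \alpha_4=0 .$$ -/

import Mathlib

open scoped ContDiff

namespace Korteweg

/-- Vectors of the three-dimensional Euclidean space, in Cartesian components. -/
abbrev V : Type := Fin 3 → ℝ

/-- Second order tensors, in Cartesian components. -/
abbrev T2 : Type := Fin 3 → Fin 3 → ℝ

/-- Time and position `(t, x)`. -/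
abbrev SpaceTime : Type := ℝ × V

/-- The state variables `(ρ, ε, ∇ρ, L, ∇ε, ∇∇ρ)`. -/
abbrev State : Type := ℝ × ℝ × V × T2 × V × T2

namespace State

def rho (z : State) : ℝ := z.1
def eps (z : State) : ℝ := z.2.1
def gradRho (z : State) : V := z.2.2.1
/-- The symmetric part of the velocity gradient. -/
def L (z : State) : T2 := z.2.2.2.1
def gradEps (z : State) : V := z.2.2.2.2.1
def hessRho (z : State) : T2 := z.2.2.2.2.2

/-- The states with `(ρ, ε) ∈ D`; the tensor slots are not restricted here. -/
def region (D : Set (ℝ × ℝ)) : Set State := {z | (z.rho, z.eps) ∈ D}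

/-- The states with `(ρ, ε) ∈ D`, with `L` and `∇∇ρ` symmetric. -/
def Admissible (D : Set (ℝ × ℝ)) (z : State) : Prop :=
  (z.rho, z.eps) ∈ D ∧ (∀ i j, z.L i j = z.L j i) ∧ (∀ i j, z.hessRho i j = z.hessRho j i)

end State

/-- The scalar product of vectors. -/
def dot (a b : V) : ℝ := ∑ i, a i * b i

/-- The full contraction of second order tensors. -/
def ddot (A B : T2) : ℝ := ∑ i, ∑ j, A i j * B i j

/-- The trace. -/
def tr (A : T2) : ℝ := ∑ i, A i i

/-- The Kronecker delta. -/
def delta (i j : Fin 3) : ℝ := if i = j then 1 else 0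

/-- The action of an orthogonal matrix on vectors. -/
def actV (Q : Matrix (Fin 3) (Fin 3) ℝ) (a : V) : V := fun i => ∑ j, Q i j * a j

/-- The action `A ↦ Q A Qᵀ` of an orthogonal matrix on second order tensors. -/
def actT (Q : Matrix (Fin 3) (Fin 3) ℝ) (A : T2) : T2 :=
  fun i j => ∑ a, ∑ b, Q i a * Q j b * A a b

/-- The action of an orthogonal matrix on states. -/
def actState (Q : Matrix (Fin 3) (Fin 3) ℝ) (z : State) : State :=
  (z.rho, z.eps, actV Q z.gradRho, actT Q z.L, actV Q z.gradEps, actT Q z.hessRho)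

/-- A vector valued constitutive function is isotropic (with respect to the full orthogonal
group) on the admissible states over `D`. -/
def IsotropicVector (D : Set (ℝ × ℝ)) (J : State → V) : Prop :=
  ∀ Q ∈ Matrix.orthogonalGroup (Fin 3) ℝ, ∀ z : State, z.Admissible D →
    J (actState Q z) = actV Q (J z)

/-- The material functions of `(ρ, ε)`: the pressure and the coefficients of the stress
tensor, of the heat flux, and of the expansion of the specific entropy. -/
structure MaterialFunctions where
  p : ℝ → ℝ → ℝ
  α1 : ℝ → ℝ → ℝ
  α2 : ℝ → ℝ → ℝ
  α3 : ℝ → ℝ → ℝ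
  α4 : ℝ → ℝ → ℝ
  α5 : ℝ → ℝ → ℝ
  α6 : ℝ → ℝ → ℝ
  q1 : ℝ → ℝ → ℝ
  q2 : ℝ → ℝ → ℝ
  s0 : ℝ → ℝ → ℝ
  s1 : ℝ → ℝ → ℝ
  s2 : ℝ → ℝ → ℝ
  s3 : ℝ → ℝ → ℝ
  s4 : ℝ → ℝ → ℝ
  s5 : ℝ → ℝ → ℝ

/-- `f` is a smooth function of `(ρ, ε)` on `D`. -/
def Smooth2 (D : Set (ℝ × ℝ)) (f : ℝ → ℝ → ℝ) : Prop :=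
  ContDiffOn ℝ ∞ (fun z : ℝ × ℝ => f z.1 z.2) D

/-- `∂f/∂ρ`. -/
noncomputable def dRho (f : ℝ → ℝ → ℝ) (ρ ε : ℝ) : ℝ := deriv (fun r => f r ε) ρ

/-- `∂f/∂ε`. -/
noncomputable def dEps (f : ℝ → ℝ → ℝ) (ρ ε : ℝ) : ℝ := deriv (fun e => f ρ e) ε

namespace MaterialFunctions

/-- All material functions are smooth on `D`. -/
structure SmoothOn (m : MaterialFunctions) (D : Set (ℝ × ℝ)) : Prop where
  p : Smooth2 D m.p
  α1 : Smooth2 D m.α1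
  α2 : Smooth2 D m.α2
  α3 : Smooth2 D m.α3
  α4 : Smooth2 D m.α4
  α5 : Smooth2 D m.α5
  α6 : Smooth2 D m.α6
  q1 : Smooth2 D m.q1
  q2 : Smooth2 D m.q2
  s0 : Smooth2 D m.s0
  s1 : Smooth2 D m.s1
  s2 : Smooth2 D m.s2
  s3 : Smooth2 D m.s3
  s4 : Smooth2 D m.s4
  s5 : Smooth2 D m.s5

/-- The Cauchy stress tensor
`(-p + α₁ Δρ + α₂ |∇ρ|²) I + α₃ ∇ρ ⊗ ∇ρ + α₄ ∇∇ρ + α₅ (∇·v) I + α₆ L`. -/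
def stress (m : MaterialFunctions) (z : State) : T2 := fun i j =>
  (-m.p z.rho z.eps + m.α1 z.rho z.eps * tr z.hessRho
      + m.α2 z.rho z.eps * dot z.gradRho z.gradRho) * delta i j
    + m.α3 z.rho z.eps * (z.gradRho i * z.gradRho j)
    + m.α4 z.rho z.eps * z.hessRho i j
    + m.α5 z.rho z.eps * tr z.L * delta i j
    + m.α6 z.rho z.eps * z.L i j

/-- The heat flux `q₁ ∇ε + q₂ ∇ρ`. -/
def heatFlux (m : MaterialFunctions) (z : State) : V := fun i =>
  m.q1 z.rho z.eps * z.gradEps i + m.q2 z.rho z.eps * z.gradRho i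

/-- The specific entropy
`s₀ + s₁ |∇ρ|² + s₂ ∇ρ·∇ε + s₃ |∇ε|² + s₄ ∇·v + s₅ Δρ`. -/
def entropy (m : MaterialFunctions) (z : State) : ℝ :=
  m.s0 z.rho z.eps
    + m.s1 z.rho z.eps * dot z.gradRho z.gradRho
    + m.s2 z.rho z.eps * dot z.gradRho z.gradEps
    + m.s3 z.rho z.eps * dot z.gradEps z.gradEps
    + m.s4 z.rho z.eps * tr z.L
    + m.s5 z.rho z.eps * tr z.hessRho

end MaterialFunctions

/-- The partial derivative with respect to time. -/
noncomputable def dt (f : SpaceTime → ℝ) : SpaceTime → ℝ :=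
  fun y => fderiv ℝ f y (1, 0)

/-- The partial derivative with respect to the `i`-th spatial coordinate. -/
noncomputable def dx (i : Fin 3) (f : SpaceTime → ℝ) : SpaceTime → ℝ :=
  fun y => fderiv ℝ f y (0, Pi.single i 1)

/-- The fields of mass density, velocity and specific internal energy. -/
structure Fields where
  rho : SpaceTime → ℝ
  v : SpaceTime → V
  eps : SpaceTime → ℝ

namespace Fields

/-- Smooth fields. -/
structure Smooth (w : Fields) : Prop where
  rho : ContDiff ℝ ∞ w.rho
  v : ContDiff ℝ ∞ w.v
  eps : ContDiff ℝ ∞ w.eps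

/-- The velocity gradient `v_{i,j}`. -/
noncomputable def gradV (w : Fields) (y : SpaceTime) : T2 :=
  fun i j => dx j (fun y' => w.v y' i) y

/-- The state variables along the given fields. -/
noncomputable def state (w : Fields) (y : SpaceTime) : State :=
  (w.rho y, w.eps y, fun i => dx i w.rho y,
    fun i j => (w.gradV y i j + w.gradV y j i) / 2,
    fun i => dx i w.eps y, fun i j => dx j (dx i w.rho) y)

/-- The material derivative `∂f/∂t + v·∇f`. -/
noncomputable def materialDeriv (w : Fields) (f : SpaceTime → ℝ) (y : SpaceTime) : ℝ :=
  dt f y + ∑ j, w.v y j * dx j f y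

/-- The left-hand side of the balance of mass, `∂ρ/∂t + ∇·(ρ v)`. -/
noncomputable def massBalance (w : Fields) (y : SpaceTime) : ℝ :=
  dt w.rho y + ∑ j, dx j (fun y' => w.rho y' * w.v y' j) y

/-- The left-hand side of the balance of linear momentum,
`ρ (∂v/∂t + (v·∇) v) - ∇·T`. -/
noncomputable def momentumBalance (m : MaterialFunctions) (w : Fields) (y : SpaceTime) : V :=
  fun i => w.rho y * w.materialDeriv (fun y' => w.v y' i) y
    - ∑ j, dx j (fun y' => m.stress (w.state y') i j) y

/-- The left-hand side of the balance of energy,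
`ρ (∂ε/∂t + v·∇ε) - T·∇v + ∇·q`. -/
noncomputable def energyBalance (m : MaterialFunctions) (w : Fields) (y : SpaceTime) : ℝ :=
  w.rho y * w.materialDeriv w.eps y - ddot (m.stress (w.state y)) (w.gradV y)
    + ∑ j, dx j (fun y' => m.heatFlux (w.state y') j) y

/-- The local entropy production `ρ (∂s/∂t + v·∇s) + ∇·J`. -/
noncomputable def entropyProduction (m : MaterialFunctions) (J : State → V) (w : Fields)
    (y : SpaceTime) : ℝ :=
  w.rho y * w.materialDeriv (fun y' => m.entropy (w.state y')) y
    + ∑ j, dx j (fun y' => J (w.state y') j) y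

end Fields

/-- The Lagrange multipliers, functions of the state variables: those of the balance
equations, of their spatial gradients, and of the second gradient of the mass balance. -/
structure Multipliers where
  lam1 : State → ℝ
  lam2 : State → V
  lam3 : State → ℝ
  Lam1 : State → V
  Lam2 : State → T2
  Lam3 : State → V
  Theta1 : State → T2

/-- The left-hand side of the extended entropy inequality: the entropy production minus the
balance equations, their first gradients, and the second gradient of the mass balance, each
contracted with its Lagrange multiplier. -/
noncomputable def extendedProduction (m : MaterialFunctions) (J : State → V) (μ : Multipliers)
    (w : Fields) (y : SpaceTime) : ℝ :=
  w.entropyProduction m J y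
    - μ.lam1 (w.state y) * w.massBalance y
    - dot (μ.lam2 (w.state y)) (w.momentumBalance m y)
    - μ.lam3 (w.state y) * w.energyBalance m y
    - dot (μ.Lam1 (w.state y)) (fun k => dx k w.massBalance y)
    - ddot (μ.Lam2 (w.state y)) (fun i k => dx k (fun y' => w.momentumBalance m y' i) y)
    - dot (μ.Lam3 (w.state y)) (fun k => dx k (w.energyBalance m) y)
    - ddot (μ.Theta1 (w.state y)) (fun i k => dx k (dx i w.massBalance) y)

/-- The extended (Liu) entropy principle over `D`: for some Lagrange multipliers depending on
the state variables only, the extended entropy inequality holds along arbitrary smooth fields,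
at every point at which `(ρ, ε) ∈ D`. -/
def ExtendedEntropyPrinciple (D : Set (ℝ × ℝ)) (m : MaterialFunctions) (J : State → V) : Prop :=
  ∃ μ : Multipliers, ∀ w : Fields, w.Smooth → ∀ y : SpaceTime, (w.rho y, w.eps y) ∈ D →
    0 ≤ extendedProduction m J μ w y

end Korteweg

/-!
Fields that satisfy the balance equations at a point, together with the second derivatives of the
mass balance and the first derivatives of the other two, kill every multiplier term there. What is
left is an inequality for the entropy production alone, in which the higher derivatives `∇∇∇ρ`,
`∇∇v`, `∇∇ε` are arbitrary and enter linearly, so that their coefficients vanish. One-dimensional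
motions already force `s₂ = s₃ = s₄ = s₅ = 0`; in three dimensions the coefficients determine
`∂J/∂L` and the symmetrised derivatives of `J` in `∇ε` and `∇∇ρ`.

To integrate these equations, take `L = 0` and `∇ε = 0`. When `∇ρ` is an eigenvector of `∇∇ρ`, the
reflections commuting with `∇∇ρ` leave only the component of `J` along `∇ρ`, and this component
solves an Euler equation that is regular at `∇ρ = 0`, which gives the formula for `J`. The
inequality that remains is affine in `∇∇ρ` and quadratic in `L`: it yields `p` and the `αᵢ`, and
also `(α₁ + α₄) ∂s₁/∂ε = 0`, whence `s₁` depends on `ρ` alone because `α₁ + α₄` is nonzero on a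
dense set.
-/

namespace Korteweg

section Derivatives

/-- The partial derivative with respect to the `i`-th coordinate of a function of position. -/
noncomputable def pd (i : Fin 3) (f : V → ℝ) : V → ℝ :=
  fun x => fderiv ℝ f x (Pi.single i 1)

variable {f g : V → ℝ} {x : V}

theorem contDiffAt_pd (hf : ContDiffAt ℝ ∞ f x) (i : Fin 3) : ContDiffAt ℝ ∞ (pd i f) x :=
  (hf.fderiv_right (m := ∞) (by simp)).clm_apply contDiffAt_const

theorem contDiff_pd (hf : ContDiff ℝ ∞ f) (i : Fin 3) : ContDiff ℝ ∞ (pd i f) :=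
  contDiff_iff_contDiffAt.2 fun _ => contDiffAt_pd hf.contDiffAt i

theorem pd_congr (h : f =ᶠ[nhds x] g) (k : Fin 3) : pd k f x = pd k g x := by
  simp [pd, h.fderiv_eq]

theorem pd_const (c : ℝ) (k : Fin 3) : pd k (fun _ => c) = fun _ => 0 := by
  funext x; simp [pd]

theorem pd_add (hf : DifferentiableAt ℝ f x) (hg : DifferentiableAt ℝ g x) (k : Fin 3) :
    pd k (fun x => f x + g x) x = pd k f x + pd k g x := by
  simp [pd, fderiv_fun_add hf hg]

theorem pd_sub (hf : DifferentiableAt ℝ f x) (hg : DifferentiableAt ℝ g x) (k : Fin 3) :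
    pd k (fun x => f x - g x) x = pd k f x - pd k g x := by
  simp [pd, fderiv_fun_sub hf hg]

theorem pd_mul (hf : DifferentiableAt ℝ f x) (hg : DifferentiableAt ℝ g x) (k : Fin 3) :
    pd k (fun x => f x * g x) x = pd k f x * g x + f x * pd k g x := by
  simp only [pd, fderiv_fun_mul hf hg, add_apply, smul_apply, smul_eq_mul]
  ring

theorem pd_const_mul (c : ℝ) (hf : DifferentiableAt ℝ f x) (k : Fin 3) :
    pd k (fun x => c * f x) x = c * pd k f x := by
  simp [pd, fderiv_const_mul hf]

variable {h : SpaceTime → ℝ} {y : SpaceTime}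

theorem contDiffAt_dx (hh : ContDiffAt ℝ ∞ h y) (i : Fin 3) : ContDiffAt ℝ ∞ (dx i h) y :=
  (hh.fderiv_right (m := ∞) (by simp)).clm_apply contDiffAt_const

theorem contDiff_dx (hh : ContDiff ℝ ∞ h) (i : Fin 3) : ContDiff ℝ ∞ (dx i h) :=
  contDiff_iff_contDiffAt.2 fun _ => contDiffAt_dx hh.contDiffAt i

theorem contDiff_dt (hh : ContDiff ℝ ∞ h) : ContDiff ℝ ∞ (dt h) :=
  (hh.fderiv_right (m := ∞) (by simp)).clm_apply contDiff_const

theorem dx_eq_pd {t : ℝ} (hh : DifferentiableAt ℝ h (t, x)) (k : Fin 3) :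
    dx k h (t, x) = pd k (fun x' => h (t, x')) x := by
  have hslice : HasFDerivAt (fun x' => h (t, x')) _ x :=
    hh.hasFDerivAt.comp x (hasFDerivAt_prodMk_right t x)
  simp [pd, dx, hslice.fderiv]

theorem dt_eq_deriv {t : ℝ} (hh : DifferentiableAt ℝ h (t, x)) :
    dt h (t, x) = deriv (fun τ => h (τ, x)) t := by
  have hslice : HasDerivAt (fun τ : ℝ => ((τ, x) : SpaceTime)) (1, 0) t :=
    (hasDerivAt_id t).prodMk (hasDerivAt_const t x)
  exact (hh.hasFDerivAt.comp_hasDerivAt t hslice).deriv.symm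

/-- The affine function with the same first order jet at the origin. -/
noncomputable def tangentAt (f : V → ℝ) (x : V) : ℝ := f 0 + fderiv ℝ f 0 x

theorem contDiff_tangentAt (f : V → ℝ) : ContDiff ℝ ∞ (tangentAt f) :=
  contDiff_const.add (fderiv ℝ f 0).contDiff

theorem tangentAt_zero (f : V → ℝ) : tangentAt f 0 = f 0 := by simp [tangentAt]

theorem pd_tangentAt (f : V → ℝ) (k : Fin 3) (x : V) : pd k (tangentAt f) x = pd k f 0 := by
  unfold pd tangentAt
  rw [fderiv_const_add, ContinuousLinearMap.fderiv]

theorem pd_mul_tangentAt_sub (hf : DifferentiableAt ℝ f 0) (hg : DifferentiableAt ℝ g 0)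
    (k : Fin 3) : pd k (fun x => f x * (tangentAt g x - g x)) 0 = 0 := by
  have htan : DifferentiableAt ℝ (tangentAt g) 0 :=
    (contDiff_tangentAt g).differentiable (by simp) 0
  rw [pd_mul (g := fun x => tangentAt g x - g x) hf (htan.sub hg), pd_sub htan hg,
    tangentAt_zero, pd_tangentAt]
  ring

end Derivatives

section Profiles

/-- The fields of mass density, velocity and specific internal energy at a fixed time. -/
structure Profile where
  rho : V → ℝ
  v : V → V
  eps : V → ℝ

namespace Profile

/-- Smooth profiles. -/
structure Smooth (P : Profile) : Prop where
  rho : ContDiff ℝ ∞ P.rho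
  v : ∀ i, ContDiff ℝ ∞ fun x => P.v x i
  eps : ContDiff ℝ ∞ P.eps

/-- The state variables along a profile. -/
noncomputable def jet (P : Profile) (x : V) : State :=
  (P.rho x, P.eps x, fun i => pd i P.rho x,
    fun i j => (pd j (fun x => P.v x i) x + pd i (fun x => P.v x j) x) / 2,
    fun i => pd i P.eps x, fun i j => pd j (pd i P.rho) x)

/-- The rate `-∇·(ρ v)` of the density at which the balance of mass is satisfied. -/
noncomputable def densityRate (P : Profile) (x : V) : ℝ :=
  -∑ j, pd j (fun x' => P.rho x' * P.v x' j) x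

/-- The rate of the velocity at which the balance of momentum is satisfied. -/
noncomputable def velocityRate (m : MaterialFunctions) (P : Profile) (x : V) : V := fun i =>
  (∑ j, pd j (fun x' => m.stress (P.jet x') i j) x) / P.rho x
    - ∑ j, P.v x j * pd j (fun x' => P.v x' i) x

/-- The rate of the energy at which the balance of energy is satisfied. -/
noncomputable def energyRate (m : MaterialFunctions) (P : Profile) (x : V) : ℝ :=
  (ddot (m.stress (P.jet x)) (fun i j => pd j (fun x' => P.v x' i) x)
      - ∑ j, pd j (fun x' => m.heatFlux (P.jet x') j) x) / P.rho x
    - ∑ j, P.v x j * pd j P.eps x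

/-- The rates of all three fields at which the balance equations are satisfied. -/
noncomputable def rates (m : MaterialFunctions) (P : Profile) : Profile :=
  ⟨P.densityRate, P.velocityRate m, P.energyRate m⟩

/-- Globally smooth rates that agree with `P.rates m` to first order at the origin (and exactly
in the density), whereas `P.rates m` is smooth only where the material functions are. -/
noncomputable def tangentRates (m : MaterialFunctions) (P : Profile) : Profile :=
  ⟨P.densityRate, fun x i => tangentAt (fun x => P.velocityRate m x i) x,
    tangentAt (P.energyRate m)⟩

variable {P Q : Profile}

theorem Smooth.jet (hP : P.Smooth) : ContDiff ℝ ∞ P.jet :=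
  hP.rho.prodMk <| hP.eps.prodMk <|
    (contDiff_pi.2 fun i => contDiff_pd hP.rho i).prodMk <|
    (contDiff_pi.2 fun i => contDiff_pi.2 fun j =>
      ((contDiff_pd (hP.v i) j).add (contDiff_pd (hP.v j) i)).div_const 2).prodMk <|
    (contDiff_pi.2 fun i => contDiff_pd hP.eps i).prodMk <|
    contDiff_pi.2 fun i => contDiff_pi.2 fun j => contDiff_pd (contDiff_pd hP.rho i) j

theorem Smooth.densityRate (hP : P.Smooth) : ContDiff ℝ ∞ P.densityRate :=
  (ContDiff.sum fun j _ => contDiff_pd (hP.rho.mul (hP.v j)) j).neg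

theorem Smooth.tangentRates (hP : P.Smooth) (m : MaterialFunctions) : (P.tangentRates m).Smooth :=
  ⟨hP.densityRate, fun i => contDiff_tangentAt fun x => P.velocityRate m x i, contDiff_tangentAt _⟩

theorem jet_tangentRates_zero (m : MaterialFunctions) (P : Profile) :
    (P.tangentRates m).jet 0 = (P.rates m).jet 0 := by
  simp only [jet, tangentRates, rates, tangentAt_zero, pd_tangentAt]

/-- The fields `P + t Q`. -/
def toFields (P Q : Profile) : Fields where
  rho := fun y => P.rho y.2 + y.1 * Q.rho y.2
  v := fun y i => P.v y.2 i + y.1 * Q.v y.2 i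
  eps := fun y => P.eps y.2 + y.1 * Q.eps y.2

theorem Smooth.toFields (hP : P.Smooth) (hQ : Q.Smooth) : (P.toFields Q).Smooth where
  rho := (hP.rho.comp contDiff_snd).add (contDiff_fst.mul (hQ.rho.comp contDiff_snd))
  v := contDiff_pi.2 fun i =>
    ((hP.v i).comp contDiff_snd).add (contDiff_fst.mul ((hQ.v i).comp contDiff_snd))
  eps := (hP.eps.comp contDiff_snd).add (contDiff_fst.mul (hQ.eps.comp contDiff_snd))

end Profile

namespace Fields

/-- The profile of the fields at time `t`. -/
def slice (w : Fields) (t : ℝ) : Profile :=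
  ⟨fun x => w.rho (t, x), fun x => w.v (t, x), fun x => w.eps (t, x)⟩

variable {w : Fields}

theorem Smooth.v_apply (hw : w.Smooth) (i : Fin 3) : ContDiff ℝ ∞ fun y => w.v y i :=
  contDiff_pi.1 hw.v i

theorem Smooth.state (hw : w.Smooth) : ContDiff ℝ ∞ w.state :=
  hw.rho.prodMk <| hw.eps.prodMk <|
    (contDiff_pi.2 fun i => contDiff_dx hw.rho i).prodMk <|
    (contDiff_pi.2 fun i => contDiff_pi.2 fun j =>
      ((contDiff_dx (hw.v_apply i) j).add (contDiff_dx (hw.v_apply j) i)).div_const 2).prodMk <|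
    (contDiff_pi.2 fun i => contDiff_dx hw.eps i).prodMk <|
    contDiff_pi.2 fun i => contDiff_pi.2 fun j => contDiff_dx (contDiff_dx hw.rho i) j

theorem gradV_eq_pd (hw : w.Smooth) (t : ℝ) (x : V) :
    w.gradV (t, x) = fun i j => pd j (fun x' => (w.slice t).v x' i) x := by
  funext i j
  exact dx_eq_pd ((hw.v_apply i).differentiable (by simp) _) j

theorem state_eq_jet (hw : w.Smooth) (t : ℝ) (x : V) : w.state (t, x) = (w.slice t).jet x := by
  have hrho : ∀ i x, dx i w.rho (t, x) = pd i (w.slice t).rho x := fun i x =>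
    dx_eq_pd (hw.rho.differentiable (by simp) _) i
  have heps : ∀ i, dx i w.eps (t, x) = pd i (w.slice t).eps x := fun i =>
    dx_eq_pd (hw.eps.differentiable (by simp) _) i
  have hhess : ∀ i j, dx j (dx i w.rho) (t, x) = pd j (pd i (w.slice t).rho) x := fun i j => by
    rw [dx_eq_pd ((contDiff_dx hw.rho i).differentiable (by simp) _)]
    simp only [hrho]
  simp only [state, gradV_eq_pd hw, hrho, heps, hhess]
  rfl

end Fields

namespace Profile

variable {P Q : Profile}

theorem slice_toFields_zero (P Q : Profile) : (P.toFields Q).slice 0 = P := by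
  simp [Fields.slice, toFields]

theorem jet_slice_toFields (hP : P.Smooth) (hQ : Q.Smooth) (t : ℝ) (x : V) :
    ((P.toFields Q).slice t).jet x = P.jet x + t • Q.jet x := by
  have hpd : ∀ {a b : V → ℝ}, ContDiff ℝ ∞ a → ContDiff ℝ ∞ b → ∀ i,
      pd i (fun x => a x + t * b x) = fun x => pd i a x + t * pd i b x := by
    intro a b ha hb i
    funext x
    have hb' : DifferentiableAt ℝ b x := hb.differentiable (by simp) x
    rw [pd_add (ha.differentiable (by simp) x) (hb'.const_mul t), pd_const_mul t hb']
  simp only [jet, Fields.slice, toFields, hpd hP.rho hQ.rho, hpd hP.eps hQ.eps,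
    hpd (hP.v _) (hQ.v _), hpd (contDiff_pd hP.rho _) (contDiff_pd hQ.rho _)]
  simp only [Prod.smul_mk, Prod.mk_add_mk, smul_eq_mul, Prod.mk.injEq, true_and]
  refine ⟨rfl, ?_, rfl, rfl⟩
  funext i j
  simp only [Pi.add_apply, Pi.smul_apply, smul_eq_mul]
  ring

theorem state_toFields (hP : P.Smooth) (hQ : Q.Smooth) (t : ℝ) (x : V) :
    (P.toFields Q).state (t, x) = P.jet x + t • Q.jet x := by
  rw [Fields.state_eq_jet (hP.toFields hQ), jet_slice_toFields hP hQ]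

theorem dt_toFields_rho (hP : P.Smooth) (hQ : Q.Smooth) (t : ℝ) (x : V) :
    dt (P.toFields Q).rho (t, x) = Q.rho x := by
  rw [dt_eq_deriv ((hP.toFields hQ).rho.differentiable (by simp) _)]
  simp [toFields]

theorem dt_toFields_v (hP : P.Smooth) (hQ : Q.Smooth) (t : ℝ) (x : V) (i : Fin 3) :
    dt (fun y => (P.toFields Q).v y i) (t, x) = Q.v x i := by
  rw [dt_eq_deriv (((hP.toFields hQ).v_apply i).differentiable (by simp) _)]
  simp [toFields]

theorem dt_toFields_eps (hP : P.Smooth) (hQ : Q.Smooth) (t : ℝ) (x : V) :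
    dt (P.toFields Q).eps (t, x) = Q.eps x := by
  rw [dt_eq_deriv ((hP.toFields hQ).eps.differentiable (by simp) _)]
  simp [toFields]

end Profile

end Profiles

section Smoothness

variable {D : Set (ℝ × ℝ)}

theorem contDiff_rho : ContDiff ℝ ∞ State.rho := contDiff_fst

theorem contDiff_eps : ContDiff ℝ ∞ State.eps := contDiff_fst.comp contDiff_snd

theorem contDiff_gradRho_apply (i : Fin 3) : ContDiff ℝ ∞ fun z : State => z.gradRho i :=
  contDiff_pi.1 (contDiff_fst.comp (contDiff_snd.comp contDiff_snd)) i

theorem contDiff_L_apply (i j : Fin 3) : ContDiff ℝ ∞ fun z : State => z.L i j :=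
  contDiff_pi.1 (contDiff_pi.1
    (contDiff_fst.comp (contDiff_snd.comp (contDiff_snd.comp contDiff_snd))) i) j

theorem contDiff_gradEps_apply (i : Fin 3) : ContDiff ℝ ∞ fun z : State => z.gradEps i :=
  contDiff_pi.1 (contDiff_fst.comp
    (contDiff_snd.comp (contDiff_snd.comp (contDiff_snd.comp contDiff_snd)))) i

theorem contDiff_hessRho_apply (i j : Fin 3) : ContDiff ℝ ∞ fun z : State => z.hessRho i j :=
  contDiff_pi.1 (contDiff_pi.1 (contDiff_snd.comp
    (contDiff_snd.comp (contDiff_snd.comp (contDiff_snd.comp contDiff_snd)))) i) j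

theorem isOpen_region (hD : IsOpen D) : IsOpen (State.region D) :=
  hD.preimage (contDiff_rho.continuous.prodMk contDiff_eps.continuous)

theorem Smooth2.contDiffAt (hD : IsOpen D) {f : ℝ → ℝ → ℝ} (hf : Smooth2 D f) {z : ℝ × ℝ}
    (hz : z ∈ D) : ContDiffAt ℝ ∞ (fun z : ℝ × ℝ => f z.1 z.2) z :=
  ContDiffOn.contDiffAt hf (hD.mem_nhds hz)

theorem Smooth2.contDiffAt_state (hD : IsOpen D) {f : ℝ → ℝ → ℝ} (hf : Smooth2 D f) {z : State}
    (hz : z ∈ State.region D) : ContDiffAt ℝ ∞ (fun z : State => f z.rho z.eps) z :=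
  ContDiffAt.comp (g := fun z : ℝ × ℝ => f z.1 z.2) (f := fun z : State => (z.rho, z.eps)) z
    (hf.contDiffAt hD hz) (contDiff_rho.contDiffAt.prodMk contDiff_eps.contDiffAt)

theorem contDiff_dot {a b : State → V} (ha : ∀ i, ContDiff ℝ ∞ fun z => a z i)
    (hb : ∀ i, ContDiff ℝ ∞ fun z => b z i) : ContDiff ℝ ∞ fun z => dot (a z) (b z) :=
  ContDiff.sum fun i _ => (ha i).mul (hb i)

theorem contDiff_tr {A : State → T2} (hA : ∀ i j, ContDiff ℝ ∞ fun z => A z i j) :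
    ContDiff ℝ ∞ fun z => tr (A z) :=
  ContDiff.sum fun i _ => hA i i

variable {m : MaterialFunctions} {z : State}

theorem contDiffAt_stress (hD : IsOpen D) (hm : m.SmoothOn D) (hz : z ∈ State.region D)
    (i j : Fin 3) : ContDiffAt ℝ ∞ (fun z => m.stress z i j) z := by
  unfold MaterialFunctions.stress
  have hgg := (contDiff_dot contDiff_gradRho_apply contDiff_gradRho_apply).contDiffAt (x := z)
  have htrH := (contDiff_tr contDiff_hessRho_apply).contDiffAt (x := z)
  have htrL := (contDiff_tr contDiff_L_apply).contDiffAt (x := z)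
  have hgij := ((contDiff_gradRho_apply i).mul (contDiff_gradRho_apply j)).contDiffAt (x := z)
  exact ((((((hm.p.contDiffAt_state hD hz).neg.add
    ((hm.α1.contDiffAt_state hD hz).mul htrH)).add
    ((hm.α2.contDiffAt_state hD hz).mul hgg)).mul contDiffAt_const).add
    ((hm.α3.contDiffAt_state hD hz).mul hgij)).add
    ((hm.α4.contDiffAt_state hD hz).mul (contDiff_hessRho_apply i j).contDiffAt)).add
    (((hm.α5.contDiffAt_state hD hz).mul htrL).mul contDiffAt_const) |>.add
    ((hm.α6.contDiffAt_state hD hz).mul (contDiff_L_apply i j).contDiffAt)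

theorem contDiffAt_heatFlux (hD : IsOpen D) (hm : m.SmoothOn D) (hz : z ∈ State.region D)
    (i : Fin 3) : ContDiffAt ℝ ∞ (fun z => m.heatFlux z i) z := by
  unfold MaterialFunctions.heatFlux
  exact ((hm.q1.contDiffAt_state hD hz).mul (contDiff_gradEps_apply i).contDiffAt).add
    ((hm.q2.contDiffAt_state hD hz).mul (contDiff_gradRho_apply i).contDiffAt)

theorem contDiffAt_entropy (hD : IsOpen D) (hm : m.SmoothOn D) (hz : z ∈ State.region D) :
    ContDiffAt ℝ ∞ m.entropy z := by
  unfold MaterialFunctions.entropy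
  have hg := contDiff_gradRho_apply
  have he := contDiff_gradEps_apply
  exact (((((hm.s0.contDiffAt_state hD hz).add
    ((hm.s1.contDiffAt_state hD hz).mul (contDiff_dot hg hg).contDiffAt)).add
    ((hm.s2.contDiffAt_state hD hz).mul (contDiff_dot hg he).contDiffAt)).add
    ((hm.s3.contDiffAt_state hD hz).mul (contDiff_dot he he).contDiffAt)).add
    ((hm.s4.contDiffAt_state hD hz).mul (contDiff_tr contDiff_L_apply).contDiffAt)).add
    ((hm.s5.contDiffAt_state hD hz).mul (contDiff_tr contDiff_hessRho_apply).contDiffAt)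

end Smoothness

section Balances

variable {D : Set (ℝ × ℝ)} {m : MaterialFunctions} {w : Fields} {y : SpaceTime}

theorem contDiff_massBalance (hw : w.Smooth) : ContDiff ℝ ∞ w.massBalance :=
  (contDiff_dt hw.rho).add (ContDiff.sum fun j _ => contDiff_dx (hw.rho.mul (hw.v_apply j)) j)

theorem massBalance_eq (hw : w.Smooth) (t : ℝ) (x : V) :
    w.massBalance (t, x) = dt w.rho (t, x) - (w.slice t).densityRate x := by
  have hdiv : ∀ j, dx j (fun y => w.rho y * w.v y j) (t, x) = _ := fun j =>
    dx_eq_pd ((hw.rho.mul (hw.v_apply j)).differentiable (by simp) _) j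
  simp only [Fields.massBalance, Profile.densityRate, hdiv, Fields.slice, sub_neg_eq_add]

theorem contDiff_materialDeriv {f : SpaceTime → ℝ} (hw : w.Smooth) (hf : ContDiff ℝ ∞ f) :
    ContDiff ℝ ∞ (w.materialDeriv f) :=
  (contDiff_dt hf).add (ContDiff.sum fun j _ => (hw.v_apply j).mul (contDiff_dx hf j))

theorem materialDeriv_eq {f : SpaceTime → ℝ} {t : ℝ} {x : V}
    (hf : DifferentiableAt ℝ f (t, x)) : w.materialDeriv f (t, x)
      = dt f (t, x) + ∑ j, (w.slice t).v x j * pd j (fun x' => f (t, x')) x := by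
  simp only [Fields.materialDeriv, dx_eq_pd hf, Fields.slice]

theorem contDiffAt_stress_state (hD : IsOpen D) (hm : m.SmoothOn D) (hw : w.Smooth)
    (hy : (w.rho y, w.eps y) ∈ D) (i j : Fin 3) :
    ContDiffAt ℝ ∞ (fun y => m.stress (w.state y) i j) y :=
  ContDiffAt.comp (g := fun z => m.stress z i j) y
    (contDiffAt_stress (z := w.state y) hD hm hy i j) hw.state.contDiffAt

theorem contDiffAt_heatFlux_state (hD : IsOpen D) (hm : m.SmoothOn D) (hw : w.Smooth)
    (hy : (w.rho y, w.eps y) ∈ D) (j : Fin 3) :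
    ContDiffAt ℝ ∞ (fun y => m.heatFlux (w.state y) j) y :=
  ContDiffAt.comp (g := fun z => m.heatFlux z j) y
    (contDiffAt_heatFlux (z := w.state y) hD hm hy j) hw.state.contDiffAt

theorem contDiffAt_momentumBalance (hD : IsOpen D) (hm : m.SmoothOn D) (hw : w.Smooth)
    (hy : (w.rho y, w.eps y) ∈ D) (i : Fin 3) :
    ContDiffAt ℝ ∞ (fun y => w.momentumBalance m y i) y :=
  (hw.rho.mul (contDiff_materialDeriv hw (hw.v_apply i))).contDiffAt.sub
    (ContDiffAt.sum fun j _ => contDiffAt_dx (contDiffAt_stress_state hD hm hw hy i j) j)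

theorem contDiffAt_energyBalance (hD : IsOpen D) (hm : m.SmoothOn D) (hw : w.Smooth)
    (hy : (w.rho y, w.eps y) ∈ D) : ContDiffAt ℝ ∞ (w.energyBalance m) y :=
  ((hw.rho.mul (contDiff_materialDeriv hw hw.eps)).contDiffAt.sub
    (ContDiffAt.sum fun i _ => ContDiffAt.sum fun j _ =>
      (contDiffAt_stress_state hD hm hw hy i j).mul
        (contDiff_dx (hw.v_apply i) j).contDiffAt)).add
    (ContDiffAt.sum fun j _ => contDiffAt_dx (contDiffAt_heatFlux_state hD hm hw hy j) j)

variable {t : ℝ} {x : V}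

theorem momentumBalance_eq (hD : IsOpen D) (hm : m.SmoothOn D) (hw : w.Smooth)
    (hx : (w.rho (t, x), w.eps (t, x)) ∈ D) (hρ : w.rho (t, x) ≠ 0) (i : Fin 3) :
    w.momentumBalance m (t, x) i
      = w.rho (t, x) * (dt (fun y => w.v y i) (t, x) - (w.slice t).velocityRate m x i) := by
  have hstress : ∀ j, dx j (fun y => m.stress (w.state y) i j) (t, x) = _ := fun j =>
    dx_eq_pd ((contDiffAt_stress_state hD hm hw hx i j).differentiableAt (by simp)) j
  simp only [Fields.momentumBalance, hstress]
  simp only [Fields.state_eq_jet hw, Profile.velocityRate,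
    materialDeriv_eq ((hw.v_apply i).differentiable (by simp) (t, x)), Fields.slice]
  field_simp
  ring

theorem energyBalance_eq (hD : IsOpen D) (hm : m.SmoothOn D) (hw : w.Smooth)
    (hx : (w.rho (t, x), w.eps (t, x)) ∈ D) (hρ : w.rho (t, x) ≠ 0) :
    w.energyBalance m (t, x)
      = w.rho (t, x) * (dt w.eps (t, x) - (w.slice t).energyRate m x) := by
  have hheat : ∀ j, dx j (fun y => m.heatFlux (w.state y) j) (t, x) = _ := fun j =>
    dx_eq_pd ((contDiffAt_heatFlux_state hD hm hw hx j).differentiableAt (by simp)) j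
  simp only [Fields.energyBalance, hheat]
  simp only [Fields.state_eq_jet hw, Profile.energyRate,
    materialDeriv_eq (hw.eps.differentiable (by simp) (t, x)), Fields.gradV_eq_pd hw,
    Fields.slice]
  field_simp
  ring

end Balances

section Reduction

variable {D : Set (ℝ × ℝ)} {m : MaterialFunctions} {P : Profile} {x : V}

theorem contDiffAt_stress_jet (hD : IsOpen D) (hm : m.SmoothOn D) (hP : P.Smooth)
    (hx : (P.rho x, P.eps x) ∈ D) (i j : Fin 3) :
    ContDiffAt ℝ ∞ (fun x => m.stress (P.jet x) i j) x :=
  ContDiffAt.comp (g := fun z => m.stress z i j) x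
    (contDiffAt_stress (z := P.jet x) hD hm hx i j) hP.jet.contDiffAt

theorem contDiffAt_heatFlux_jet (hD : IsOpen D) (hm : m.SmoothOn D) (hP : P.Smooth)
    (hx : (P.rho x, P.eps x) ∈ D) (j : Fin 3) :
    ContDiffAt ℝ ∞ (fun x => m.heatFlux (P.jet x) j) x :=
  ContDiffAt.comp (g := fun z => m.heatFlux z j) x
    (contDiffAt_heatFlux (z := P.jet x) hD hm hx j) hP.jet.contDiffAt

theorem contDiffAt_velocityRate (hD : IsOpen D) (hm : m.SmoothOn D) (hP : P.Smooth)
    (hx : (P.rho x, P.eps x) ∈ D) (hρ : P.rho x ≠ 0) (i : Fin 3) :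
    ContDiffAt ℝ ∞ (fun x => P.velocityRate m x i) x :=
  ((ContDiffAt.sum fun j _ => contDiffAt_pd
    (contDiffAt_stress_jet hD hm hP hx i j) j).div hP.rho.contDiffAt hρ).sub
    (ContDiff.sum fun j _ => (hP.v j).mul (contDiff_pd (hP.v i) j)).contDiffAt

theorem contDiffAt_energyRate (hD : IsOpen D) (hm : m.SmoothOn D) (hP : P.Smooth)
    (hx : (P.rho x, P.eps x) ∈ D) (hρ : P.rho x ≠ 0) :
    ContDiffAt ℝ ∞ (P.energyRate m) x :=
  (((ContDiffAt.sum fun i _ => ContDiffAt.sum fun j _ =>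
      (contDiffAt_stress_jet hD hm hP hx i j).mul
        (contDiff_pd (hP.v i) j).contDiffAt).sub
    (ContDiffAt.sum fun j _ => contDiffAt_pd
      (contDiffAt_heatFlux_jet hD hm hP hx j) j)).div hP.rho.contDiffAt hρ).sub
    (ContDiff.sum fun j _ => (hP.v j).mul (contDiff_pd hP.eps j)).contDiffAt

theorem eventually_mem_and_rho_ne_zero (hD : IsOpen D) (hP : P.Smooth)
    (h0 : (P.rho 0, P.eps 0) ∈ D) (hρ : P.rho 0 ≠ 0) :
    ∀ᶠ x in nhds (0 : V), (P.rho x, P.eps x) ∈ D ∧ P.rho x ≠ 0 :=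
  ((hP.rho.continuous.prodMk hP.eps.continuous).continuousAt.eventually_mem
    (hD.mem_nhds h0)).and (hP.rho.continuous.continuousAt.eventually_ne hρ)

/-- The fields through `P` that satisfy the balance of mass, its first two gradients, the balances
of momentum and energy, and their first gradients at the origin of space-time. -/
noncomputable def balancedFields (m : MaterialFunctions) (P : Profile) : Fields :=
  P.toFields (P.tangentRates m)

theorem balancedFields_smooth (m : MaterialFunctions) (hP : P.Smooth) :
    (balancedFields m P).Smooth := hP.toFields (hP.tangentRates m)

theorem slice_balancedFields (m : MaterialFunctions) (P : Profile) :
    (balancedFields m P).slice 0 = P := Profile.slice_toFields_zero P _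

theorem rho_balancedFields (m : MaterialFunctions) (P : Profile) (x : V) :
    (balancedFields m P).rho (0, x) = P.rho x :=
  congrFun (congrArg Profile.rho (slice_balancedFields m P)) x

theorem v_balancedFields (m : MaterialFunctions) (P : Profile) (x : V) :
    (balancedFields m P).v (0, x) = P.v x :=
  congrFun (congrArg Profile.v (slice_balancedFields m P)) x

theorem eps_balancedFields (m : MaterialFunctions) (P : Profile) (x : V) :
    (balancedFields m P).eps (0, x) = P.eps x :=
  congrFun (congrArg Profile.eps (slice_balancedFields m P)) x

theorem state_balancedFields (m : MaterialFunctions) (hP : P.Smooth) (t : ℝ) (x : V) :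
    (balancedFields m P).state (t, x) = P.jet x + t • (P.tangentRates m).jet x :=
  Profile.state_toFields hP (hP.tangentRates m) t x

theorem state_balancedFields_zero (m : MaterialFunctions) (hP : P.Smooth) (x : V) :
    (balancedFields m P).state (0, x) = P.jet x := by
  rw [state_balancedFields m hP, zero_smul, add_zero]

theorem massBalance_balancedFields (m : MaterialFunctions) (hP : P.Smooth) (x : V) :
    (balancedFields m P).massBalance (0, x) = 0 := by
  rw [massBalance_eq (balancedFields_smooth m hP), slice_balancedFields, balancedFields,
    Profile.dt_toFields_rho hP (hP.tangentRates m), Profile.tangentRates, sub_self]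

theorem dx_massBalance_balancedFields (m : MaterialFunctions) (hP : P.Smooth) (k : Fin 3)
    (x : V) : dx k (balancedFields m P).massBalance (0, x) = 0 := by
  rw [dx_eq_pd ((contDiff_massBalance (balancedFields_smooth m hP)).differentiable (by simp) _)]
  simp only [massBalance_balancedFields m hP, pd_const]

theorem dx_dx_massBalance_balancedFields (m : MaterialFunctions) (hP : P.Smooth) (i k : Fin 3)
    (x : V) : dx k (dx i (balancedFields m P).massBalance) (0, x) = 0 := by
  rw [dx_eq_pd ((contDiff_dx (contDiff_massBalance (balancedFields_smooth m hP)) i).differentiable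
    (by simp) _)]
  simp only [dx_massBalance_balancedFields m hP, pd_const]

theorem momentumBalance_balancedFields (hD : IsOpen D) (hm : m.SmoothOn D) (hP : P.Smooth)
    (hx : (P.rho x, P.eps x) ∈ D) (hρ : P.rho x ≠ 0) (i : Fin 3) :
    (balancedFields m P).momentumBalance m (0, x) i
      = P.rho x * (tangentAt (fun x => P.velocityRate m x i) x - P.velocityRate m x i) := by
  rw [momentumBalance_eq hD hm (balancedFields_smooth m hP)
    (by rwa [rho_balancedFields, eps_balancedFields]) (by rwa [rho_balancedFields]),
    slice_balancedFields, rho_balancedFields, balancedFields,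
    Profile.dt_toFields_v hP (hP.tangentRates m), Profile.tangentRates]

theorem energyBalance_balancedFields (hD : IsOpen D) (hm : m.SmoothOn D) (hP : P.Smooth)
    (hx : (P.rho x, P.eps x) ∈ D) (hρ : P.rho x ≠ 0) :
    (balancedFields m P).energyBalance m (0, x)
      = P.rho x * (tangentAt (P.energyRate m) x - P.energyRate m x) := by
  rw [energyBalance_eq hD hm (balancedFields_smooth m hP)
    (by rwa [rho_balancedFields, eps_balancedFields]) (by rwa [rho_balancedFields]),
    slice_balancedFields, rho_balancedFields, balancedFields,
    Profile.dt_toFields_eps hP (hP.tangentRates m), Profile.tangentRates]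

theorem dx_momentumBalance_balancedFields (hD : IsOpen D) (hm : m.SmoothOn D) (hP : P.Smooth)
    (h0 : (P.rho 0, P.eps 0) ∈ D) (hρ : P.rho 0 ≠ 0) (i k : Fin 3) :
    dx k (fun y => (balancedFields m P).momentumBalance m y i) (0, 0) = 0 := by
  have hsmooth := contDiffAt_momentumBalance hD hm (balancedFields_smooth m hP) (y := (0, 0))
    (by rwa [rho_balancedFields, eps_balancedFields]) i
  have hnear := (eventually_mem_and_rho_ne_zero hD hP h0 hρ).mono fun x hx =>
    momentumBalance_balancedFields hD hm hP hx.1 hx.2 i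
  rw [dx_eq_pd (hsmooth.differentiableAt (by simp)), pd_congr hnear]
  exact pd_mul_tangentAt_sub (hP.rho.differentiable (by simp) 0)
    ((contDiffAt_velocityRate hD hm hP h0 hρ i).differentiableAt (by simp)) k

theorem dx_energyBalance_balancedFields (hD : IsOpen D) (hm : m.SmoothOn D) (hP : P.Smooth)
    (h0 : (P.rho 0, P.eps 0) ∈ D) (hρ : P.rho 0 ≠ 0) (k : Fin 3) :
    dx k ((balancedFields m P).energyBalance m) (0, 0) = 0 := by
  have hsmooth := contDiffAt_energyBalance hD hm (balancedFields_smooth m hP) (y := (0, 0))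
    (by rwa [rho_balancedFields, eps_balancedFields])
  have hnear := (eventually_mem_and_rho_ne_zero hD hP h0 hρ).mono fun x hx =>
    energyBalance_balancedFields hD hm hP hx.1 hx.2
  rw [dx_eq_pd (hsmooth.differentiableAt (by simp)), pd_congr hnear]
  exact pd_mul_tangentAt_sub (hP.rho.differentiable (by simp) 0)
    ((contDiffAt_energyRate hD hm hP h0 hρ).differentiableAt (by simp)) k

theorem extendedProduction_balancedFields (hD : IsOpen D) (hm : m.SmoothOn D) (hP : P.Smooth)
    (h0 : (P.rho 0, P.eps 0) ∈ D) (hρ : P.rho 0 ≠ 0) (J : State → V) (μ : Multipliers) :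
    extendedProduction m J μ (balancedFields m P) (0, 0)
      = (balancedFields m P).entropyProduction m J (0, 0) := by
  have hmomentum : (balancedFields m P).momentumBalance m (0, 0) = fun _ => 0 := by
    funext i
    rw [momentumBalance_balancedFields hD hm hP h0 hρ, tangentAt_zero, sub_self, mul_zero]
  have henergy : (balancedFields m P).energyBalance m (0, 0) = 0 := by
    rw [energyBalance_balancedFields hD hm hP h0 hρ, tangentAt_zero, sub_self, mul_zero]
  simp only [extendedProduction, hmomentum, henergy, massBalance_balancedFields m hP,
    dx_massBalance_balancedFields m hP, dx_dx_massBalance_balancedFields m hP,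
    dx_momentumBalance_balancedFields hD hm hP h0 hρ,
    dx_energyBalance_balancedFields hD hm hP h0 hρ, dot, ddot, mul_zero, Finset.sum_const_zero,
    sub_zero]

theorem dt_entropy_balancedFields (hD : IsOpen D) (hm : m.SmoothOn D) (hP : P.Smooth)
    (h0 : (P.rho 0, P.eps 0) ∈ D) :
    dt (fun y => m.entropy ((balancedFields m P).state y)) (0, 0)
      = fderiv ℝ m.entropy (P.jet 0) ((P.rates m).jet 0) := by
  have hentropy : DifferentiableAt ℝ m.entropy (P.jet 0) :=
    (contDiffAt_entropy hD hm (z := P.jet 0) h0).differentiableAt (by simp)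
  have hstate : DifferentiableAt ℝ (balancedFields m P).state (0, 0) :=
    (balancedFields_smooth m hP).state.differentiable (by simp) _
  have hline : HasDerivAt (fun t : ℝ => P.jet 0 + t • (P.rates m).jet 0) ((P.rates m).jet 0) 0 := by
    simpa using ((hasDerivAt_id (0 : ℝ)).smul_const ((P.rates m).jet 0)).const_add (P.jet 0)
  have hcomp : DifferentiableAt ℝ (fun y => m.entropy ((balancedFields m P).state y)) (0, 0) :=
    DifferentiableAt.comp (g := m.entropy) _ (by rwa [state_balancedFields_zero m hP]) hstate
  rw [dt_eq_deriv hcomp]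
  simp only [state_balancedFields m hP, Profile.jet_tangentRates_zero]
  exact (HasFDerivAt.comp_hasDerivAt_of_eq (0 : ℝ) hentropy.hasFDerivAt hline (by simp)).deriv

theorem dx_flux_balancedFields (hD : IsOpen D) {J : State → V}
    (hJ : ContDiffOn ℝ ∞ J (State.region D)) (hP : P.Smooth) (h0 : (P.rho 0, P.eps 0) ∈ D)
    (j : Fin 3) : dx j (fun y => J ((balancedFields m P).state y) j) (0, 0)
      = pd j (fun x => J (P.jet x) j) 0 := by
  have hflux : DifferentiableAt ℝ J ((balancedFields m P).state (0, 0)) := by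
    rw [state_balancedFields_zero m hP]
    exact (hJ.contDiffAt ((isOpen_region hD).mem_nhds h0)).differentiableAt (by simp)
  have hcomp : DifferentiableAt ℝ (fun y => J ((balancedFields m P).state y)) (0, 0) :=
    hflux.comp _ ((balancedFields_smooth m hP).state.differentiable (by simp) _)
  rw [dx_eq_pd (differentiableAt_pi.1 hcomp j)]
  simp only [state_balancedFields_zero m hP]

theorem reduced_entropy_inequality (hD : IsOpen D) (hm : m.SmoothOn D) {J : State → V}
    (hJ : ContDiffOn ℝ ∞ J (State.region D)) (hent : ExtendedEntropyPrinciple D m J)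
    (hP : P.Smooth) (hv : P.v 0 = 0) (h0 : (P.rho 0, P.eps 0) ∈ D) (hρ : P.rho 0 ≠ 0) :
    0 ≤ P.rho 0 * fderiv ℝ m.entropy (P.jet 0) ((P.rates m).jet 0)
      + ∑ j, pd j (fun x => J (P.jet x) j) 0 := by
  obtain ⟨μ, hμ⟩ := hent
  have hineq := hμ (balancedFields m P) (balancedFields_smooth m hP) (0, 0)
    (by rwa [rho_balancedFields, eps_balancedFields])
  simpa only [extendedProduction_balancedFields hD hm hP h0 hρ, Fields.entropyProduction,
    Fields.materialDeriv, rho_balancedFields, v_balancedFields, hv, Pi.zero_apply, zero_mul,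
    Finset.sum_const_zero, add_zero, dt_entropy_balancedFields hD hm hP h0,
    dx_flux_balancedFields hD hJ hP h0] using hineq

end Reduction

section PartialDerivatives

variable {D : Set (ℝ × ℝ)} {f : ℝ → ℝ → ℝ} {ρ ε : ℝ}

theorem Smooth2.hasFDerivAt (hD : IsOpen D) (hf : Smooth2 D f) (h : (ρ, ε) ∈ D) :
    HasFDerivAt (fun z : ℝ × ℝ => f z.1 z.2)
      (dRho f ρ ε • ContinuousLinearMap.fst ℝ ℝ ℝ + dEps f ρ ε • ContinuousLinearMap.snd ℝ ℝ ℝ)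
      (ρ, ε) := by
  have hfd := ((hf.contDiffAt hD h).differentiableAt (by simp)).hasFDerivAt
  have hr : dRho f ρ ε = fderiv ℝ (fun z : ℝ × ℝ => f z.1 z.2) (ρ, ε) (1, 0) :=
    (hfd.comp_hasDerivAt (f := fun r : ℝ => ((r, ε) : ℝ × ℝ)) ρ
      ((hasDerivAt_id ρ).prodMk (hasDerivAt_const ρ ε))).deriv
  have he : dEps f ρ ε = fderiv ℝ (fun z : ℝ × ℝ => f z.1 z.2) (ρ, ε) (0, 1) :=
    (hfd.comp_hasDerivAt (f := fun e : ℝ => ((ρ, e) : ℝ × ℝ)) ε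
      ((hasDerivAt_const ε ρ).prodMk (hasDerivAt_id ε))).deriv
  refine hfd.congr_fderiv ?_
  ext <;> simp [hr, he]

theorem Smooth2.hasDerivAt (hD : IsOpen D) (hf : Smooth2 D f) {a b : ℝ → ℝ} {a' b' t : ℝ}
    (ha : HasDerivAt a a' t) (hb : HasDerivAt b b' t) (h : (a t, b t) ∈ D) :
    HasDerivAt (fun s => f (a s) (b s))
      (dRho f (a t) (b t) * a' + dEps f (a t) (b t) * b') t :=
  ((hf.hasFDerivAt hD h).comp_hasDerivAt (f := fun s => (a s, b s)) t
    (ha.prodMk hb)).congr_deriv (by simp)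

theorem Smooth2.contDiffOn_fderiv_apply (hD : IsOpen D) (hf : Smooth2 D f) (y : ℝ × ℝ) :
    ContDiffOn ℝ ∞ (fun z => fderiv ℝ (fun z : ℝ × ℝ => f z.1 z.2) z y) D :=
  (ContDiffOn.fderiv_of_isOpen (m := ∞) hf hD (by simp)).clm_apply contDiffOn_const

theorem Smooth2.dRho (hD : IsOpen D) (hf : Smooth2 D f) : Smooth2 D (dRho f) :=
  (hf.contDiffOn_fderiv_apply hD (1, 0)).congr fun z hz => by
    simp [(hf.hasFDerivAt (ρ := z.1) (ε := z.2) hD hz).fderiv]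

theorem Smooth2.dEps (hD : IsOpen D) (hf : Smooth2 D f) : Smooth2 D (dEps f) :=
  (hf.contDiffOn_fderiv_apply hD (0, 1)).congr fun z hz => by
    simp [(hf.hasFDerivAt (ρ := z.1) (ε := z.2) hD hz).fderiv]

theorem dRho_eq_zero (hD : IsOpen D) (h : ∀ ρ ε, (ρ, ε) ∈ D → f ρ ε = 0) (hz : (ρ, ε) ∈ D) :
    dRho f ρ ε = 0 := by
  have hnear : ∀ᶠ r in nhds ρ, (r, ε) ∈ D :=
    (by fun_prop : Continuous fun r : ℝ => (r, ε)).continuousAt.preimage_mem_nhds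
      (hD.mem_nhds hz)
  have hzero : (fun r => f r ε) =ᶠ[nhds ρ] fun _ => 0 := hnear.mono fun r hr => h r ε hr
  simp [Korteweg.dRho, hzero.deriv_eq]

theorem dEps_eq_zero (hD : IsOpen D) (h : ∀ ρ ε, (ρ, ε) ∈ D → f ρ ε = 0) (hz : (ρ, ε) ∈ D) :
    dEps f ρ ε = 0 := by
  have hnear : ∀ᶠ e in nhds ε, (ρ, e) ∈ D :=
    (by fun_prop : Continuous fun e : ℝ => (ρ, e)).continuousAt.preimage_mem_nhds
      (hD.mem_nhds hz)
  have hzero : (fun e => f ρ e) =ᶠ[nhds ε] fun _ => 0 := hnear.mono fun e he => h ρ e he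
  simp [Korteweg.dEps, hzero.deriv_eq]

theorem Smooth2.eq_zero_of_mul_eq_zero (hD : IsOpen D) (hf : Smooth2 D f) {A : ℝ × ℝ → ℝ}
    (hA : D ⊆ closure {z | z ∈ D ∧ A z ≠ 0}) (h : ∀ ρ ε, (ρ, ε) ∈ D → f ρ ε * A (ρ, ε) = 0)
    (hz : (ρ, ε) ∈ D) : f ρ ε = 0 := by
  by_contra hne
  have hnear : ∀ᶠ z : ℝ × ℝ in nhds (ρ, ε), f z.1 z.2 ≠ 0 :=
    (hf.contDiffAt hD hz).continuousAt.eventually_ne hne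
  obtain ⟨z, ⟨hzD, hAz⟩, hfz⟩ :=
    ((mem_closure_iff_frequently.1 (hA hz)).and_eventually hnear).exists
  exact mul_ne_zero hfz hAz (h z.1 z.2 hzD)

theorem fderiv_entropy {m : MaterialFunctions} (hD : IsOpen D) (hm : m.SmoothOn D) {z : State}
    (hz : z ∈ State.region D) (y : State) :
    fderiv ℝ m.entropy z y
      = (dRho m.s0 z.rho z.eps + dRho m.s1 z.rho z.eps * dot z.gradRho z.gradRho
          + dRho m.s2 z.rho z.eps * dot z.gradRho z.gradEps
          + dRho m.s3 z.rho z.eps * dot z.gradEps z.gradEps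
          + dRho m.s4 z.rho z.eps * tr z.L + dRho m.s5 z.rho z.eps * tr z.hessRho) * y.rho
        + (dEps m.s0 z.rho z.eps + dEps m.s1 z.rho z.eps * dot z.gradRho z.gradRho
          + dEps m.s2 z.rho z.eps * dot z.gradRho z.gradEps
          + dEps m.s3 z.rho z.eps * dot z.gradEps z.gradEps
          + dEps m.s4 z.rho z.eps * tr z.L + dEps m.s5 z.rho z.eps * tr z.hessRho) * y.eps
        + 2 * m.s1 z.rho z.eps * dot z.gradRho y.gradRho
        + m.s2 z.rho z.eps * (dot y.gradRho z.gradEps + dot z.gradRho y.gradEps)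
        + 2 * m.s3 z.rho z.eps * dot z.gradEps y.gradEps
        + m.s4 z.rho z.eps * tr y.L + m.s5 z.rho z.eps * tr y.hessRho := by
  have hline (c d : ℝ) : HasDerivAt (fun t : ℝ => c + t * d) d 0 := by
    simpa using ((hasDerivAt_id (0 : ℝ)).mul_const d).const_add c
  have hdot (a a' b b' : V) : HasDerivAt (fun t : ℝ => dot (a + t • a') (b + t • b'))
      (dot a' b + dot a b') 0 :=
    (HasDerivAt.fun_sum fun i _ => (hline (a i) (a' i)).fun_mul (hline (b i) (b' i))).congr_deriv
      (by simp [dot, Finset.sum_add_distrib])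
  have htr (A A' : T2) : HasDerivAt (fun t : ℝ => tr (A + t • A')) (tr A') 0 :=
    HasDerivAt.fun_sum fun i _ => hline (A i i) (A' i i)
  have hcoeff (f : ℝ → ℝ → ℝ) (hf : Smooth2 D f) :
      HasDerivAt (fun t : ℝ => f (z.rho + t * y.rho) (z.eps + t * y.eps))
        (dRho f z.rho z.eps * y.rho + dEps f z.rho z.eps * y.eps) 0 :=
    (hf.hasDerivAt hD (hline z.rho y.rho) (hline z.eps y.eps)
      (by simpa using show (z.rho, z.eps) ∈ D from hz)).congr_deriv (by simp)
  have hentropy : HasDerivAt (fun t : ℝ => m.entropy (z + t • y)) _ 0 :=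
    (((((hcoeff _ hm.s0).fun_add
      ((hcoeff _ hm.s1).fun_mul (hdot z.gradRho y.gradRho z.gradRho y.gradRho))).fun_add
      ((hcoeff _ hm.s2).fun_mul (hdot z.gradRho y.gradRho z.gradEps y.gradEps))).fun_add
      ((hcoeff _ hm.s3).fun_mul (hdot z.gradEps y.gradEps z.gradEps y.gradEps))).fun_add
      ((hcoeff _ hm.s4).fun_mul (htr z.L y.L))).fun_add
      ((hcoeff _ hm.s5).fun_mul (htr z.hessRho y.hessRho))
  have hchain : HasDerivAt (fun t : ℝ => m.entropy (z + t • y)) (fderiv ℝ m.entropy z y) 0 :=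
    ((contDiffAt_entropy hD hm hz).differentiableAt (by simp)).hasFDerivAt.hasLineDerivAt y
  rw [hchain.unique hentropy]
  simp only [zero_mul, zero_smul, add_zero, dot, Fin.sum_univ_three]
  ring

end PartialDerivatives

section Line

/-- The state of a profile that depends on the first coordinate only, with the velocity in the
direction of that coordinate. -/
def lineState (ρ ε g l e h : ℝ) : State :=
  (ρ, ε, fun i => g * delta i 0, fun i j => l * (delta i 0 * delta j 0),
    fun i => e * delta i 0, fun i j => h * (delta i 0 * delta j 0))

theorem lineState_add (ρ ε g l e h ρ' ε' g' l' e' h' : ℝ) :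
    lineState ρ ε g l e h + lineState ρ' ε' g' l' e' h'
      = lineState (ρ + ρ') (ε + ε') (g + g') (l + l') (e + e') (h + h') := by
  simp only [lineState, Prod.mk_add_mk, Prod.mk.injEq, true_and]
  refine ⟨?_, ?_, ?_, ?_⟩ <;> ext <;> simp <;> ring

theorem smul_lineState (t ρ ε g l e h : ℝ) :
    t • lineState ρ ε g l e h = lineState (t * ρ) (t * ε) (t * g) (t * l) (t * e) (t * h) := by
  simp only [lineState, Prod.smul_mk, smul_eq_mul, Prod.mk.injEq, true_and]
  refine ⟨?_, ?_, ?_, ?_⟩ <;> ext <;> simp <;> ring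

theorem lineState_zero : lineState 0 0 0 0 0 0 = 0 := by
  simpa using (smul_lineState 0 0 0 0 0 0 0).symm

theorem hasDerivAt_lineState {a b g l e h : ℝ → ℝ} {a' b' g' l' e' h' s : ℝ}
    (ha : HasDerivAt a a' s) (hb : HasDerivAt b b' s) (hg : HasDerivAt g g' s)
    (hl : HasDerivAt l l' s) (he : HasDerivAt e e' s) (hh : HasDerivAt h h' s) :
    HasDerivAt (fun s => lineState (a s) (b s) (g s) (l s) (e s) (h s))
      (lineState a' b' g' l' e' h') s :=
  ha.prodMk <| hb.prodMk <| (hasDerivAt_pi.2 fun _ => hg.mul_const _).prodMk <|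
    (hasDerivAt_pi.2 fun _ => hasDerivAt_pi.2 fun _ => hl.mul_const _).prodMk <|
    (hasDerivAt_pi.2 fun _ => he.mul_const _).prodMk <|
    hasDerivAt_pi.2 fun _ => hasDerivAt_pi.2 fun _ => hh.mul_const _

/-- The coefficient of `∂²ρ` in the stress of a one-dimensional motion. -/
def capillaryModulus (m : MaterialFunctions) (ρ ε : ℝ) : ℝ := m.α1 ρ ε + m.α4 ρ ε

/-- The coefficient of `(∂ρ)²` in the stress of a one-dimensional motion. -/
def gradientModulus (m : MaterialFunctions) (ρ ε : ℝ) : ℝ := m.α2 ρ ε + m.α3 ρ ε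

/-- The coefficient of `∂v` in the stress of a one-dimensional motion. -/
def viscousModulus (m : MaterialFunctions) (ρ ε : ℝ) : ℝ := m.α5 ρ ε + m.α6 ρ ε

/-- The normal stress `T₀₀` in the state `lineState ρ ε g l e h`, whatever `e`. -/
def normalStress (m : MaterialFunctions) (ρ ε g l h : ℝ) : ℝ :=
  -m.p ρ ε + capillaryModulus m ρ ε * h + gradientModulus m ρ ε * g ^ 2 + viscousModulus m ρ ε * l

theorem MaterialFunctions.SmoothOn.capillaryModulus {D : Set (ℝ × ℝ)} {m : MaterialFunctions}
    (hm : m.SmoothOn D) : Smooth2 D (capillaryModulus m) := ContDiffOn.add hm.α1 hm.α4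

theorem MaterialFunctions.SmoothOn.gradientModulus {D : Set (ℝ × ℝ)} {m : MaterialFunctions}
    (hm : m.SmoothOn D) : Smooth2 D (gradientModulus m) := ContDiffOn.add hm.α2 hm.α3

theorem MaterialFunctions.SmoothOn.viscousModulus {D : Set (ℝ × ℝ)} {m : MaterialFunctions}
    (hm : m.SmoothOn D) : Smooth2 D (viscousModulus m) := ContDiffOn.add hm.α5 hm.α6

theorem stress_lineState (m : MaterialFunctions) (ρ ε g l e h : ℝ) (i : Fin 3) :
    m.stress (lineState ρ ε g l e h) i 0 = normalStress m ρ ε g l h * delta i 0 := by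
  simp only [normalStress, capillaryModulus, gradientModulus, viscousModulus,
    MaterialFunctions.stress, lineState, State.rho, State.eps, State.gradRho, State.L,
    State.hessRho, tr, dot, delta, Fin.sum_univ_three, Fin.reduceEq, reduceIte]
  split_ifs <;> ring

theorem heatFlux_lineState (m : MaterialFunctions) (ρ ε g l e h : ℝ) (i : Fin 3) :
    m.heatFlux (lineState ρ ε g l e h) i = (m.q1 ρ ε * e + m.q2 ρ ε * g) * delta i 0 := by
  simp only [MaterialFunctions.heatFlux, lineState, State.rho, State.eps, State.gradRho,
    State.gradEps]
  ring

theorem fderiv_entropy_lineState {D : Set (ℝ × ℝ)} {m : MaterialFunctions} (hD : IsOpen D)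
    (hm : m.SmoothOn D) {ρ ε : ℝ} (hz : (ρ, ε) ∈ D) (g l e h R Φ R₁ Ψ₁ Φ₁ R₂ : ℝ) :
    fderiv ℝ m.entropy (lineState ρ ε g l e h) (lineState R Φ R₁ Ψ₁ Φ₁ R₂)
      = (dRho m.s0 ρ ε + dRho m.s1 ρ ε * g ^ 2 + dRho m.s2 ρ ε * (g * e)
          + dRho m.s3 ρ ε * e ^ 2 + dRho m.s4 ρ ε * l + dRho m.s5 ρ ε * h) * R
        + (dEps m.s0 ρ ε + dEps m.s1 ρ ε * g ^ 2 + dEps m.s2 ρ ε * (g * e)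
          + dEps m.s3 ρ ε * e ^ 2 + dEps m.s4 ρ ε * l + dEps m.s5 ρ ε * h) * Φ
        + (2 * m.s1 ρ ε * g + m.s2 ρ ε * e) * R₁ + (m.s2 ρ ε * g + 2 * m.s3 ρ ε * e) * Φ₁
        + m.s4 ρ ε * Ψ₁ + m.s5 ρ ε * R₂ := by
  rw [fderiv_entropy hD hm hz]
  simp only [lineState, State.rho, State.eps, State.gradRho, State.L, State.gradEps,
    State.hessRho, dot, tr, delta, Fin.sum_univ_three, Fin.reduceEq, reduceIte]
  ring

theorem pd_line (f : ℝ → ℝ) (i : Fin 3) (x : V) :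
    pd i (fun x => f (x 0)) x = deriv f (x 0) * delta i 0 := by
  by_cases hf : DifferentiableAt ℝ f (x 0)
  · have hcomp := hf.hasDerivAt.comp_hasFDerivAt x
      (ContinuousLinearMap.proj (R := ℝ) (φ := fun _ : Fin 3 => ℝ) 0).hasFDerivAt
    have hfd : fderiv ℝ (fun x : V => f (x 0)) x = _ := hcomp.fderiv
    simp [pd, hfd, delta, Pi.single_apply, eq_comm]
  · have hnot : ¬DifferentiableAt ℝ (fun x : V => f (x 0)) x := fun h => hf <| by
      have hx : DifferentiableAt ℝ (fun x : V => f (x 0)) (Function.update x 0 (x 0)) := by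
        rwa [Function.update_eq_self]
      simpa [Function.comp_def] using
        hx.comp (x 0) (hasFDerivAt_update x (x 0)).differentiableAt
    simp [pd, fderiv_zero_of_not_differentiableAt hnot, deriv_zero_of_not_differentiableAt hf]

theorem pd_line_mul_const (f : ℝ → ℝ) (c : ℝ) (i : Fin 3) (x : V) :
    pd i (fun x => f (x 0) * c) x = deriv f (x 0) * c * delta i 0 := by
  rw [pd_line (fun s => f s * c), deriv_mul_const_field]

/-- The profile of density `a`, energy `b` and longitudinal velocity `u`, all functions of the
first coordinate. -/
def lineProfile (a b u : ℝ → ℝ) : Profile :=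
  ⟨fun x => a (x 0), fun x i => u (x 0) * delta i 0, fun x => b (x 0)⟩

/-- The states along `lineProfile a b u`. -/
noncomputable def lineJet (a b u : ℝ → ℝ) (s : ℝ) : State :=
  lineState (a s) (b s) (deriv a s) (deriv u s) (deriv b s) (deriv (deriv a) s)

/-- The normal stress along `lineProfile a b u`. -/
noncomputable def lineStress (m : MaterialFunctions) (a b u : ℝ → ℝ) (s : ℝ) : ℝ :=
  normalStress m (a s) (b s) (deriv a s) (deriv u s) (deriv (deriv a) s)

/-- The heat flux along `lineProfile a b u`. -/
noncomputable def lineFlux (m : MaterialFunctions) (a b : ℝ → ℝ) (s : ℝ) : ℝ :=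
  m.q1 (a s) (b s) * deriv b s + m.q2 (a s) (b s) * deriv a s

/-- The density of `(lineProfile a b u).rates m`. -/
noncomputable def lineDensityRate (a u : ℝ → ℝ) (s : ℝ) : ℝ := -deriv (fun s => a s * u s) s

/-- The velocity of `(lineProfile a b u).rates m`. -/
noncomputable def lineVelocityRate (m : MaterialFunctions) (a b u : ℝ → ℝ) (s : ℝ) : ℝ :=
  deriv (lineStress m a b u) s / a s - u s * deriv u s

/-- The energy of `(lineProfile a b u).rates m`. -/
noncomputable def lineEnergyRate (m : MaterialFunctions) (a b u : ℝ → ℝ) (s : ℝ) : ℝ :=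
  (lineStress m a b u s * deriv u s - deriv (lineFlux m a b) s) / a s - u s * deriv b s

variable {a b u : ℝ → ℝ}

theorem jet_lineProfile (a b u : ℝ → ℝ) (x : V) :
    (lineProfile a b u).jet x = lineJet a b u (x 0) := by
  have hpd (f : ℝ → ℝ) (i : Fin 3) : pd i (fun x => f (x 0)) = fun x => deriv f (x 0) * delta i 0 :=
    funext (pd_line f i)
  simp only [Profile.jet, lineProfile, lineJet, lineState, hpd, pd_line_mul_const,
    Prod.mk.injEq, true_and]
  refine ⟨?_, ?_⟩ <;> ext <;> ring

theorem rates_lineProfile (m : MaterialFunctions) (a b u : ℝ → ℝ) :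
    (lineProfile a b u).rates m
      = lineProfile (lineDensityRate a u) (lineEnergyRate m a b u) (lineVelocityRate m a b u) := by
  have hmass (x : V) (j : Fin 3) : pd j (fun x => a (x 0) * (u (x 0) * delta j 0)) x
      = deriv (fun s => a s * u s) (x 0) * delta j 0 * delta j 0 := by
    simp only [← mul_assoc, pd_line_mul_const (fun s => a s * u s)]
  have hstress (x : V) (i j : Fin 3) : pd j (fun x => m.stress (lineJet a b u (x 0)) i j) x
      = deriv (fun s => m.stress (lineJet a b u s) i j) (x 0) * delta j 0 :=
    pd_line (fun s => m.stress (lineJet a b u s) i j) j x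
  have hflux (x : V) (j : Fin 3) : pd j (fun x => m.heatFlux (lineJet a b u (x 0)) j) x
      = deriv (lineFlux m a b) (x 0) * delta j 0 * delta j 0 := by
    simp only [lineJet, heatFlux_lineState]
    exact pd_line_mul_const (lineFlux m a b) _ j x
  have hnormal (s : ℝ) (i : Fin 3) :
      m.stress (lineJet a b u s) i 0 = lineStress m a b u s * delta i 0 :=
    stress_lineState m _ _ _ _ _ _ i
  simp only [Profile.rates, lineProfile, Profile.mk.injEq]
  refine ⟨funext fun x => ?_, funext fun x => funext fun i => ?_, funext fun x => ?_⟩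
  · simp only [Profile.densityRate, lineDensityRate, hmass]
    simp [delta]
  · simp only [Profile.velocityRate, lineVelocityRate, ← lineProfile.eq_def, jet_lineProfile,
      hstress, pd_line_mul_const, Fin.sum_univ_three, hnormal, deriv_mul_const_field]
    by_cases hi : i = 0 <;> simp [delta, hi]
  · simp only [Profile.energyRate, lineEnergyRate, ← lineProfile.eq_def, jet_lineProfile, hflux,
      pd_line_mul_const, pd_line b, ddot, Fin.sum_univ_three, hnormal]
    simp [delta]

variable {D : Set (ℝ × ℝ)} {m : MaterialFunctions} {J : State → V} {s : ℝ}

theorem hasDerivAt_flux_comp (hD : IsOpen D) (hJ : ContDiffOn ℝ ∞ J (State.region D))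
    {γ : ℝ → State} {γ' : State} (hγ : HasDerivAt γ γ' s) (h : γ s ∈ State.region D)
    (i : Fin 3) : HasDerivAt (fun s => J (γ s) i) (fderiv ℝ J (γ s) γ' i) s :=
  hasDerivAt_pi.1 (((hJ.contDiffAt ((isOpen_region hD).mem_nhds h)).differentiableAt
    (by simp)).hasFDerivAt.comp_hasDerivAt s hγ) i

theorem contDiff_deriv (ha : ContDiff ℝ ∞ a) : ContDiff ℝ ∞ (deriv a) :=
  (contDiff_infty_iff_deriv.1 ha).2

theorem hasDerivAt_of_contDiff (ha : ContDiff ℝ ∞ a) (s : ℝ) : HasDerivAt a (deriv a s) s :=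
  (ha.differentiable (by simp) s).hasDerivAt

theorem hasDerivAt_lineJet (ha : ContDiff ℝ ∞ a) (hb : ContDiff ℝ ∞ b) (hu : ContDiff ℝ ∞ u)
    (s : ℝ) :
    HasDerivAt (lineJet a b u)
      (lineState (deriv a s) (deriv b s) (deriv (deriv a) s) (deriv (deriv u) s)
        (deriv (deriv b) s) (deriv (deriv (deriv a)) s)) s :=
  hasDerivAt_lineState (hasDerivAt_of_contDiff ha s) (hasDerivAt_of_contDiff hb s)
    (hasDerivAt_of_contDiff (contDiff_deriv ha) s) (hasDerivAt_of_contDiff (contDiff_deriv hu) s)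
    (hasDerivAt_of_contDiff (contDiff_deriv hb) s)
    (hasDerivAt_of_contDiff (contDiff_deriv (contDiff_deriv ha)) s)

theorem line_inequality (hD : IsOpen D) (hm : m.SmoothOn D)
    (hJ : ContDiffOn ℝ ∞ J (State.region D)) (hent : ExtendedEntropyPrinciple D m J)
    (ha : ContDiff ℝ ∞ a) (hb : ContDiff ℝ ∞ b) (hu : ContDiff ℝ ∞ u) (hu0 : u 0 = 0)
    (h0 : (a 0, b 0) ∈ D) (hρ : a 0 ≠ 0) :
    0 ≤ a 0 * fderiv ℝ m.entropy (lineJet a b u 0)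
          (lineState (lineDensityRate a u 0) (lineEnergyRate m a b u 0)
            (deriv (lineDensityRate a u) 0) (deriv (lineVelocityRate m a b u) 0)
            (deriv (lineEnergyRate m a b u) 0) (deriv (deriv (lineDensityRate a u)) 0))
        + fderiv ℝ J (lineJet a b u 0)
            (lineState (deriv a 0) (deriv b 0) (deriv (deriv a) 0) (deriv (deriv u) 0)
              (deriv (deriv b) 0) (deriv (deriv (deriv a)) 0)) 0 := by
  have hx : ContDiff ℝ ∞ fun x : V => x 0 := contDiff_apply ℝ ℝ 0
  have hP : (lineProfile a b u).Smooth :=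
    ⟨ha.comp hx, fun i => (hu.comp hx).mul contDiff_const, hb.comp hx⟩
  have hineq := reduced_entropy_inequality hD hm hJ hent hP (by ext; simp [lineProfile, hu0])
    h0 hρ
  have hdiv (j : Fin 3) : pd j (fun x => J (lineJet a b u (x 0)) j) 0
      = deriv (fun s => J (lineJet a b u s) j) 0 * delta j 0 :=
    pd_line (fun s => J (lineJet a b u s) j) j 0
  simp only [rates_lineProfile, jet_lineProfile, hdiv] at hineq
  rw [← (hasDerivAt_flux_comp hD hJ (hasDerivAt_lineJet ha hb hu 0) h0 0).deriv]
  simpa [lineProfile, delta, lineJet.eq_1 (lineDensityRate a u)] using hineq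

theorem hasDerivAt_lineStress (hD : IsOpen D) (hm : m.SmoothOn D) (ha : ContDiff ℝ ∞ a)
    (hb : ContDiff ℝ ∞ b) (hu : ContDiff ℝ ∞ u) (h : (a s, b s) ∈ D) :
    HasDerivAt (lineStress m a b u)
      (-(dRho m.p (a s) (b s) * deriv a s + dEps m.p (a s) (b s) * deriv b s)
        + ((dRho (capillaryModulus m) (a s) (b s) * deriv a s
            + dEps (capillaryModulus m) (a s) (b s) * deriv b s) * deriv (deriv a) s
          + capillaryModulus m (a s) (b s) * deriv (deriv (deriv a)) s)
        + ((dRho (gradientModulus m) (a s) (b s) * deriv a s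
            + dEps (gradientModulus m) (a s) (b s) * deriv b s) * deriv a s ^ 2
          + gradientModulus m (a s) (b s) * (2 * deriv a s * deriv (deriv a) s))
        + ((dRho (viscousModulus m) (a s) (b s) * deriv a s
            + dEps (viscousModulus m) (a s) (b s) * deriv b s) * deriv u s
          + viscousModulus m (a s) (b s) * deriv (deriv u) s)) s := by
  have hcoeff {f : ℝ → ℝ → ℝ} (hf : Smooth2 D f) : HasDerivAt (fun s => f (a s) (b s))
      (dRho f (a s) (b s) * deriv a s + dEps f (a s) (b s) * deriv b s) s :=
    hf.hasDerivAt hD (hasDerivAt_of_contDiff ha s) (hasDerivAt_of_contDiff hb s) h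
  have ha₁ := hasDerivAt_of_contDiff (contDiff_deriv ha) s
  have ha₂ := hasDerivAt_of_contDiff (contDiff_deriv (contDiff_deriv ha)) s
  have hu₁ := hasDerivAt_of_contDiff (contDiff_deriv hu) s
  exact (((hcoeff hm.p).fun_neg.fun_add ((hcoeff hm.capillaryModulus).fun_mul ha₂)).fun_add
    ((hcoeff hm.gradientModulus).fun_mul (ha₁.fun_pow 2))).fun_add
    ((hcoeff hm.viscousModulus).fun_mul hu₁) |>.congr_deriv (by simp)

theorem hasDerivAt_lineFlux (hD : IsOpen D) (hm : m.SmoothOn D) (ha : ContDiff ℝ ∞ a)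
    (hb : ContDiff ℝ ∞ b) (h : (a s, b s) ∈ D) :
    HasDerivAt (lineFlux m a b)
      ((dRho m.q1 (a s) (b s) * deriv a s + dEps m.q1 (a s) (b s) * deriv b s) * deriv b s
        + m.q1 (a s) (b s) * deriv (deriv b) s
        + ((dRho m.q2 (a s) (b s) * deriv a s + dEps m.q2 (a s) (b s) * deriv b s) * deriv a s
          + m.q2 (a s) (b s) * deriv (deriv a) s)) s := by
  have ha₀ := hasDerivAt_of_contDiff ha s
  have hb₀ := hasDerivAt_of_contDiff hb s
  exact ((hm.q1.hasDerivAt hD ha₀ hb₀ h).fun_mul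
      (hasDerivAt_of_contDiff (contDiff_deriv hb) s)).fun_add
    ((hm.q2.hasDerivAt hD ha₀ hb₀ h).fun_mul (hasDerivAt_of_contDiff (contDiff_deriv ha) s))

theorem hasDerivAt_lineVelocityRate {τ₂ : ℝ} (ha : ContDiff ℝ ∞ a) (hu : ContDiff ℝ ∞ u)
    (hρ : a s ≠ 0) (hτ : HasDerivAt (deriv (lineStress m a b u)) τ₂ s) :
    HasDerivAt (lineVelocityRate m a b u)
      ((τ₂ * a s - deriv (lineStress m a b u) s * deriv a s) / a s ^ 2
        - (deriv u s * deriv u s + u s * deriv (deriv u) s)) s :=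
  (hτ.fun_div (hasDerivAt_of_contDiff ha s) hρ).fun_sub
    ((hasDerivAt_of_contDiff hu s).fun_mul (hasDerivAt_of_contDiff (contDiff_deriv hu) s))

theorem hasDerivAt_lineEnergyRate {τ₁ κ₂ : ℝ} (ha : ContDiff ℝ ∞ a) (hb : ContDiff ℝ ∞ b)
    (hu : ContDiff ℝ ∞ u) (hρ : a s ≠ 0) (hτ : HasDerivAt (lineStress m a b u) τ₁ s)
    (hκ : HasDerivAt (deriv (lineFlux m a b)) κ₂ s) :
    HasDerivAt (lineEnergyRate m a b u)
      (((τ₁ * deriv u s + lineStress m a b u s * deriv (deriv u) s - κ₂) * a s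
          - (lineStress m a b u s * deriv u s - deriv (lineFlux m a b) s) * deriv a s) / a s ^ 2
        - (deriv u s * deriv b s + u s * deriv (deriv b) s)) s :=
  (((hτ.fun_mul (hasDerivAt_of_contDiff (contDiff_deriv hu) s)).fun_sub hκ).fun_div
      (hasDerivAt_of_contDiff ha s) hρ).fun_sub
    ((hasDerivAt_of_contDiff hu s).fun_mul (hasDerivAt_of_contDiff (contDiff_deriv hb) s))

theorem eventually_mem (hD : IsOpen D) (ha : ContDiff ℝ ∞ a) (hb : ContDiff ℝ ∞ b)
    (h : (a s, b s) ∈ D) : ∀ᶠ r in nhds s, (a r, b r) ∈ D :=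
  (ha.continuous.prodMk hb.continuous).continuousAt.preimage_mem_nhds (hD.mem_nhds h)

end Line

section LineTests

theorem eq_zero_of_forall_affine_nonneg {c d : ℝ} (h : ∀ t, 0 ≤ c + t * d) : d = 0 := by
  by_contra hd
  have hneg := h (-(c + 1) / d)
  rw [div_mul_cancel₀ _ hd] at hneg
  linarith

/-- The polynomial of degree four with derivatives `c₀, …, c₄` at the origin, the test function of
the one-dimensional motions. -/
noncomputable def quartic (c₀ c₁ c₂ c₃ c₄ s : ℝ) : ℝ :=
  c₀ + c₁ * s + c₂ * s ^ 2 / 2 + c₃ * s ^ 3 / 6 + c₄ * s ^ 4 / 24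

variable {c₀ c₁ c₂ c₃ c₄ : ℝ}

theorem hasDerivAt_quartic (s : ℝ) :
    HasDerivAt (quartic c₀ c₁ c₂ c₃ c₄) (quartic c₁ c₂ c₃ c₄ 0 s) s := by
  have hpow (c k : ℝ) (n : ℕ) :
      HasDerivAt (fun s => c * s ^ n / k) (c * (n * s ^ (n - 1)) / k) s :=
    ((hasDerivAt_pow n s).const_mul c).div_const k
  refine (((((hasDerivAt_id s).const_mul c₁).const_add c₀).fun_add (hpow c₂ 2 2)).fun_add
    (hpow c₃ 6 3)).fun_add (hpow c₄ 24 4) |>.congr_deriv ?_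
  simp only [quartic]
  push_cast
  ring

theorem deriv_quartic : deriv (quartic c₀ c₁ c₂ c₃ c₄) = quartic c₁ c₂ c₃ c₄ 0 :=
  funext fun s => (hasDerivAt_quartic s).deriv

theorem quartic_apply_zero : quartic c₀ c₁ c₂ c₃ c₄ 0 = c₀ := by
  simp [quartic]

theorem quartic_zero (s : ℝ) : quartic 0 0 0 0 0 s = 0 := by
  simp [quartic]

theorem contDiff_quartic : ContDiff ℝ ∞ (quartic c₀ c₁ c₂ c₃ c₄) := by
  unfold quartic
  fun_prop

variable {D : Set (ℝ × ℝ)} {m : MaterialFunctions} {J : State → V} {ρ ε : ℝ}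

theorem lineDensityRate_quartic {a₀ a₁ a₂ a₃ a₄ : ℝ} :
    lineDensityRate (quartic a₀ a₁ a₂ a₃ a₄) (quartic c₀ c₁ c₂ c₃ c₄) = fun s =>
      -(quartic a₁ a₂ a₃ a₄ 0 s * quartic c₀ c₁ c₂ c₃ c₄ s
        + quartic a₀ a₁ a₂ a₃ a₄ s * quartic c₁ c₂ c₃ c₄ 0 s) :=
  funext fun s => by
    rw [lineDensityRate, ((hasDerivAt_quartic s).fun_mul (hasDerivAt_quartic s)).deriv]

theorem lineJet_quartic {a₀ a₁ a₂ a₃ a₄ b₀ b₁ b₂ b₃ b₄ : ℝ} :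
    lineJet (quartic a₀ a₁ a₂ a₃ a₄) (quartic b₀ b₁ b₂ b₃ b₄) (quartic c₀ c₁ c₂ c₃ c₄) 0
      = lineState a₀ b₀ a₁ c₁ b₁ a₂ := by
  simp only [lineJet, deriv_quartic, quartic_apply_zero]

theorem lineEnergyRate_quartic_eq_zero (hD : IsOpen D) (hm : m.SmoothOn D) (h0 : (ρ, ε) ∈ D)
    {a₃ a₄ : ℝ} : lineEnergyRate m (quartic ρ 0 0 a₃ a₄) (quartic ε 0 0 0 0)
      (quartic 0 0 c₂ c₃ c₄) 0 = 0 := by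
  have hz : (quartic ρ 0 0 a₃ a₄ 0, quartic ε 0 0 0 0 0) ∈ D := by simpa only [quartic_apply_zero]
  simp [lineEnergyRate, (hasDerivAt_lineFlux hD hm contDiff_quartic contDiff_quartic hz).deriv,
    deriv_quartic, quartic_apply_zero]

theorem hasDerivAt_deriv_lineStress_density (hD : IsOpen D) (hm : m.SmoothOn D) (h0 : (ρ, ε) ∈ D)
    (c : ℝ) :
    HasDerivAt (deriv (lineStress m (quartic ρ 0 0 0 c) (quartic ε 0 0 0 0) (quartic 0 0 0 0 0)))
      (capillaryModulus m ρ ε * c) 0 := by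
  set a := quartic ρ 0 0 0 c
  set b := quartic ε 0 0 0 0
  have hz : (a 0, b 0) ∈ D := by simpa only [a, b, quartic_apply_zero] using h0
  have hcoeff {f : ℝ → ℝ → ℝ} (hf : Smooth2 D f) := hf.hasDerivAt hD
    (hasDerivAt_quartic 0 : HasDerivAt a _ 0) (hasDerivAt_quartic 0 : HasDerivAt b _ 0) hz
  have hnear : deriv (lineStress m a b (quartic 0 0 0 0 0)) =ᶠ[nhds 0] fun s =>
      -(dRho m.p (a s) (b s) * quartic 0 0 0 c 0 s)
      + (dRho (capillaryModulus m) (a s) (b s) * quartic 0 0 0 c 0 s * quartic 0 0 c 0 0 s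
        + capillaryModulus m (a s) (b s) * quartic 0 c 0 0 0 s)
      + (dRho (gradientModulus m) (a s) (b s) * quartic 0 0 0 c 0 s * quartic 0 0 0 c 0 s ^ 2
        + gradientModulus m (a s) (b s)
          * (2 * quartic 0 0 0 c 0 s * quartic 0 0 c 0 0 s)) := by
    filter_upwards [eventually_mem hD contDiff_quartic contDiff_quartic hz] with s hs
    rw [(hasDerivAt_lineStress hD hm contDiff_quartic contDiff_quartic contDiff_quartic hs).deriv]
    simp only [a, b, deriv_quartic, quartic_zero, mul_zero, add_zero]
  refine HasDerivAt.congr_of_eventuallyEq ?_ hnear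
  have hA := hcoeff hm.capillaryModulus
  have hB := hcoeff hm.gradientModulus
  refine (((hcoeff (hm.p.dRho hD)).fun_mul (hasDerivAt_quartic 0)).fun_neg.fun_add
    ((((hcoeff (hm.capillaryModulus.dRho hD)).fun_mul (hasDerivAt_quartic 0)).fun_mul
      (hasDerivAt_quartic 0)).fun_add (hA.fun_mul (hasDerivAt_quartic 0)))).fun_add
    ((((hcoeff (hm.gradientModulus.dRho hD)).fun_mul (hasDerivAt_quartic 0)).fun_mul
      ((hasDerivAt_quartic 0).fun_pow 2)).fun_add
      (hB.fun_mul (((hasDerivAt_quartic 0).const_mul 2).fun_mul (hasDerivAt_quartic 0))))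
    |>.congr_deriv ?_
  simp [quartic_apply_zero]

theorem s4_mul_capillaryModulus_eq_zero (hD : IsOpen D) (hm : m.SmoothOn D)
    (hJ : ContDiffOn ℝ ∞ J (State.region D)) (hent : ExtendedEntropyPrinciple D m J)
    (h0 : (ρ, ε) ∈ D) (hρ : ρ ≠ 0) : m.s4 ρ ε * capillaryModulus m ρ ε = 0 := by
  refine eq_zero_of_forall_affine_nonneg (c := 0) fun c => ?_
  have hz : (quartic ρ 0 0 0 c 0, quartic ε 0 0 0 0 0) ∈ D := by simpa only [quartic_apply_zero]
  have hineq := line_inequality (u := quartic 0 0 0 0 0) hD hm hJ hent contDiff_quartic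
    contDiff_quartic contDiff_quartic quartic_apply_zero hz (by rwa [quartic_apply_zero])
  have hrate := (hasDerivAt_lineVelocityRate contDiff_quartic contDiff_quartic
    (by rwa [quartic_apply_zero]) (hasDerivAt_deriv_lineStress_density hD hm h0 c)).deriv
  have henergy : lineEnergyRate m (quartic ρ 0 0 0 c) (quartic ε 0 0 0 0)
      (quartic 0 0 0 0 0) 0 = 0 := lineEnergyRate_quartic_eq_zero hD hm h0
  have hdensity : lineDensityRate (quartic ρ 0 0 0 c) (quartic 0 0 0 0 0) = fun _ => 0 := by
    simp only [lineDensityRate_quartic, quartic_zero, mul_zero, add_zero, neg_zero]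
  simp only [lineJet_quartic, hdensity, henergy, hrate, deriv_const',
    deriv_quartic, quartic_apply_zero, lineState_zero, map_zero, Pi.zero_apply,
    fderiv_entropy_lineState hD hm h0] at hineq
  refine hineq.trans_eq ?_
  field_simp
  ring

theorem s5_eq_zero (hD : IsOpen D) (hm : m.SmoothOn D)
    (hJ : ContDiffOn ℝ ∞ J (State.region D)) (hent : ExtendedEntropyPrinciple D m J)
    (h0 : (ρ, ε) ∈ D) (hρ : ρ ≠ 0) (h4 : m.s4 ρ ε = 0) : m.s5 ρ ε = 0 := by
  have hmul : ρ ^ 2 * m.s5 ρ ε = 0 := by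
    refine eq_zero_of_forall_affine_nonneg (c := 0) fun c => ?_
    have hz : (quartic ρ 0 0 0 0 0, quartic ε 0 0 0 0 0) ∈ D := by simpa only [quartic_apply_zero]
    have hineq := line_inequality (u := quartic 0 0 0 (-c) 0) hD hm hJ hent contDiff_quartic
      contDiff_quartic contDiff_quartic quartic_apply_zero hz (by rwa [quartic_apply_zero])
    have hdensity : lineDensityRate (quartic ρ 0 0 0 0) (quartic 0 0 0 (-c) 0)
        = quartic 0 0 (ρ * c) 0 0 := by
      rw [lineDensityRate_quartic]
      funext s
      simp only [quartic]
      ring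
    have henergy : lineEnergyRate m (quartic ρ 0 0 0 0) (quartic ε 0 0 0 0)
        (quartic 0 0 0 (-c) 0) 0 = 0 := lineEnergyRate_quartic_eq_zero hD hm h0
    simp only [lineJet_quartic, hdensity, henergy,
      deriv_quartic, quartic_apply_zero, lineState_zero, map_zero, Pi.zero_apply,
      fderiv_entropy_lineState hD hm h0, h4] at hineq
    exact hineq.trans_eq (by ring)
  simpa [hρ] using hmul

end LineTests

section QuadraticLineTest

variable {D : Set (ℝ × ℝ)} {m : MaterialFunctions} {J : State → V} {ρ ε : ℝ}

theorem fderiv_lineState (J : State → V) (z : State) (r w g l e h : ℝ) (i : Fin 3) :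
    fderiv ℝ J z (lineState r w g l e h) i = fderiv ℝ J z (lineState r w g 0 0 h) i
      + l * fderiv ℝ J z (lineState 0 0 0 1 0 0) i
      + e * fderiv ℝ J z (lineState 0 0 0 0 1 0) i := by
  have hsplit : lineState r w g l e h = lineState r w g 0 0 h + l • lineState 0 0 0 1 0 0
      + e • lineState 0 0 0 0 1 0 := by
    simp only [smul_lineState, lineState_add, mul_zero, mul_one, add_zero, zero_add]
  rw [hsplit, map_add, map_add, map_smul, map_smul]
  rfl

theorem hasDerivAt_lineStress_quadratic (hD : IsOpen D) (hm : m.SmoothOn D) (h0 : (ρ, ε) ∈ D)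
    (l e h l' e' : ℝ) :
    HasDerivAt (lineStress m (quartic ρ 0 h 0 0) (quartic ε e e' 0 0) (quartic 0 l l' 0 0))
      (-dEps m.p ρ ε * e + dEps (capillaryModulus m) ρ ε * e * h
        + dEps (viscousModulus m) ρ ε * e * l + viscousModulus m ρ ε * l') 0 := by
  refine (hasDerivAt_lineStress hD hm contDiff_quartic contDiff_quartic contDiff_quartic
    (by simpa only [quartic_apply_zero])).congr_deriv ?_
  simp only [deriv_quartic, quartic_apply_zero]
  ring

theorem hasDerivAt_deriv_lineFlux_quadratic (hD : IsOpen D) (hm : m.SmoothOn D)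
    (h0 : (ρ, ε) ∈ D) (e h e' : ℝ) :
    HasDerivAt (deriv (lineFlux m (quartic ρ 0 h 0 0) (quartic ε e e' 0 0)))
      (dRho m.q1 ρ ε * h * e + dEps (dEps m.q1) ρ ε * e ^ 3 + 2 * dEps m.q2 ρ ε * e * h
        + 3 * dEps m.q1 ρ ε * e * e') 0 := by
  set a := quartic ρ 0 h 0 0
  set b := quartic ε e e' 0 0
  have hz : (a 0, b 0) ∈ D := by simpa only [a, b, quartic_apply_zero] using h0
  have hcoeff {f : ℝ → ℝ → ℝ} (hf : Smooth2 D f) := hf.hasDerivAt hD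
    (hasDerivAt_quartic 0 : HasDerivAt a _ 0) (hasDerivAt_quartic 0 : HasDerivAt b _ 0) hz
  have ha' : HasDerivAt (quartic 0 h 0 0 0) _ 0 := hasDerivAt_quartic 0
  have hb' : HasDerivAt (quartic e e' 0 0 0) _ 0 := hasDerivAt_quartic 0
  have hnear : deriv (lineFlux m a b) =ᶠ[nhds 0] fun s =>
      (dRho m.q1 (a s) (b s) * quartic 0 h 0 0 0 s + dEps m.q1 (a s) (b s) * quartic e e' 0 0 0 s)
          * quartic e e' 0 0 0 s
        + m.q1 (a s) (b s) * quartic e' 0 0 0 0 s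
        + ((dRho m.q2 (a s) (b s) * quartic 0 h 0 0 0 s
            + dEps m.q2 (a s) (b s) * quartic e e' 0 0 0 s) * quartic 0 h 0 0 0 s
          + m.q2 (a s) (b s) * quartic h 0 0 0 0 s) := by
    filter_upwards [eventually_mem hD contDiff_quartic contDiff_quartic hz] with s hs
    rw [(hasDerivAt_lineFlux hD hm contDiff_quartic contDiff_quartic hs).deriv]
    simp only [a, b, deriv_quartic]
  refine HasDerivAt.congr_of_eventuallyEq ?_ hnear
  refine (((((hcoeff (hm.q1.dRho hD)).fun_mul ha').fun_add
      ((hcoeff (hm.q1.dEps hD)).fun_mul hb')).fun_mul hb').fun_add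
      ((hcoeff hm.q1).fun_mul (hasDerivAt_quartic 0))).fun_add
    (((((hcoeff (hm.q2.dRho hD)).fun_mul ha').fun_add
      ((hcoeff (hm.q2.dEps hD)).fun_mul hb')).fun_mul ha').fun_add
      ((hcoeff hm.q2).fun_mul (hasDerivAt_quartic 0))) |>.congr_deriv ?_
  simp only [quartic_apply_zero]
  ring

theorem lineStress_quadratic (m : MaterialFunctions) (ρ ε l e h l' e' : ℝ) :
    lineStress m (quartic ρ 0 h 0 0) (quartic ε e e' 0 0) (quartic 0 l l' 0 0) 0
      = normalStress m ρ ε 0 l h := by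
  simp only [lineStress, deriv_quartic, quartic_apply_zero]

theorem deriv_lineFlux_quadratic (hD : IsOpen D) (hm : m.SmoothOn D) (h0 : (ρ, ε) ∈ D)
    (e h e' : ℝ) :
    deriv (lineFlux m (quartic ρ 0 h 0 0) (quartic ε e e' 0 0)) 0
      = dEps m.q1 ρ ε * e ^ 2 + m.q1 ρ ε * e' + m.q2 ρ ε * h := by
  rw [(hasDerivAt_lineFlux hD hm contDiff_quartic contDiff_quartic
    (by simpa only [quartic_apply_zero])).deriv]
  simp only [deriv_quartic, quartic_apply_zero]
  ring

theorem quadratic_line_inequality (hD : IsOpen D) (hm : m.SmoothOn D)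
    (hJ : ContDiffOn ℝ ∞ J (State.region D)) (hent : ExtendedEntropyPrinciple D m J)
    (h4 : ∀ ρ ε, (ρ, ε) ∈ D → m.s4 ρ ε = 0) (h5 : ∀ ρ ε, (ρ, ε) ∈ D → m.s5 ρ ε = 0)
    (h0 : (ρ, ε) ∈ D) (hρ : ρ ≠ 0) (l e h : ℝ) : ∃ c₀ : ℝ, ∀ l' e' : ℝ,
    0 ≤ c₀ + l' * (2 * m.s3 ρ ε * e * (-m.p ρ ε + capillaryModulus m ρ ε * h
            + 2 * viscousModulus m ρ ε * l) - ρ ^ 2 * m.s2 ρ ε * e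
          + fderiv ℝ J (lineState ρ ε 0 l e h) (lineState 0 0 0 1 0 0) 0)
        + e' * (-(dEps m.s0 ρ ε + dEps m.s3 ρ ε * e ^ 2) * m.q1 ρ ε
            - 6 * m.s3 ρ ε * e ^ 2 * dEps m.q1 ρ ε
          + fderiv ℝ J (lineState ρ ε 0 l e h) (lineState 0 0 0 0 1 0) 0) := by
  set κ := dRho m.q1 ρ ε * h * e + dEps (dEps m.q1) ρ ε * e ^ 3 + 2 * dEps m.q2 ρ ε * e * h
  set τ := -dEps m.p ρ ε * e + dEps (capillaryModulus m) ρ ε * e * h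
    + dEps (viscousModulus m) ρ ε * e * l
  refine ⟨-ρ ^ 2 * l * (dRho m.s0 ρ ε + dRho m.s3 ρ ε * e ^ 2)
    + (dEps m.s0 ρ ε + dEps m.s3 ρ ε * e ^ 2)
      * (normalStress m ρ ε 0 l h * l - (dEps m.q1 ρ ε * e ^ 2 + m.q2 ρ ε * h))
    + 2 * m.s3 ρ ε * e * (τ * l - κ - ρ * l * e)
    + fderiv ℝ J (lineState ρ ε 0 l e h) (lineState 0 e h 0 0 0) 0, fun l' e' => ?_⟩
  have hineq := line_inequality hD hm hJ hent (a := quartic ρ 0 h 0 0) (b := quartic ε e e' 0 0)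
    (u := quartic 0 l l' 0 0) contDiff_quartic contDiff_quartic contDiff_quartic
    quartic_apply_zero (by simpa only [quartic_apply_zero]) (by rwa [quartic_apply_zero])
  have hdensity : deriv (lineDensityRate (quartic ρ 0 h 0 0) (quartic 0 l l' 0 0)) 0
      = -ρ * l' := by
    rw [lineDensityRate_quartic, (((hasDerivAt_quartic 0).fun_mul (hasDerivAt_quartic 0)).fun_add
      ((hasDerivAt_quartic 0).fun_mul (hasDerivAt_quartic 0))).fun_neg.deriv]
    simp only [quartic_apply_zero]
    ring
  have henergy := (hasDerivAt_lineEnergyRate contDiff_quartic contDiff_quartic contDiff_quartic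
    (by rwa [quartic_apply_zero]) (hasDerivAt_lineStress_quadratic hD hm h0 l e h l' e')
    (hasDerivAt_deriv_lineFlux_quadratic hD hm h0 e h e')).deriv
  rw [lineJet_quartic, hdensity, henergy, fderiv_entropy_lineState hD hm (by exact h0),
    fderiv_lineState] at hineq
  simp only [lineDensityRate_quartic, lineEnergyRate, lineStress_quadratic,
    deriv_lineFlux_quadratic hD hm h0, deriv_quartic, quartic_apply_zero, h4 _ _ h0, h5 _ _ h0,
    dRho_eq_zero hD h4 h0, dRho_eq_zero hD h5 h0, dEps_eq_zero hD h4 h0,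
    dEps_eq_zero hD h5 h0] at hineq
  refine hineq.trans_eq ?_
  simp only [normalStress, κ, τ]
  field_simp
  ring

theorem hasDerivAt_flux_l (hD : IsOpen D) (hJ : ContDiffOn ℝ ∞ J (State.region D))
    (h0 : (ρ, ε) ∈ D) (l e h : ℝ) :
    HasDerivAt (fun l => J (lineState ρ ε 0 l e h) 0)
      (fderiv ℝ J (lineState ρ ε 0 l e h) (lineState 0 0 0 1 0 0) 0) l :=
  hasDerivAt_flux_comp hD hJ
    (hasDerivAt_lineState (hasDerivAt_const _ _) (hasDerivAt_const _ _) (hasDerivAt_const _ _)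
      (hasDerivAt_id l) (hasDerivAt_const _ _) (hasDerivAt_const _ _)) h0 0

theorem hasDerivAt_flux_e (hD : IsOpen D) (hJ : ContDiffOn ℝ ∞ J (State.region D))
    (h0 : (ρ, ε) ∈ D) (l e h : ℝ) :
    HasDerivAt (fun e => J (lineState ρ ε 0 l e h) 0)
      (fderiv ℝ J (lineState ρ ε 0 l e h) (lineState 0 0 0 0 1 0) 0) e :=
  hasDerivAt_flux_comp hD hJ
    (hasDerivAt_lineState (hasDerivAt_const _ _) (hasDerivAt_const _ _) (hasDerivAt_const _ _)
      (hasDerivAt_const _ _) (hasDerivAt_id e) (hasDerivAt_const _ _)) h0 0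

theorem hasDerivAt_flux_l_eq (hD : IsOpen D) (hm : m.SmoothOn D)
    (hJ : ContDiffOn ℝ ∞ J (State.region D)) (hent : ExtendedEntropyPrinciple D m J)
    (h4 : ∀ ρ ε, (ρ, ε) ∈ D → m.s4 ρ ε = 0) (h5 : ∀ ρ ε, (ρ, ε) ∈ D → m.s5 ρ ε = 0)
    (h0 : (ρ, ε) ∈ D) (hρ : ρ ≠ 0) (l e h : ℝ) :
    HasDerivAt (fun l => J (lineState ρ ε 0 l e h) 0)
      (e * (ρ ^ 2 * m.s2 ρ ε - 2 * m.s3 ρ ε * (-m.p ρ ε + capillaryModulus m ρ ε * h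
        + 2 * viscousModulus m ρ ε * l))) l := by
  obtain ⟨c₀, hc₀⟩ := quadratic_line_inequality hD hm hJ hent h4 h5 h0 hρ l e h
  have hcoeff := eq_zero_of_forall_affine_nonneg (c := c₀) fun l' => by simpa using hc₀ l' 0
  exact (hasDerivAt_flux_l hD hJ h0 l e h).congr_deriv (by linear_combination hcoeff)

theorem hasDerivAt_flux_e_eq (hD : IsOpen D) (hm : m.SmoothOn D)
    (hJ : ContDiffOn ℝ ∞ J (State.region D)) (hent : ExtendedEntropyPrinciple D m J)
    (h4 : ∀ ρ ε, (ρ, ε) ∈ D → m.s4 ρ ε = 0) (h5 : ∀ ρ ε, (ρ, ε) ∈ D → m.s5 ρ ε = 0)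
    (h0 : (ρ, ε) ∈ D) (hρ : ρ ≠ 0) (l e h : ℝ) :
    HasDerivAt (fun e => J (lineState ρ ε 0 l e h) 0)
      ((dEps m.s0 ρ ε + dEps m.s3 ρ ε * e ^ 2) * m.q1 ρ ε
        + 6 * m.s3 ρ ε * e ^ 2 * dEps m.q1 ρ ε) e := by
  obtain ⟨c₀, hc₀⟩ := quadratic_line_inequality hD hm hJ hent h4 h5 h0 hρ l e h
  have hcoeff := eq_zero_of_forall_affine_nonneg (c := c₀) fun e' => by simpa using hc₀ 0 e'
  exact (hasDerivAt_flux_e hD hJ h0 l e h).congr_deriv (by linear_combination hcoeff)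

/-- The `l`-derivative of `J` is linear in `e` while its `e`-derivative does not depend on `l`. -/
theorem s2_s3_relation (hD : IsOpen D) (hm : m.SmoothOn D)
    (hJ : ContDiffOn ℝ ∞ J (State.region D)) (hent : ExtendedEntropyPrinciple D m J)
    (h4 : ∀ ρ ε, (ρ, ε) ∈ D → m.s4 ρ ε = 0) (h5 : ∀ ρ ε, (ρ, ε) ∈ D → m.s5 ρ ε = 0)
    (h0 : (ρ, ε) ∈ D) (hρ : ρ ≠ 0) (l h : ℝ) :
    ρ ^ 2 * m.s2 ρ ε * l - 2 * m.s3 ρ ε * ((-m.p ρ ε + capillaryModulus m ρ ε * h) * l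
      + viscousModulus m ρ ε * l ^ 2) = 0 := by
  set κ : ℝ → ℝ := fun l => ρ ^ 2 * m.s2 ρ ε * l - 2 * m.s3 ρ ε
    * ((-m.p ρ ε + capillaryModulus m ρ ε * h) * l + viscousModulus m ρ ε * l ^ 2) with hκ
  have hderiv (l : ℝ) : HasDerivAt κ (ρ ^ 2 * m.s2 ρ ε - 2 * m.s3 ρ ε * (-m.p ρ ε
      + capillaryModulus m ρ ε * h + 2 * viscousModulus m ρ ε * l)) l :=
    (((hasDerivAt_id' l).const_mul _).fun_sub ((((hasDerivAt_id' l).const_mul _).fun_add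
      ((hasDerivAt_pow 2 l).const_mul _)).const_mul _)).congr_deriv (by push_cast; ring)
  have hsplit (l e : ℝ) : J (lineState ρ ε 0 l e h) 0 = J (lineState ρ ε 0 0 e h) 0 + e * κ l := by
    have hd (l : ℝ) : HasDerivAt (fun l => J (lineState ρ ε 0 l e h) 0 - e * κ l) 0 l :=
      ((hasDerivAt_flux_l_eq hD hm hJ hent h4 h5 h0 hρ l e h).fun_sub
        ((hderiv l).const_mul e)).congr_deriv (by ring)
    have hconst :=
      is_const_of_deriv_eq_zero (fun l => (hd l).differentiableAt) (fun l => (hd l).deriv) l 0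
    simp only [hκ, mul_zero, zero_pow two_ne_zero, add_zero, sub_zero] at hconst
    linear_combination hconst
  have hflux (l : ℝ) := hasDerivAt_flux_e_eq hD hm hJ hent h4 h5 h0 hρ l 0 h
  have hunique := (hflux l).unique <| ((hflux 0).fun_add
    ((hasDerivAt_id' (0 : ℝ)).mul_const (κ l))).congr_of_eventuallyEq (.of_forall (hsplit l))
  linear_combination -hunique

theorem entropy_coefficients_eq_zero (hD : IsOpen D) (hm : m.SmoothOn D)
    (hDpos : ∀ z ∈ D, 0 < z.1)
    (hJ : ContDiffOn ℝ ∞ J (State.region D)) (hent : ExtendedEntropyPrinciple D m J)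
    (hcap : D ⊆ closure {z : ℝ × ℝ | z ∈ D ∧ m.α1 z.1 z.2 + m.α4 z.1 z.2 ≠ 0})
    (h0 : (ρ, ε) ∈ D) :
    m.s2 ρ ε = 0 ∧ m.s3 ρ ε = 0 ∧ m.s4 ρ ε = 0 ∧ m.s5 ρ ε = 0 := by
  have hρ {ρ ε : ℝ} (h : (ρ, ε) ∈ D) : ρ ≠ 0 := (hDpos _ h).ne'
  have h4 (ρ ε : ℝ) (h : (ρ, ε) ∈ D) : m.s4 ρ ε = 0 :=
    hm.s4.eq_zero_of_mul_eq_zero (A := fun z => capillaryModulus m z.1 z.2) hD hcap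
      (fun _ _ h => s4_mul_capillaryModulus_eq_zero hD hm hJ hent h (hρ h)) h
  have h5 (ρ ε : ℝ) (h : (ρ, ε) ∈ D) : m.s5 ρ ε = 0 :=
    s5_eq_zero hD hm hJ hent h (hρ h) (h4 ρ ε h)
  have hrel {ρ ε : ℝ} (h : (ρ, ε) ∈ D) := s2_s3_relation hD hm hJ hent h4 h5 h (hρ h)
  have h3 (ρ ε : ℝ) (h : (ρ, ε) ∈ D) : m.s3 ρ ε = 0 :=
    hm.s3.eq_zero_of_mul_eq_zero (A := fun z => capillaryModulus m z.1 z.2) hD hcap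
      (fun _ _ h => by linear_combination (1 / 2) * (hrel h 1 0 - hrel h 1 1)) h
  have h2 : ρ ^ 2 * m.s2 ρ ε = 0 := by
    linear_combination hrel h0 1 0 + 2 * (-m.p ρ ε + viscousModulus m ρ ε) * h3 ρ ε h0
  exact ⟨by simpa [hρ h0] using h2, h3 _ _ h0, h4 _ _ h0, h5 _ _ h0⟩

end QuadraticLineTest

section Chain

variable {D : Set (ℝ × ℝ)} {m : MaterialFunctions} {P : Profile}

theorem pd_sum {ι : Type*} (s : Finset ι) {f : ι → V → ℝ} {x : V}
    (hf : ∀ j ∈ s, DifferentiableAt ℝ (f j) x) (k : Fin 3) :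
    pd k (fun x => ∑ j ∈ s, f j x) x = ∑ j ∈ s, pd k (f j) x := by
  simp [pd, fderiv_fun_sum hf]

theorem Smooth2.hasFDerivAt_comp (hD : IsOpen D) {f : ℝ → ℝ → ℝ} (hf : Smooth2 D f)
    {r e : V → ℝ} {x : V} (hr : DifferentiableAt ℝ r x) (he : DifferentiableAt ℝ e x)
    (hx : (r x, e x) ∈ D) :
    HasFDerivAt (fun x => f (r x) (e x))
      (Korteweg.dRho f (r x) (e x) • fderiv ℝ r x + Korteweg.dEps f (r x) (e x) • fderiv ℝ e x)
      x :=
  (HasFDerivAt.comp (g := fun z : ℝ × ℝ => f z.1 z.2) (f := fun x => (r x, e x)) x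
    (hf.hasFDerivAt hD hx) (hr.hasFDerivAt.prodMk he.hasFDerivAt)).congr_fderiv (by ext; simp)

theorem densityRate_eq (hP : P.Smooth) (x : V) :
    P.densityRate x
      = -∑ j, (pd j P.rho x * P.v x j + P.rho x * pd j (fun x => P.v x j) x) := by
  simp only [Profile.densityRate,
    pd_mul (hP.rho.differentiable (by simp) x) ((hP.v _).differentiable (by simp) x)]

theorem densityRate_zero (hP : P.Smooth) (hv : P.v 0 = 0) :
    P.densityRate 0 = -(P.rho 0 * ∑ j, pd j (fun x => P.v x j) 0) := by
  simp [densityRate_eq hP, hv, Finset.mul_sum]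

theorem pd_densityRate_zero (hP : P.Smooth) (hv : P.v 0 = 0) (i : Fin 3) :
    pd i P.densityRate 0
      = -∑ j, (pd j P.rho 0 * pd i (fun x => P.v x j) 0
        + pd i P.rho 0 * pd j (fun x => P.v x j) 0
        + P.rho 0 * pd i (pd j fun x => P.v x j) 0) := by
  have hρ : DifferentiableAt ℝ P.rho 0 := hP.rho.differentiable (by simp) 0
  have hv' (j : Fin 3) : DifferentiableAt ℝ (fun x => P.v x j) 0 :=
    (hP.v j).differentiable (by simp) 0
  have hpρ (j : Fin 3) : DifferentiableAt ℝ (pd j P.rho) 0 :=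
    (contDiff_pd hP.rho j).differentiable (by simp) 0
  have hpv (j : Fin 3) : DifferentiableAt ℝ (pd j fun x => P.v x j) 0 :=
    (contDiff_pd (hP.v j) j).differentiable (by simp) 0
  have hneg (f : V → ℝ) : pd i (fun x => -f x) 0 = -pd i f 0 := by simp [pd, fderiv_fun_neg]
  rw [funext (densityRate_eq hP), hneg,
    pd_sum _ fun j _ => ((hpρ j).fun_mul (hv' j)).fun_add (hρ.fun_mul (hpv j))]
  congr 1
  refine Finset.sum_congr rfl fun j _ => ?_
  rw [pd_add ((hpρ j).fun_mul (hv' j)) (hρ.fun_mul (hpv j)), pd_mul (hpρ j) (hv' j),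
    pd_mul hρ (hpv j), hv, Pi.zero_apply]
  ring

/-- The divergence of the heat flux, as a function of the jets of the density and the energy:
`g` and `e` are their gradients, `H` and `E` their Hessians. -/
noncomputable def divHeatFlux (m : MaterialFunctions) (ρ ε : ℝ) (g e : V) (H E : T2) : ℝ :=
  m.q1 ρ ε * tr E + m.q2 ρ ε * tr H + dRho m.q1 ρ ε * dot g e + dEps m.q1 ρ ε * dot e e
    + dRho m.q2 ρ ε * dot g g + dEps m.q2 ρ ε * dot g e

theorem sum_pd_heatFlux (hD : IsOpen D) (hm : m.SmoothOn D) (hP : P.Smooth) {x : V}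
    (hx : (P.rho x, P.eps x) ∈ D) :
    ∑ j, pd j (fun x => m.heatFlux (P.jet x) j) x
      = divHeatFlux m (P.rho x) (P.eps x) (fun i => pd i P.rho x) (fun i => pd i P.eps x)
        (fun i j => pd j (pd i P.rho) x) (fun i j => pd j (pd i P.eps) x) := by
  have hρ : DifferentiableAt ℝ P.rho x := hP.rho.differentiable (by simp) x
  have hε : DifferentiableAt ℝ P.eps x := hP.eps.differentiable (by simp) x
  have hpρ (j : Fin 3) : DifferentiableAt ℝ (pd j P.rho) x :=
    (contDiff_pd hP.rho j).differentiable (by simp) x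
  have hpε (j : Fin 3) : DifferentiableAt ℝ (pd j P.eps) x :=
    (contDiff_pd hP.eps j).differentiable (by simp) x
  have h₁ := hm.q1.hasFDerivAt_comp hD hρ hε hx
  have h₂ := hm.q2.hasFDerivAt_comp hD hρ hε hx
  have hcomponent (j : Fin 3) : pd j (fun x => m.heatFlux (P.jet x) j) x
      = (dRho m.q1 (P.rho x) (P.eps x) * pd j P.rho x
          + dEps m.q1 (P.rho x) (P.eps x) * pd j P.eps x) * pd j P.eps x
        + m.q1 (P.rho x) (P.eps x) * pd j (pd j P.eps) x
        + ((dRho m.q2 (P.rho x) (P.eps x) * pd j P.rho x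
          + dEps m.q2 (P.rho x) (P.eps x) * pd j P.eps x) * pd j P.rho x
        + m.q2 (P.rho x) (P.eps x) * pd j (pd j P.rho) x) := by
    have hflux : (fun x => m.heatFlux (P.jet x) j)
        = fun x => m.q1 (P.rho x) (P.eps x) * pd j P.eps x
          + m.q2 (P.rho x) (P.eps x) * pd j P.rho x := rfl
    rw [hflux, pd_add (h₁.differentiableAt.fun_mul (hpε j)) (h₂.differentiableAt.fun_mul (hpρ j)),
      pd_mul h₁.differentiableAt (hpε j), pd_mul h₂.differentiableAt (hpρ j)]
    simp [pd, h₁.fderiv, h₂.fderiv]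
  simp only [hcomponent, divHeatFlux, tr, dot, Fin.sum_univ_three]
  ring

theorem energyRate_zero (hD : IsOpen D) (hm : m.SmoothOn D) (hP : P.Smooth) (hv : P.v 0 = 0)
    (h0 : (P.rho 0, P.eps 0) ∈ D) :
    P.energyRate m 0
      = (ddot (m.stress (P.jet 0)) (fun i j => pd j (fun x => P.v x i) 0)
        - divHeatFlux m (P.rho 0) (P.eps 0) (fun i => pd i P.rho 0) (fun i => pd i P.eps 0)
          (fun i j => pd j (pd i P.rho) 0) (fun i j => pd j (pd i P.eps) 0)) / P.rho 0 := by
  simp [Profile.energyRate, sum_pd_heatFlux hD hm hP h0, hv]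

theorem fderiv_jet (hP : P.Smooth) (x : V) (k : Fin 3) :
    fderiv ℝ P.jet x (Pi.single k 1)
      = (pd k P.rho x, pd k P.eps x, fun i => pd k (pd i P.rho) x,
        fun i j => (pd k (pd j fun x => P.v x i) x + pd k (pd i fun x => P.v x j) x) / 2,
        fun i => pd k (pd i P.eps) x, fun i j => pd k (pd j (pd i P.rho)) x) := by
  have hfd {f : V → ℝ} (hf : ContDiff ℝ ∞ f) : HasFDerivAt f (fderiv ℝ f x) x :=
    (hf.differentiable (by simp) x).hasFDerivAt
  have hL : HasFDerivAt
      (fun x (i j : Fin 3) => (pd j (fun x => P.v x i) x + pd i (fun x => P.v x j) x) / 2)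
      (ContinuousLinearMap.pi fun i => ContinuousLinearMap.pi fun j => (2 : ℝ)⁻¹ •
        (fderiv ℝ (pd j fun x => P.v x i) x + fderiv ℝ (pd i fun x => P.v x j) x)) x := by
    refine hasFDerivAt_pi.2 fun i => hasFDerivAt_pi.2 fun j => ?_
    simp only [div_eq_inv_mul]
    exact ((hfd (contDiff_pd (hP.v i) j)).add (hfd (contDiff_pd (hP.v j) i))).const_mul _
  have hjet : HasFDerivAt P.jet _ x := (hfd hP.rho).prodMk <| (hfd hP.eps).prodMk <|
    (hasFDerivAt_pi.2 fun i => hfd (contDiff_pd hP.rho i)).prodMk <| hL.prodMk <|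
    (hasFDerivAt_pi.2 fun i => hfd (contDiff_pd hP.eps i)).prodMk <|
    hasFDerivAt_pi.2 fun i => hasFDerivAt_pi.2 fun j => hfd (contDiff_pd (contDiff_pd hP.rho i) j)
  rw [hjet.fderiv]
  simp only [ContinuousLinearMap.prod_apply, Prod.mk.injEq]
  refine ⟨rfl, rfl, rfl, ?_, rfl, rfl⟩
  ext i j
  simp only [ContinuousLinearMap.coe_pi', smul_apply, add_apply, smul_eq_mul, pd]
  ring

theorem pd_flux_jet (hD : IsOpen D) {J : State → V} (hJ : ContDiffOn ℝ ∞ J (State.region D))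
    (hP : P.Smooth) {x : V} (hx : (P.rho x, P.eps x) ∈ D) (i k : Fin 3) :
    pd k (fun x => J (P.jet x) i) x
      = fderiv ℝ J (P.jet x) (fderiv ℝ P.jet x (Pi.single k 1)) i := by
  have hflux : DifferentiableAt ℝ J (P.jet x) :=
    (hJ.contDiffAt ((isOpen_region hD).mem_nhds hx)).differentiableAt (by simp)
  have hcomp : HasFDerivAt (fun x => J (P.jet x)) _ x :=
    hflux.hasFDerivAt.comp x (hP.jet.differentiable (by simp) x).hasFDerivAt
  have hcomponent : HasFDerivAt (fun x => J (P.jet x) i) _ x := hasFDerivAt_pi'.1 hcomp i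
  simp [pd, hcomponent.fderiv]

end Chain

section Polynomials

/-- The quadratic polynomial with value `c` and gradient `g` at the origin and, when `H` is
symmetric, with Hessian `H`. -/
noncomputable def quadPoly (c : ℝ) (g : V) (H : T2) (x : V) : ℝ :=
  c + ∑ i, g i * x i + (∑ i, ∑ j, H i j * (x i * x j)) / 2

theorem contDiff_quadPoly (c : ℝ) (g : V) (H : T2) : ContDiff ℝ ∞ (quadPoly c g H) := by
  unfold quadPoly; fun_prop

theorem quadPoly_zero (c : ℝ) (g : V) (H : T2) : quadPoly c g H 0 = c := by simp [quadPoly]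

theorem hasFDerivAt_coord (j : Fin 3) (x : V) : HasFDerivAt (fun x : V => x j)
    (ContinuousLinearMap.proj (R := ℝ) (φ := fun _ : Fin 3 => ℝ) j) x :=
  (ContinuousLinearMap.proj (R := ℝ) (φ := fun _ : Fin 3 => ℝ) j).hasFDerivAt

theorem pd_quadPoly (c : ℝ) (g : V) {H : T2} (hH : ∀ i j, H i j = H j i) (k : Fin 3) :
    pd k (quadPoly c g H) = quadPoly (g k) (H k) 0 := by
  funext x
  have hpoly : HasFDerivAt (quadPoly c g H) _ x :=
    ((HasFDerivAt.fun_sum fun i _ => (hasFDerivAt_coord i x).const_mul (g i)).const_add c).add <|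
      (HasFDerivAt.fun_sum fun i _ => HasFDerivAt.fun_sum fun j _ =>
        ((hasFDerivAt_coord i x).mul (hasFDerivAt_coord j x)).const_mul (H i j)).mul_const 2⁻¹
  rw [pd, hpoly.fderiv]
  fin_cases k <;> simp [quadPoly, Fin.sum_univ_three, hH 1 0, hH 2 0, hH 2 1] <;> ring

theorem contDiff_mul_dot_pow (a : ℝ) (ξ : V) (n : ℕ) :
    ContDiff ℝ ∞ fun x => a * dot ξ x ^ n := by
  unfold dot; fun_prop

theorem pd_mul_dot_pow (ξ : V) (c : ℝ) (n : ℕ) (k : Fin 3) :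
    pd k (fun x => c * dot ξ x ^ (n + 1)) = fun x => ((n + 1) * c * ξ k) * dot ξ x ^ n := by
  funext x
  have hdot : HasFDerivAt (fun x => dot ξ x) _ x :=
    HasFDerivAt.fun_sum fun i _ => (hasFDerivAt_coord i x).const_mul (ξ i)
  rw [pd, ((hdot.pow (n + 1)).const_mul c).fderiv]
  fin_cases k <;> simp [Fin.sum_univ_three] <;> ring

theorem pd_quadPoly_add_mul_dot_pow (c : ℝ) (g : V) {H : T2} (hH : ∀ i j, H i j = H j i) (a : ℝ)
    (ξ : V) (n : ℕ) (k : Fin 3) :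
    pd k (fun x => quadPoly c g H x + a * dot ξ x ^ (n + 1))
      = fun x => quadPoly (g k) (H k) 0 x + ((n + 1) * a * ξ k) * dot ξ x ^ n := by
  funext x
  rw [pd_add ((contDiff_quadPoly c g H).differentiable (by simp) x)
    ((contDiff_mul_dot_pow a ξ (n + 1)).differentiable (by simp) x), pd_quadPoly c g hH,
    pd_mul_dot_pow]

/-- A polynomial profile with prescribed derivatives at the origin: the state there is
`(ρ, ε, g, L, e, H)`, the second derivatives of the velocity are `B`, the Hessian of the energy is
`E`, and the third derivative of the density is `a ξ ⊗ ξ ⊗ ξ`. -/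
noncomputable def jetProfile (ρ ε : ℝ) (g e : V) (L H E : T2) (B : Fin 3 → T2) (a : ℝ) (ξ : V) :
    Profile :=
  ⟨fun x => quadPoly ρ g H x + a / 6 * dot ξ x ^ 3, fun x i => quadPoly 0 (L i) (B i) x,
    quadPoly ε e E⟩

variable (ρ ε : ℝ) (g e : V) (L : T2) {H E : T2} {B : Fin 3 → T2} (a : ℝ) (ξ : V)

theorem jetProfile_smooth (H E : T2) (B : Fin 3 → T2) :
    (jetProfile ρ ε g e L H E B a ξ).Smooth :=
  ⟨(contDiff_quadPoly ρ g H).add (contDiff_mul_dot_pow (a / 6) ξ 3),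
    fun i => contDiff_quadPoly 0 (L i) (B i), contDiff_quadPoly ε e E⟩

theorem rho_jetProfile_zero (H E : T2) (B : Fin 3 → T2) :
    (jetProfile ρ ε g e L H E B a ξ).rho 0 = ρ := by
  simp [jetProfile, quadPoly_zero, dot]

theorem eps_jetProfile_zero (H E : T2) (B : Fin 3 → T2) :
    (jetProfile ρ ε g e L H E B a ξ).eps 0 = ε :=
  quadPoly_zero ε e E

theorem v_jetProfile_zero (H E : T2) (B : Fin 3 → T2) :
    (jetProfile ρ ε g e L H E B a ξ).v 0 = 0 :=
  funext fun i => quadPoly_zero 0 (L i) (B i)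

theorem pd_v_jetProfile_zero (H E : T2) (hB : ∀ i j k, B i j k = B i k j) (i j : Fin 3) :
    pd j (fun x => (jetProfile ρ ε g e L H E B a ξ).v x i) 0 = L i j := by
  rw [show (fun x => (jetProfile ρ ε g e L H E B a ξ).v x i) = quadPoly 0 (L i) (B i) from rfl,
    pd_quadPoly _ _ (hB i), quadPoly_zero]

theorem pd_pd_v_jetProfile_zero (H E : T2) (hB : ∀ i j k, B i j k = B i k j) (i j k : Fin 3) :
    pd k (pd j fun x => (jetProfile ρ ε g e L H E B a ξ).v x i) 0 = B i j k := by
  rw [show (fun x => (jetProfile ρ ε g e L H E B a ξ).v x i) = quadPoly 0 (L i) (B i) from rfl,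
    pd_quadPoly _ _ (hB i), pd_quadPoly _ _ fun _ _ => rfl, quadPoly_zero]

theorem pd_eps_jetProfile_zero (H : T2) (B : Fin 3 → T2) (hE : ∀ i j, E i j = E j i) (i : Fin 3) :
    pd i (jetProfile ρ ε g e L H E B a ξ).eps 0 = e i := by
  rw [jetProfile, pd_quadPoly _ _ hE, quadPoly_zero]

theorem pd_pd_eps_jetProfile_zero (H : T2) (B : Fin 3 → T2) (hE : ∀ i j, E i j = E j i)
    (i j : Fin 3) : pd j (pd i (jetProfile ρ ε g e L H E B a ξ).eps) 0 = E i j := by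
  rw [jetProfile, pd_quadPoly _ _ hE, pd_quadPoly _ _ fun _ _ => rfl, quadPoly_zero]

theorem pd_rho_jetProfile_zero (hH : ∀ i j, H i j = H j i) (E : T2) (B : Fin 3 → T2) (i : Fin 3) :
    pd i (jetProfile ρ ε g e L H E B a ξ).rho 0 = g i := by
  rw [jetProfile, pd_quadPoly_add_mul_dot_pow _ _ hH]
  simp [quadPoly_zero, dot]

theorem pd_pd_rho_jetProfile_zero (hH : ∀ i j, H i j = H j i) (E : T2) (B : Fin 3 → T2)
    (i j : Fin 3) : pd j (pd i (jetProfile ρ ε g e L H E B a ξ).rho) 0 = H i j := by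
  rw [jetProfile, pd_quadPoly_add_mul_dot_pow _ _ hH,
    pd_quadPoly_add_mul_dot_pow _ _ fun _ _ => rfl]
  simp [quadPoly_zero, dot]

theorem pd_pd_pd_rho_jetProfile_zero (hH : ∀ i j, H i j = H j i) (E : T2) (B : Fin 3 → T2)
    (i j k : Fin 3) :
    pd k (pd j (pd i (jetProfile ρ ε g e L H E B a ξ).rho)) 0 = a * (ξ i * ξ j * ξ k) := by
  rw [jetProfile, pd_quadPoly_add_mul_dot_pow _ _ hH,
    pd_quadPoly_add_mul_dot_pow _ _ fun _ _ => rfl, pd_quadPoly_add_mul_dot_pow _ _ fun _ _ => rfl]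
  simp only [quadPoly_zero, Pi.zero_apply, pow_zero]
  push_cast
  ring

theorem jet_jetProfile_zero (hL : ∀ i j, L i j = L j i) (hH : ∀ i j, H i j = H j i)
    (hE : ∀ i j, E i j = E j i) (hB : ∀ i j k, B i j k = B i k j) :
    (jetProfile ρ ε g e L H E B a ξ).jet 0 = (ρ, ε, g, L, e, H) := by
  have hsymm (i j : Fin 3) : (L i j + L j i) / 2 = L i j := by rw [hL j i]; ring
  simp only [Profile.jet, rho_jetProfile_zero, eps_jetProfile_zero, pd_rho_jetProfile_zero, hH,
    pd_v_jetProfile_zero _ _ _ _ _ _ _ H E hB, pd_eps_jetProfile_zero _ _ _ _ _ _ _ H B hE,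
    pd_pd_rho_jetProfile_zero _ _ _ _ _ _ _ hH, hsymm, implies_true]

end Polynomials

section JetInequality

variable {D : Set (ℝ × ℝ)} {m : MaterialFunctions} {J : State → V} {ρ ε : ℝ}

/-- The derivative with respect to the energy, that is, the inverse temperature, of the entropy
`s₀ + s₁ |∇ρ|²` at the density gradient `g`. -/
noncomputable def coldness (m : MaterialFunctions) (ρ ε : ℝ) (g : V) : ℝ :=
  dEps m.s0 ρ ε + dEps m.s1 ρ ε * dot g g

/-- The part of the entropy production that does not involve `∇∇v`, `∇∇ε` and `∇∇∇ρ`, once the rates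
of change are eliminated by the balance equations and the entropy is `s₀ + s₁ |∇ρ|²`. -/
noncomputable def residualProduction (m : MaterialFunctions) (J : State → V) (ρ ε : ℝ) (g : V)
    (L : T2) (e : V) (H : T2) : ℝ :=
  -ρ ^ 2 * (dRho m.s0 ρ ε + dRho m.s1 ρ ε * dot g g) * tr L
    + coldness m ρ ε g * (ddot (m.stress (ρ, ε, g, L, e, H)) L - divHeatFlux m ρ ε g e H 0)
    - 2 * ρ * m.s1 ρ ε * ∑ i, g i * ∑ j, (g j * L j i + g i * L j j)
    + ∑ j, fderiv ℝ J (ρ, ε, g, L, e, H) (g j, e j, fun i => H i j, 0, 0, 0) j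

theorem fderiv_entropy_of_coefficients_eq_zero (hD : IsOpen D) (hm : m.SmoothOn D)
    (hs : ∀ ρ ε, (ρ, ε) ∈ D → m.s2 ρ ε = 0 ∧ m.s3 ρ ε = 0 ∧ m.s4 ρ ε = 0 ∧ m.s5 ρ ε = 0)
    (h0 : (ρ, ε) ∈ D) (g : V) (L : T2) (e : V) (H : T2) (y : State) :
    fderiv ℝ m.entropy (ρ, ε, g, L, e, H) y
      = (dRho m.s0 ρ ε + dRho m.s1 ρ ε * dot g g) * y.rho + coldness m ρ ε g * y.eps
        + 2 * m.s1 ρ ε * dot g y.gradRho := by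
  have hs2 ρ ε (h : (ρ, ε) ∈ D) : m.s2 ρ ε = 0 := (hs ρ ε h).1
  have hs3 ρ ε (h : (ρ, ε) ∈ D) : m.s3 ρ ε = 0 := (hs ρ ε h).2.1
  have hs4 ρ ε (h : (ρ, ε) ∈ D) : m.s4 ρ ε = 0 := (hs ρ ε h).2.2.1
  have hs5 ρ ε (h : (ρ, ε) ∈ D) : m.s5 ρ ε = 0 := (hs ρ ε h).2.2.2
  rw [fderiv_entropy hD hm (show (ρ, ε, g, L, e, H) ∈ State.region D from h0)]
  simp only [State.rho, State.eps, State.gradRho, coldness, hs2 ρ ε h0, hs3 ρ ε h0, hs4 ρ ε h0,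
    hs5 ρ ε h0, dRho_eq_zero hD hs2 h0, dRho_eq_zero hD hs3 h0, dRho_eq_zero hD hs4 h0,
    dRho_eq_zero hD hs5 h0, dEps_eq_zero hD hs2 h0, dEps_eq_zero hD hs3 h0, dEps_eq_zero hD hs4 h0,
    dEps_eq_zero hD hs5 h0]
  ring

theorem divHeatFlux_eq_add (m : MaterialFunctions) (ρ ε : ℝ) (g e : V) (H E : T2) :
    divHeatFlux m ρ ε g e H E = divHeatFlux m ρ ε g e H 0 + m.q1 ρ ε * tr E := by
  simp only [divHeatFlux, tr, Pi.zero_apply, Finset.sum_const_zero]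
  ring

section JetProfile

variable (g e : V) {L H E : T2} {B : Fin 3 → T2} (a : ℝ) (ξ : V)

theorem rho_jet_rates_jetProfile_zero (m : MaterialFunctions) (ρ ε : ℝ) (H E : T2)
    (hB : ∀ i j k, B i j k = B i k j) :
    (((jetProfile ρ ε g e L H E B a ξ).rates m).jet 0).rho = -(ρ * tr L) := by
  change (jetProfile ρ ε g e L H E B a ξ).densityRate 0 = _
  rw [densityRate_zero (jetProfile_smooth ρ ε g e L a ξ H E B)
    (v_jetProfile_zero ρ ε g e L a ξ H E B)]
  simp only [rho_jetProfile_zero, pd_v_jetProfile_zero ρ ε g e L a ξ H E hB, tr]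

theorem gradRho_jet_rates_jetProfile_zero (m : MaterialFunctions) (ρ ε : ℝ) (E : T2)
    (hH : ∀ i j, H i j = H j i) (hB : ∀ i j k, B i j k = B i k j) (i : Fin 3) :
    (((jetProfile ρ ε g e L H E B a ξ).rates m).jet 0).gradRho i
      = -∑ j, (g j * L j i + g i * L j j + ρ * B j j i) := by
  change pd i (jetProfile ρ ε g e L H E B a ξ).densityRate 0 = _
  rw [pd_densityRate_zero (jetProfile_smooth ρ ε g e L a ξ H E B)
    (v_jetProfile_zero ρ ε g e L a ξ H E B)]
  simp only [rho_jetProfile_zero, pd_rho_jetProfile_zero ρ ε g e L a ξ hH,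
    pd_v_jetProfile_zero ρ ε g e L a ξ H E hB, pd_pd_v_jetProfile_zero ρ ε g e L a ξ H E hB]

theorem eps_jet_rates_jetProfile_zero (hD : IsOpen D) (hm : m.SmoothOn D) (h0 : (ρ, ε) ∈ D)
    (hL : ∀ i j, L i j = L j i) (hH : ∀ i j, H i j = H j i) (hE : ∀ i j, E i j = E j i)
    (hB : ∀ i j k, B i j k = B i k j) :
    (((jetProfile ρ ε g e L H E B a ξ).rates m).jet 0).eps
      = (ddot (m.stress (ρ, ε, g, L, e, H)) L - divHeatFlux m ρ ε g e H E) / ρ := by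
  change (jetProfile ρ ε g e L H E B a ξ).energyRate m 0 = _
  rw [energyRate_zero hD hm (jetProfile_smooth ρ ε g e L a ξ H E B)
    (v_jetProfile_zero ρ ε g e L a ξ H E B) (by simpa [rho_jetProfile_zero, eps_jetProfile_zero])]
  simp only [rho_jetProfile_zero, eps_jetProfile_zero,
    jet_jetProfile_zero ρ ε g e L a ξ hL hH hE hB, pd_rho_jetProfile_zero ρ ε g e L a ξ hH,
    pd_v_jetProfile_zero ρ ε g e L a ξ H E hB, pd_eps_jetProfile_zero ρ ε g e L a ξ H B hE,
    pd_pd_eps_jetProfile_zero ρ ε g e L a ξ H B hE, pd_pd_rho_jetProfile_zero ρ ε g e L a ξ hH]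

theorem pd_flux_jetProfile_zero (hD : IsOpen D) (hJ : ContDiffOn ℝ ∞ J (State.region D))
    (h0 : (ρ, ε) ∈ D) (hL : ∀ i j, L i j = L j i) (hH : ∀ i j, H i j = H j i)
    (hE : ∀ i j, E i j = E j i) (hB : ∀ i j k, B i j k = B i k j) (j : Fin 3) :
    pd j (fun x => J ((jetProfile ρ ε g e L H E B a ξ).jet x) j) 0
      = fderiv ℝ J (ρ, ε, g, L, e, H) (g j, e j, fun i => H i j, 0, 0, 0) j
        + fderiv ℝ J (ρ, ε, g, L, e, H) (0, 0, 0, fun i k => (B i k j + B k i j) / 2,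
          fun i => E i j, fun i k => a * (ξ i * ξ k * ξ j)) j := by
  have hP := jetProfile_smooth ρ ε g e L a ξ H E B
  rw [pd_flux_jet hD hJ hP (by simpa [rho_jetProfile_zero, eps_jetProfile_zero]), fderiv_jet hP,
    jet_jetProfile_zero ρ ε g e L a ξ hL hH hE hB, ← Pi.add_apply, ← map_add]
  simp [pd_rho_jetProfile_zero ρ ε g e L a ξ hH, pd_eps_jetProfile_zero ρ ε g e L a ξ H B hE,
    pd_pd_rho_jetProfile_zero ρ ε g e L a ξ hH, pd_pd_v_jetProfile_zero ρ ε g e L a ξ H E hB,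
    pd_pd_eps_jetProfile_zero ρ ε g e L a ξ H B hE,
    pd_pd_pd_rho_jetProfile_zero ρ ε g e L a ξ hH]

theorem jet_inequality (hD : IsOpen D) (hm : m.SmoothOn D)
    (hJ : ContDiffOn ℝ ∞ J (State.region D)) (hent : ExtendedEntropyPrinciple D m J)
    (hs : ∀ ρ ε, (ρ, ε) ∈ D → m.s2 ρ ε = 0 ∧ m.s3 ρ ε = 0 ∧ m.s4 ρ ε = 0 ∧ m.s5 ρ ε = 0)
    (h0 : (ρ, ε) ∈ D) (hρ : ρ ≠ 0) (hL : ∀ i j, L i j = L j i) (hH : ∀ i j, H i j = H j i)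
    (hE : ∀ i j, E i j = E j i) (hB : ∀ i j k, B i j k = B i k j) :
    0 ≤ residualProduction m J ρ ε g L e H
      + (-coldness m ρ ε g * m.q1 ρ ε * tr E - 2 * ρ ^ 2 * m.s1 ρ ε * ∑ i, g i * ∑ j, B j j i
        + ∑ j, fderiv ℝ J (ρ, ε, g, L, e, H) (0, 0, 0, fun i k => (B i k j + B k i j) / 2,
          fun i => E i j, fun i k => a * (ξ i * ξ k * ξ j)) j) := by
  have hreduced := reduced_entropy_inequality hD hm hJ hent
    (jetProfile_smooth ρ ε g e L a ξ H E B) (v_jetProfile_zero ρ ε g e L a ξ H E B)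
    (by simpa [rho_jetProfile_zero, eps_jetProfile_zero]) (by simpa [rho_jetProfile_zero])
  simp only [pd_flux_jetProfile_zero g e a ξ hD hJ h0 hL hH hE hB,
    jet_jetProfile_zero ρ ε g e L a ξ hL hH hE hB, rho_jetProfile_zero, Finset.sum_add_distrib,
    fderiv_entropy_of_coefficients_eq_zero hD hm hs h0,
    rho_jet_rates_jetProfile_zero g e a ξ m ρ ε H E hB,
    eps_jet_rates_jetProfile_zero g e a ξ hD hm h0 hL hH hE hB, divHeatFlux_eq_add m ρ ε g e H E,
    dot, gradRho_jet_rates_jetProfile_zero g e a ξ m ρ ε E hH hB] at hreduced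
  refine hreduced.trans_eq ?_
  have hcancel (x : ℝ) : ρ * (coldness m ρ ε g * (x / ρ)) = coldness m ρ ε g * x := by field_simp
  rw [mul_add, mul_add, hcancel]
  simp only [residualProduction, dot, Fin.sum_univ_three]
  ring

theorem highest_order_eq_zero (hD : IsOpen D) (hm : m.SmoothOn D)
    (hJ : ContDiffOn ℝ ∞ J (State.region D)) (hent : ExtendedEntropyPrinciple D m J)
    (hs : ∀ ρ ε, (ρ, ε) ∈ D → m.s2 ρ ε = 0 ∧ m.s3 ρ ε = 0 ∧ m.s4 ρ ε = 0 ∧ m.s5 ρ ε = 0)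
    (h0 : (ρ, ε) ∈ D) (hρ : ρ ≠ 0) (hL : ∀ i j, L i j = L j i) (hH : ∀ i j, H i j = H j i)
    (hE : ∀ i j, E i j = E j i) (hB : ∀ i j k, B i j k = B i k j) :
    -coldness m ρ ε g * m.q1 ρ ε * tr E - 2 * ρ ^ 2 * m.s1 ρ ε * ∑ i, g i * ∑ j, B j j i
      + ∑ j, fderiv ℝ J (ρ, ε, g, L, e, H) (0, 0, 0, fun i k => (B i k j + B k i j) / 2,
        fun i => E i j, fun i k => a * (ξ i * ξ k * ξ j)) j = 0 := by
  refine eq_zero_of_forall_affine_nonneg (c := residualProduction m J ρ ε g L e H) fun t => ?_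
  have hscale (j : Fin 3) : ((0, 0, 0, fun i k => ((t • B) i k j + (t • B) k i j) / 2,
        fun i => (t • E) i j, fun i k => t * a * (ξ i * ξ k * ξ j)) : State)
      = t • (0, 0, 0, fun i k => (B i k j + B k i j) / 2, fun i => E i j,
        fun i k => a * (ξ i * ξ k * ξ j)) := by
    simp only [Prod.smul_mk, smul_zero, Prod.mk.injEq, true_and]
    refine ⟨?_, rfl, ?_⟩ <;> ext <;> simp <;> ring
  have h := jet_inequality g e (t * a) ξ hD hm hJ hent hs h0 hρ hL hH (E := t • E) (B := t • B)
    (fun i j => by simp [hE i j]) (fun i j k => by simp [hB i j k])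
  simp only [hscale, map_smul] at h
  refine h.trans_eq ?_
  simp only [tr, Pi.smul_apply, smul_eq_mul, Fin.sum_univ_three]
  ring

theorem residualProduction_nonneg (hD : IsOpen D) (hm : m.SmoothOn D)
    (hJ : ContDiffOn ℝ ∞ J (State.region D)) (hent : ExtendedEntropyPrinciple D m J)
    (hs : ∀ ρ ε, (ρ, ε) ∈ D → m.s2 ρ ε = 0 ∧ m.s3 ρ ε = 0 ∧ m.s4 ρ ε = 0 ∧ m.s5 ρ ε = 0)
    (h0 : (ρ, ε) ∈ D) (hρ : ρ ≠ 0) (hL : ∀ i j, L i j = L j i) (hH : ∀ i j, H i j = H j i) :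
    0 ≤ residualProduction m J ρ ε g L e H := by
  have hE (i j : Fin 3) : (0 : T2) i j = (0 : T2) j i := rfl
  have hB (i j k : Fin 3) : (0 : Fin 3 → T2) i j k = (0 : Fin 3 → T2) i k j := rfl
  have h := jet_inequality g e 0 0 hD hm hJ hent hs h0 hρ hL hH hE hB
  rwa [highest_order_eq_zero g e 0 0 hD hm hJ hent hs h0 hρ hL hH hE hB, add_zero] at h

end JetProfile

end JetInequality

/-- The tensor `ξ ⊗ ξ`. -/
def outer (ξ : V) : T2 := fun i j => ξ i * ξ j

theorem outer_symm (ξ : V) (i j : Fin 3) : outer ξ i j = outer ξ j i := mul_comm _ _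

theorem add_smul_outer_symm {H : T2} (hH : ∀ i j, H i j = H j i) (t : ℝ) (ξ : V) (i j : Fin 3) :
    (H + t • outer ξ) i j = (H + t • outer ξ) j i := by
  simp [hH i j, outer_symm ξ i j]

/-- The consequences of the entropy principle once the entropy is `s₀ + s₁ |∇ρ|²`: the coefficients
of the derivatives of order one higher than those in the state vanish, and the remaining terms are
nonnegative. -/
structure FluxConditions (D : Set (ℝ × ℝ)) (m : MaterialFunctions) (J : State → V) : Prop where
  dL : ∀ {ρ ε}, (ρ, ε) ∈ D → ∀ (g e : V) {L H S : T2}, (∀ i j, L i j = L j i) →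
    (∀ i j, H i j = H j i) → (∀ i j, S i j = S j i) → ∀ i,
    fderiv ℝ J (ρ, ε, g, L, e, H) (0, 0, 0, S, 0, 0) i = 2 * ρ ^ 2 * m.s1 ρ ε * tr S * g i
  dGradEps : ∀ {ρ ε}, (ρ, ε) ∈ D → ∀ (g e : V) {L H : T2}, (∀ i j, L i j = L j i) →
    (∀ i j, H i j = H j i) → ∀ ξ : V,
    dot ξ (fderiv ℝ J (ρ, ε, g, L, e, H) (0, 0, 0, 0, ξ, 0))
      = coldness m ρ ε g * m.q1 ρ ε * dot ξ ξ
  dHess : ∀ {ρ ε}, (ρ, ε) ∈ D → ∀ (g e : V) {L H : T2}, (∀ i j, L i j = L j i) →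
    (∀ i j, H i j = H j i) → ∀ ξ : V,
    dot ξ (fderiv ℝ J (ρ, ε, g, L, e, H) (0, 0, 0, 0, 0, outer ξ)) = 0
  nonneg : ∀ {ρ ε}, (ρ, ε) ∈ D → ∀ (g e : V) {L H : T2}, (∀ i j, L i j = L j i) →
    (∀ i j, H i j = H j i) → 0 ≤ residualProduction m J ρ ε g L e H

section Extraction

variable {D : Set (ℝ × ℝ)} {m : MaterialFunctions} {J : State → V} {ρ ε : ℝ} {g e : V} {L H S : T2}

theorem fderiv_flux_L (hD : IsOpen D) (hm : m.SmoothOn D)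
    (hJ : ContDiffOn ℝ ∞ J (State.region D)) (hent : ExtendedEntropyPrinciple D m J)
    (hs : ∀ ρ ε, (ρ, ε) ∈ D → m.s2 ρ ε = 0 ∧ m.s3 ρ ε = 0 ∧ m.s4 ρ ε = 0 ∧ m.s5 ρ ε = 0)
    (h0 : (ρ, ε) ∈ D) (hρ : ρ ≠ 0) (hL : ∀ i j, L i j = L j i) (hH : ∀ i j, H i j = H j i)
    (hS : ∀ i j, S i j = S j i) (i : Fin 3) :
    fderiv ℝ J (ρ, ε, g, L, e, H) (0, 0, 0, S, 0, 0) i = 2 * ρ ^ 2 * m.s1 ρ ε * tr S * g i := by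
  let B : Fin 3 → T2 := fun a b k => S a b * delta k i + S a k * delta b i - S b k * delta a i
  have hB a b k : B a b k = B a k b := by simp only [B, hS k b]; ring
  have hsymm j : (fun a b => (B a b j + B b a j) / 2) = delta j i • S := by
    ext a b
    simp only [B, Pi.smul_apply, smul_eq_mul, hS b a]
    ring
  have hdiv : ∑ k, g k * ∑ j, B j j k = tr S * g i := by
    simp only [B, tr, Fin.sum_univ_three]
    fin_cases i <;> simp [delta] <;> ring
  have hslot j : ((0, 0, 0, delta j i • S, fun i => (0 : T2) i j,
      fun i k => 0 * ((0 : V) i * (0 : V) k * (0 : V) j)) : State)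
      = delta j i • (0, 0, 0, S, 0, 0) := by
    simp only [Prod.smul_mk, smul_zero, Prod.mk.injEq, true_and]
    exact ⟨rfl, by ext; simp⟩
  have h := highest_order_eq_zero g e 0 0 hD hm hJ hent hs h0 hρ hL hH (E := 0) (fun _ _ => rfl) hB
  simp only [hsymm, hdiv, hslot, map_smul] at h
  have hsum : ∑ j, (delta j i • fderiv ℝ J (ρ, ε, g, L, e, H) (0, 0, 0, S, 0, 0)) j
      = fderiv ℝ J (ρ, ε, g, L, e, H) (0, 0, 0, S, 0, 0) i := by simp [delta]
  have htr : tr (0 : T2) = 0 := by simp [tr]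
  rw [hsum, htr] at h
  linear_combination h

theorem dot_fderiv_flux_gradEps (hD : IsOpen D) (hm : m.SmoothOn D)
    (hJ : ContDiffOn ℝ ∞ J (State.region D)) (hent : ExtendedEntropyPrinciple D m J)
    (hs : ∀ ρ ε, (ρ, ε) ∈ D → m.s2 ρ ε = 0 ∧ m.s3 ρ ε = 0 ∧ m.s4 ρ ε = 0 ∧ m.s5 ρ ε = 0)
    (h0 : (ρ, ε) ∈ D) (hρ : ρ ≠ 0) (hL : ∀ i j, L i j = L j i) (hH : ∀ i j, H i j = H j i)
    (ξ : V) :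
    dot ξ (fderiv ℝ J (ρ, ε, g, L, e, H) (0, 0, 0, 0, ξ, 0))
      = coldness m ρ ε g * m.q1 ρ ε * dot ξ ξ := by
  have hslot j : ((0, 0, 0, fun i k => ((0 : Fin 3 → T2) i k j + (0 : Fin 3 → T2) k i j) / 2,
      fun i => outer ξ i j, fun i k => 0 * ((0 : V) i * (0 : V) k * (0 : V) j)) : State)
      = ξ j • (0, 0, 0, 0, ξ, 0) := by
    simp only [Prod.smul_mk, smul_zero, Prod.mk.injEq, true_and]
    refine ⟨?_, ?_, ?_⟩ <;> ext <;> simp [outer, mul_comm]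
  have h := highest_order_eq_zero g e 0 0 hD hm hJ hent hs h0 hρ hL hH (outer_symm ξ) (B := 0)
    fun _ _ _ => rfl
  simp only [hslot] at h
  simp only [map_smul, Pi.smul_apply, smul_eq_mul, Pi.zero_apply, Finset.sum_const_zero, mul_zero,
    sub_zero, tr, outer] at h
  simp only [dot]
  linear_combination h

theorem dot_fderiv_flux_hess (hD : IsOpen D) (hm : m.SmoothOn D)
    (hJ : ContDiffOn ℝ ∞ J (State.region D)) (hent : ExtendedEntropyPrinciple D m J)
    (hs : ∀ ρ ε, (ρ, ε) ∈ D → m.s2 ρ ε = 0 ∧ m.s3 ρ ε = 0 ∧ m.s4 ρ ε = 0 ∧ m.s5 ρ ε = 0)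
    (h0 : (ρ, ε) ∈ D) (hρ : ρ ≠ 0) (hL : ∀ i j, L i j = L j i) (hH : ∀ i j, H i j = H j i)
    (ξ : V) : dot ξ (fderiv ℝ J (ρ, ε, g, L, e, H) (0, 0, 0, 0, 0, outer ξ)) = 0 := by
  have hslot j : ((0, 0, 0, fun i k => ((0 : Fin 3 → T2) i k j + (0 : Fin 3 → T2) k i j) / 2,
      fun i => (0 : T2) i j, fun i k => 1 * (ξ i * ξ k * ξ j)) : State)
      = ξ j • (0, 0, 0, 0, 0, outer ξ) := by
    simp only [Prod.smul_mk, smul_zero, Prod.mk.injEq, true_and]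
    refine ⟨?_, ?_, ?_⟩ <;> ext <;> simp [outer, mul_comm]
  have h := highest_order_eq_zero g e 1 ξ hD hm hJ hent hs h0 hρ hL hH (E := 0) (B := 0)
    (fun _ _ => rfl) fun _ _ _ => rfl
  simp only [hslot] at h
  simpa only [map_smul, Pi.smul_apply, smul_eq_mul, Pi.zero_apply, Finset.sum_const_zero, mul_zero,
    sub_zero, tr, zero_add, dot] using h

theorem fluxConditions (hD : IsOpen D) (hDpos : ∀ z ∈ D, 0 < z.1) (hm : m.SmoothOn D)
    (hJ : ContDiffOn ℝ ∞ J (State.region D)) (hent : ExtendedEntropyPrinciple D m J)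
    (hs : ∀ ρ ε, (ρ, ε) ∈ D → m.s2 ρ ε = 0 ∧ m.s3 ρ ε = 0 ∧ m.s4 ρ ε = 0 ∧ m.s5 ρ ε = 0) :
    FluxConditions D m J where
  dL h0 _ _ := fderiv_flux_L hD hm hJ hent hs h0 (hDpos _ h0).ne'
  dGradEps h0 _ _ := dot_fderiv_flux_gradEps hD hm hJ hent hs h0 (hDpos _ h0).ne'
  dHess h0 _ _ := dot_fderiv_flux_hess hD hm hJ hent hs h0 (hDpos _ h0).ne'
  nonneg h0 g e := residualProduction_nonneg g e hD hm hJ hent hs h0 (hDpos _ h0).ne'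

end Extraction

theorem eq_add_mul_of_forall_hasDerivAt {f : ℝ → ℝ} {c : ℝ} (h : ∀ t, HasDerivAt f c t) (t : ℝ) :
    f t = f 0 + t * c := by
  have hsub (s : ℝ) : HasDerivAt (fun s => f s - s * c) 0 s := by
    simpa using (h s).fun_sub ((hasDerivAt_id s).mul_const c)
  have hconst := is_const_of_deriv_eq_zero (fun s => (hsub s).differentiableAt)
    (fun s => (hsub s).deriv) t 0
  simp only [zero_mul, sub_zero] at hconst
  linarith

theorem hasDerivAt_dot_flux {D : Set (ℝ × ℝ)} {J : State → V} (hD : IsOpen D)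
    (hJ : ContDiffOn ℝ ∞ J (State.region D)) (ξ : V) {γ : ℝ → State} {γ' : State} {t : ℝ}
    (hγ : HasDerivAt γ γ' t) (h : γ t ∈ State.region D) :
    HasDerivAt (fun t => dot ξ (J (γ t))) (dot ξ (fderiv ℝ J (γ t) γ')) t :=
  HasDerivAt.fun_sum fun i _ => (hasDerivAt_flux_comp hD hJ hγ h i).const_mul (ξ i)

namespace FluxConditions

variable {D : Set (ℝ × ℝ)} {m : MaterialFunctions} {J : State → V} {ρ ε : ℝ}

theorem flux_L (hc : FluxConditions D m J) (hD : IsOpen D)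
    (hJ : ContDiffOn ℝ ∞ J (State.region D)) (h0 : (ρ, ε) ∈ D) (g e : V) {L H : T2}
    (hL : ∀ i j, L i j = L j i) (hH : ∀ i j, H i j = H j i) (i : Fin 3) :
    J (ρ, ε, g, L, e, H) i = J (ρ, ε, g, 0, e, H) i + 2 * ρ ^ 2 * m.s1 ρ ε * tr L * g i := by
  have hderiv (t : ℝ) : HasDerivAt (fun t : ℝ => J (ρ, ε, g, t • L, e, H) i)
      (2 * ρ ^ 2 * m.s1 ρ ε * tr L * g i) t := by
    have hγ : HasDerivAt (fun t : ℝ => ((ρ, ε, g, t • L, e, H) : State)) (0, 0, 0, L, 0, 0) t :=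
      (hasDerivAt_const t ρ).prodMk <| (hasDerivAt_const t ε).prodMk <|
        (hasDerivAt_const t g).prodMk <| HasDerivAt.prodMk
          (by simpa using (hasDerivAt_id t).smul_const L) <|
        (hasDerivAt_const t e).prodMk (hasDerivAt_const t H)
    exact (hasDerivAt_flux_comp hD hJ hγ h0 i).congr_deriv
      (hc.dL h0 g e (fun i j => by simp [hL i j]) hH hL i)
  simpa using eq_add_mul_of_forall_hasDerivAt hderiv 1

theorem flux_hess (hc : FluxConditions D m J) (hD : IsOpen D)
    (hJ : ContDiffOn ℝ ∞ J (State.region D)) (h0 : (ρ, ε) ∈ D) (g e : V) {H : T2}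
    (hH : ∀ i j, H i j = H j i) (ξ : V) (t : ℝ) :
    dot ξ (J (ρ, ε, g, 0, e, H + t • outer ξ)) = dot ξ (J (ρ, ε, g, 0, e, H)) := by
  have hderiv (t : ℝ) :
      HasDerivAt (fun t : ℝ => dot ξ (J (ρ, ε, g, 0, e, H + t • outer ξ))) 0 t := by
    have hγ : HasDerivAt (fun t : ℝ => ((ρ, ε, g, 0, e, H + t • outer ξ) : State))
        (0, 0, 0, 0, 0, outer ξ) t :=
      (hasDerivAt_const t ρ).prodMk <| (hasDerivAt_const t ε).prodMk <|
        (hasDerivAt_const t g).prodMk <| (hasDerivAt_const t 0).prodMk <|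
        (hasDerivAt_const t e).prodMk <| by
          simpa using ((hasDerivAt_id t).smul_const (outer ξ)).const_add H
    exact (hasDerivAt_dot_flux hD hJ ξ hγ h0).congr_deriv
      (hc.dHess h0 g e (fun _ _ => rfl) (add_smul_outer_symm hH t ξ) ξ)
  simpa using eq_add_mul_of_forall_hasDerivAt hderiv t

theorem flux_gradEps (hc : FluxConditions D m J) (hD : IsOpen D)
    (hJ : ContDiffOn ℝ ∞ J (State.region D)) (h0 : (ρ, ε) ∈ D) (g e : V) {H : T2}
    (hH : ∀ i j, H i j = H j i) (ξ : V) :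
    dot ξ (J (ρ, ε, g, 0, e + ξ, H)) = dot ξ (J (ρ, ε, g, 0, e, H))
      + coldness m ρ ε g * m.q1 ρ ε * dot ξ ξ := by
  have hderiv (t : ℝ) : HasDerivAt (fun t : ℝ => dot ξ (J (ρ, ε, g, 0, e + t • ξ, H)))
      (coldness m ρ ε g * m.q1 ρ ε * dot ξ ξ) t := by
    have hγ : HasDerivAt (fun t : ℝ => ((ρ, ε, g, 0, e + t • ξ, H) : State))
        (0, 0, 0, 0, ξ, 0) t :=
      (hasDerivAt_const t ρ).prodMk <| (hasDerivAt_const t ε).prodMk <|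
        (hasDerivAt_const t g).prodMk <| (hasDerivAt_const t 0).prodMk <| HasDerivAt.prodMk
          (by simpa using ((hasDerivAt_id t).smul_const ξ).const_add e) (hasDerivAt_const t H)
    exact (hasDerivAt_dot_flux hD hJ ξ hγ h0).congr_deriv
      (hc.dGradEps h0 g _ (fun _ _ => rfl) hH ξ)
  simpa using eq_add_mul_of_forall_hasDerivAt hderiv 1

end FluxConditions

theorem eq_add_mul_of_map_midpoint {φ : ℝ → ℝ} (hφ : Continuous φ)
    (h : ∀ a b, φ (midpoint ℝ a b) = midpoint ℝ (φ a) (φ b)) (t : ℝ) :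
    φ t = φ 0 + t * (φ 1 - φ 0) := by
  have hline := (AffineMap.ofMapMidpoint φ h hφ).apply_lineMap 0 1 t
  simpa [AffineMap.lineMap_apply, AffineMap.ofMapMidpoint, add_comm] using hline

theorem eq_zero_of_euler_ode {φ : ℝ → ℝ} (hφ : Differentiable ℝ φ) (n : ℕ) (h0 : φ 0 = 0)
    (h : ∀ x, x ≠ 0 → deriv φ x + (n + 1) * φ x / x = 0) {x : ℝ} (hx : x ≠ 0) : φ x = 0 := by
  have hd y : HasDerivAt (fun y => y ^ (n + 1) * φ y) 0 y := by
    refine ((hasDerivAt_pow (n + 1) y).fun_mul (hφ y).hasDerivAt).congr_deriv ?_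
    rcases eq_or_ne y 0 with rfl | hy
    · simp [h0]
    · rw [eq_neg_of_add_eq_zero_left (h y hy)]
      rw [Nat.add_sub_cancel, Nat.cast_add_one]
      field_simp
      ring
  have hconst := is_const_of_deriv_eq_zero (fun y => (hd y).differentiableAt)
    (fun y => (hd y).deriv) x 0
  simp only [h0, mul_zero] at hconst
  exact (mul_eq_zero.1 hconst).resolve_left (pow_ne_zero _ hx)

section HessianDependence

variable {f : T2 → V}
  (hf : ∀ {H : T2}, (∀ i j, H i j = H j i) → ∀ (ξ : V) (t : ℝ),
    dot ξ (f (H + t • outer ξ)) = dot ξ (f H))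
  {H : T2} (hH : ∀ i j, H i j = H j i)

include hf hH

/-- `v (x ⊗ x + y ⊗ y) = (v / 2) ((x + y) ⊗ (x + y) + (x - y) ⊗ (x - y))`, and the sum and the
difference of the two components are invariant along one of these directions each. -/
theorem dot_apply_add_outer_sub (x y : V) (v : ℝ) :
    dot x (f (H + v • outer y)) - dot x (f H)
      = dot y (f (H + v • outer x)) - 2 * dot y (f (H + (v / 2) • outer (x + y)))
        + dot y (f H) := by
  have hsum : H + v • outer y + v • outer x
      = H + (v / 2) • outer (x + y) + (v / 2) • outer (x - y) := by
    ext i j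
    simp only [outer, Pi.add_apply, Pi.sub_apply, Pi.smul_apply, smul_eq_mul]
    ring
  have hx := hf (add_smul_outer_symm hH v y) x v
  have hy := hf (add_smul_outer_symm hH v x) y v
  rw [hsum] at hx
  rw [add_right_comm, hsum] at hy
  have hadd := hf hH (x + y) (v / 2)
  have hsub := hf (add_smul_outer_symm hH (v / 2) (x + y)) (x - y) (v / 2)
  simp only [dot, Pi.add_apply, Pi.sub_apply, add_mul, sub_mul, Finset.sum_add_distrib,
    Finset.sum_sub_distrib] at hx hy hadd hsub ⊢
  linear_combination -hx + hy + hadd + hsub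

theorem dot_apply_second_difference (x y : V) (v : ℝ) :
    dot x (f (H + v • outer y + v • outer y)) + dot x (f H)
      = 2 * dot x (f (H + v • outer y)) := by
  have h := dot_apply_add_outer_sub hf hH x y v
  have hshift := dot_apply_add_outer_sub hf (add_smul_outer_symm hH v y) x y v
  rw [add_right_comm H (v • outer y) (v • outer x), add_right_comm H _ ((v / 2) • _),
    hf (add_smul_outer_symm hH v x), hf (add_smul_outer_symm hH (v / 2) (x + y)), hf hH] at hshift
  linear_combination hshift - h

theorem dot_apply_add_smul_outer (x y : V)
    (hcont : Continuous fun t : ℝ => dot x (f (H + t • outer y))) (t : ℝ) :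
    dot x (f (H + t • outer y))
      = dot x (f H) + t * (dot x (f (H + outer y)) - dot x (f H)) := by
  have h := eq_add_mul_of_map_midpoint hcont (fun a b => ?_) t
  · simpa using h
  · have hdiff := dot_apply_second_difference hf (add_smul_outer_symm hH a y) x y ((b - a) / 2)
    simp only [add_assoc, ← add_smul, add_halves, add_sub_cancel] at hdiff
    have hmid : midpoint ℝ a b = a + (b - a) / 2 := by
      rw [midpoint_eq_smul_add, smul_eq_mul, invOf_eq_inv]; ring
    rw [hmid, midpoint_eq_smul_add, smul_eq_mul, invOf_eq_inv]
    linear_combination -(1 / 2) * hdiff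

end HessianDependence

theorem dot_comm (a b : V) : dot a b = dot b a := dotProduct_comm a b

theorem dot_self_eq_zero {a : V} : dot a a = 0 ↔ a = 0 := dotProduct_self_eq_zero

theorem dot_self_nonneg (a : V) : 0 ≤ dot a a := Finset.sum_nonneg fun i _ => mul_self_nonneg (a i)

theorem add_dot (a b c : V) : dot (a + b) c = dot a c + dot b c := add_dotProduct a b c

theorem dot_add (a b c : V) : dot a (b + c) = dot a b + dot a c := dotProduct_add a b c

theorem smul_dot (t : ℝ) (a b : V) : dot (t • a) b = t * dot a b := smul_dotProduct t a b

theorem dot_smul (t : ℝ) (a b : V) : dot a (t • b) = t * dot a b := dotProduct_smul t a b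

theorem zero_dot (a : V) : dot 0 a = 0 := zero_dotProduct a

theorem dot_zero (a : V) : dot a 0 = 0 := dotProduct_zero a

theorem actV_zero (Q : Matrix (Fin 3) (Fin 3) ℝ) : actV Q 0 = 0 := Q.mulVec_zero

theorem actV_eq_mulVec (Q : Matrix (Fin 3) (Fin 3) ℝ) (a : V) : actV Q a = Q.mulVec a := rfl

theorem actV_add (Q : Matrix (Fin 3) (Fin 3) ℝ) (a b : V) :
    actV Q (a + b) = actV Q a + actV Q b := Q.mulVec_add a b

theorem actV_smul (Q : Matrix (Fin 3) (Fin 3) ℝ) (c : ℝ) (a : V) :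
    actV Q (c • a) = c • actV Q a := Q.mulVec_smul c a

theorem actV_add_smul_outer (H : T2) (t : ℝ) (ξ n : V) :
    actV (.of (H + t • outer ξ)) n = actV (.of H) n + (t * dot ξ n) • ξ := by
  ext i
  simp only [actV, outer, dot, Matrix.of_apply, Pi.add_apply, Pi.smul_apply, smul_eq_mul,
    Fin.sum_univ_three]
  ring

theorem dot_actV_comm {H : T2} (hH : ∀ i j, H i j = H j i) (a b : V) :
    dot a (actV (.of H) b) = dot b (actV (.of H) a) := by
  simp only [dot, actV, Matrix.of_apply, Fin.sum_univ_three, hH 1 0, hH 2 0, hH 2 1]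
  ring

theorem dot_eq_zero_of_actV_eq_smul {H : T2} (hH : ∀ i j, H i j = H j i) {μ ν : ℝ} (hμν : μ ≠ ν)
    {a b : V} (ha : actV (.of H) a = μ • a) (hb : actV (.of H) b = ν • b) : dot a b = 0 := by
  have h := dot_actV_comm hH a b
  rw [ha, hb] at h
  rw [dot_smul, dot_smul, dot_comm b a] at h
  refine (mul_eq_zero.1 ?_).resolve_left (sub_ne_zero.2 hμν)
  linear_combination -h

section Reflection

/-- The reflection across the plane orthogonal to `n`. For `n = 0` it is the identity, since
`2 / 0 = 0`. -/
noncomputable def reflection (n : V) : Matrix (Fin 3) (Fin 3) ℝ :=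
  1 - (2 / dot n n) • Matrix.vecMulVec n n

theorem reflection_transpose (n : V) : (reflection n).transpose = reflection n := by
  simp [reflection, Matrix.transpose_vecMulVec]

theorem reflection_mul_self (n : V) : reflection n * reflection n = 1 := by
  rcases eq_or_ne n 0 with rfl | hn
  · simp [reflection]
  have hnn : dot n n ≠ 0 := dot_self_eq_zero.not.2 hn
  have hsq : Matrix.vecMulVec n n * Matrix.vecMulVec n n = dot n n • Matrix.vecMulVec n n := by
    rw [Matrix.vecMulVec_mul_vecMulVec, Matrix.vecMulVec_smul]
    rfl
  have hc : 2 / dot n n * (2 / dot n n * dot n n) = 2 / dot n n + 2 / dot n n := by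
    field_simp
    norm_num
  simp only [reflection, sub_mul, mul_sub, one_mul, mul_one, Matrix.smul_mul, Matrix.mul_smul, hsq,
    smul_smul, hc, add_smul]
  abel

theorem reflection_mem_orthogonalGroup (n : V) :
    reflection n ∈ Matrix.orthogonalGroup (Fin 3) ℝ := by
  rw [Matrix.mem_orthogonalGroup_iff, reflection_transpose, reflection_mul_self]

theorem actV_reflection (n a : V) :
    actV (reflection n) a = a - (2 / dot n n * dot n a) • n := by
  rw [actV_eq_mulVec, reflection, Matrix.sub_mulVec, Matrix.one_mulVec, Matrix.smul_mulVec,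
    Matrix.vecMulVec_mulVec, op_smul_eq_smul, smul_smul]
  rfl

theorem actV_reflection_of_dot_eq_zero {n a : V} (h : dot n a = 0) :
    actV (reflection n) a = a := by simp [actV_reflection, h]

theorem actV_reflection_sub {a b : V} (h : dot a a = dot b b) :
    actV (reflection (a - b)) a = b := by
  rcases eq_or_ne a b with rfl | hab
  · simp [actV_reflection]
  have hne : dot (a - b) (a - b) ≠ 0 := dot_self_eq_zero.not.2 (sub_ne_zero.2 hab)
  have hdot : 2 * dot (a - b) a = dot (a - b) (a - b) := by
    simp only [dot, Fin.sum_univ_three, Pi.sub_apply] at h ⊢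
    linear_combination h
  rw [actV_reflection, div_mul_eq_mul_div, hdot, div_self hne, one_smul, sub_sub_cancel]

variable {H : T2} {n : V} {μ : ℝ}

theorem actV_reflection_comm (hH : ∀ i j, H i j = H j i) (hn : actV (.of H) n = μ • n) (a : V) :
    actV (reflection n) (actV (.of H) a) = actV (.of H) (actV (reflection n) a) := by
  have hna : dot n (actV (.of H) a) = μ * dot n a := by
    rw [dot_actV_comm hH, hn, dot_smul, dot_comm]
  rw [actV_reflection, actV_reflection, hna, sub_eq_add_neg, sub_eq_add_neg, actV_add, ← neg_smul,
    ← neg_smul, actV_smul, hn, smul_smul]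
  ring_nf

theorem actT_eq_mul (Q : Matrix (Fin 3) (Fin 3) ℝ) (A : T2) :
    actT Q A = Q * Matrix.of A * Q.transpose := by
  ext i j
  simp only [actT, Matrix.mul_apply, Matrix.transpose_apply, Matrix.of_apply, Fin.sum_univ_three]
  ring

theorem actT_reflection (hH : ∀ i j, H i j = H j i) (hn : actV (.of H) n = μ • n) :
    actT (reflection n) H = H := by
  have hcomm : reflection n * Matrix.of H = Matrix.of H * reflection n :=
    Matrix.mulVec_injective <| funext fun a => by
      simpa only [actV_eq_mulVec, Matrix.mulVec_mulVec] using actV_reflection_comm hH hn a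
  rw [actT_eq_mul, hcomm, reflection_transpose, Matrix.mul_assoc, reflection_mul_self,
    Matrix.mul_one]
  rfl

end Reflection

section Frames

/-- The vectors `u 0`, `u 1`, `u 2` form an orthonormal basis. -/
def IsFrame (u : Fin 3 → V) : Prop := ∀ i j, dot (u i) (u j) = delta i j

variable {u : Fin 3 → V}

theorem IsFrame.mem_orthogonalGroup (hu : IsFrame u) :
    Matrix.of u ∈ Matrix.orthogonalGroup (Fin 3) ℝ := by
  rw [Matrix.mem_orthogonalGroup_iff]
  ext i j
  exact (hu i j).trans (Matrix.one_apply ..).symm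

theorem IsFrame.sum_dot_smul (hu : IsFrame u) (a : V) : ∑ i, dot (u i) a • u i = a := by
  have h := (Matrix.mem_orthogonalGroup_iff' (Fin 3) ℝ).1 hu.mem_orthogonalGroup
  calc ∑ i, dot (u i) a • u i
      = (Matrix.of u).transpose.mulVec ((Matrix.of u).mulVec a) := by
        ext j
        simp [Matrix.mulVec, dotProduct, dot, mul_comm]
    _ = a := by rw [Matrix.mulVec_mulVec, h, Matrix.one_mulVec]

theorem IsFrame.eq_zero_of_forall_dot_eq_zero (hu : IsFrame u) {a : V}
    (h : ∀ i, dot (u i) a = 0) : a = 0 := by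
  rw [← hu.sum_dot_smul a]
  simp [h]

theorem dot_actV {Q : Matrix (Fin 3) (Fin 3) ℝ} (hQ : Q ∈ Matrix.orthogonalGroup (Fin 3) ℝ)
    (a b : V) : dot (actV Q a) (actV Q b) = dot a b := by
  have h := (Matrix.mem_orthogonalGroup_iff' (Fin 3) ℝ).1 hQ
  change Q.mulVec a ⬝ᵥ Q.mulVec b = a ⬝ᵥ b
  rw [Matrix.dotProduct_mulVec, Matrix.vecMul_mulVec, h, Matrix.vecMul_one]

variable {H : T2} (hH : ∀ i j, H i j = H j i)
include hH

theorem exists_eigenframe :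
    ∃ (u : Fin 3 → V) (μ : V), IsFrame u ∧ ∀ i, actV (.of H) (u i) = μ i • u i := by
  have hherm : (Matrix.of H).IsHermitian := Matrix.IsHermitian.ext fun i j => (hH j i :)
  refine ⟨fun i => (hherm.eigenvectorBasis i).ofLp, hherm.eigenvalues, fun i j => ?_,
    hherm.mulVec_eigenvectorBasis⟩
  have h := orthonormal_iff_ite.1 hherm.eigenvectorBasis.orthonormal i j
  simpa [dot, delta, PiLp.inner_apply, mul_comm] using h

/-- An eigenvector `g` of `H` and the element of an eigenframe not orthogonal to `g` have the same
eigenvalue, so the reflection exchanging their directions commutes with `H`. -/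
theorem exists_eigenframe_of_eigenvector {g : V} {ν : ℝ} (hg : actV (.of H) g = ν • g) :
    ∃ (u : Fin 3 → V) (μ : V) (γ : ℝ), IsFrame u ∧ (∀ i, actV (.of H) (u i) = μ i • u i)
      ∧ g = γ • u 0 := by
  obtain ⟨u, μ, hu, hμ⟩ := exists_eigenframe hH
  rcases eq_or_ne g 0 with rfl | hg0
  · exact ⟨u, μ, 0, hu, hμ, (zero_smul ..).symm⟩
  obtain ⟨k, hk⟩ : ∃ k, dot (u k) g ≠ 0 := by
    by_contra! h
    exact hg0 (hu.eq_zero_of_forall_dot_eq_zero h)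
  have hkν : μ k = ν := by
    by_contra h
    exact hk (dot_eq_zero_of_actV_eq_smul hH h (hμ k) hg)
  set γ := Real.sqrt (dot g g)
  have hγ : γ ^ 2 = dot g g := Real.sq_sqrt (dot_self_nonneg g)
  let n := γ • u k - g
  have hn : actV (.of H) n = ν • n := by
    rw [actV_eq_mulVec, Matrix.mulVec_sub, Matrix.mulVec_smul, ← actV_eq_mulVec, ← actV_eq_mulVec,
      hμ, hkν, hg, smul_comm, smul_sub]
  have hlen : dot (γ • u k) (γ • u k) = dot g g := by
    rw [smul_dot, dot_smul, hu k k, delta, if_pos rfl, mul_one, ← sq, hγ]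
  refine ⟨fun i => actV (reflection n) (u (Equiv.swap 0 k i)), fun i => μ (Equiv.swap 0 k i), γ,
    fun i j => ?_, fun i => ?_, ?_⟩
  · rw [dot_actV (reflection_mem_orthogonalGroup n), hu]
    simp [delta]
  · rw [← actV_reflection_comm hH hn, hμ, actV_smul]
  · simp only [Equiv.swap_apply_left]
    rw [← actV_smul, actV_reflection_sub hlen]

end Frames

/-- The diagonal tensor with the entries of `d`. -/
def diag (d : V) : T2 := fun i j => d i * delta i j

theorem diag_symm (d : V) (i j : Fin 3) : diag d i j = diag d j i := by
  rcases eq_or_ne i j with rfl | h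
  · rfl
  · simp [diag, delta, h, h.symm]

theorem actV_of (u : Fin 3 → V) (a : V) : actV (.of u) a = fun i => dot (u i) a := rfl

theorem IsFrame.actT_of {u : Fin 3 → V} (hu : IsFrame u) {H : T2} {μ : V}
    (hμ : ∀ i, actV (.of H) (u i) = μ i • u i) : actT (.of u) H = diag μ := by
  ext i j
  calc actT (.of u) H i j = dot (u i) (actV (.of H) (u j)) := by
        simp only [actT, actV, dot, Matrix.of_apply, Fin.sum_univ_three]
        ring
    _ = μ j * dot (u i) (u j) := by rw [hμ, dot_smul]
    _ = diag μ j i := by rw [hu]; simp only [diag, delta, eq_comm]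
    _ = diag μ i j := diag_symm μ j i

/-- The vector functions of two vectors and a symmetric tensor which are isotropic with respect to
the full orthogonal group. -/
def IsotropicMap (f : V → V → T2 → V) : Prop :=
  ∀ Q ∈ Matrix.orthogonalGroup (Fin 3) ℝ, ∀ (g e : V) {H : T2}, (∀ i j, H i j = H j i) →
    f (actV Q g) (actV Q e) (actT Q H) = actV Q (f g e H)

theorem IsotropicMap.dot_eq_zero {f : V → V → T2 → V} (hf : IsotropicMap f) {g e n : V} {H : T2}
    {μ : ℝ} (hH : ∀ i j, H i j = H j i) (hn : actV (.of H) n = μ • n) (hg : dot n g = 0)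
    (he : dot n e = 0) : dot n (f g e H) = 0 := by
  rcases eq_or_ne n 0 with rfl | hn0
  · exact zero_dot _
  have h := hf (reflection n) (reflection_mem_orthogonalGroup n) g e hH
  rw [actV_reflection_of_dot_eq_zero hg, actV_reflection_of_dot_eq_zero he, actT_reflection hH hn,
    actV_reflection, eq_comm, sub_eq_self, smul_eq_zero] at h
  simpa [dot_self_eq_zero, hn0] using h

/-- The properties of the difference between the flux at `L = 0` and its expected value. They force
it to vanish on symmetric tensors. -/
structure IsotropicNull (f : V → V → T2 → V) : Prop where
  isotropic : IsotropicMap f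
  hess : ∀ (g e : V) {H : T2}, (∀ i j, H i j = H j i) → ∀ (ξ : V) (t : ℝ),
    dot ξ (f g e (H + t • outer ξ)) = dot ξ (f g e H)
  gradEps : ∀ (g e : V) {H : T2}, (∀ i j, H i j = H j i) → ∀ ξ : V,
    dot ξ (f g (e + ξ) H) = dot ξ (f g e H)
  axis : ∀ (γ : ℝ) (d : V), f (γ • Pi.single 0 1) 0 (diag d) 0 = 0

namespace IsotropicNull

variable {f : V → V → T2 → V} (hf : IsotropicNull f) {H : T2} (hH : ∀ i j, H i j = H j i)
include hf hH

theorem dot_eq_zero_of_eigenvector {g : V} {ν : ℝ} (hg : actV (.of H) g = ν • g) :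
    dot g (f g 0 H) = 0 := by
  obtain ⟨u, μ, γ, hu, hμ, rfl⟩ := exists_eigenframe_of_eigenvector hH hg
  have hu0 : actV (.of u) (u 0) = Pi.single 0 1 := by
    ext i
    simp [actV_of, hu i 0, delta, Pi.single_apply]
  have h := congrFun (hf.isotropic _ hu.mem_orthogonalGroup (γ • u 0) 0 hH) 0
  rw [actV_smul, hu0, actV_zero, hu.actT_of hμ, hf.axis] at h
  rw [smul_dot, show dot (u 0) (f (γ • u 0) 0 H) = 0 from h.symm, mul_zero]

end IsotropicNull

section Shift

variable {H : T2} {p q : V} {μ ν t : ℝ}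

theorem actV_add_smul_outer_self (hp : actV (.of H) p = μ • p) (ht : μ + t * dot p p = ν) :
    actV (.of (H + t • outer p)) p = ν • p := by
  rw [actV_add_smul_outer, hp, ← add_smul, ht]

theorem actV_add_smul_outer_of_dot_eq_zero (hq : actV (.of H) q = ν • q) (hpq : dot p q = 0) :
    actV (.of (H + t • outer p)) q = ν • q := by
  rw [actV_add_smul_outer, hq, hpq, mul_zero, zero_smul, add_zero]

theorem actV_linear_combination (hp : actV (.of H) p = ν • p) (hq : actV (.of H) q = ν • q)
    (a b : ℝ) : actV (.of H) (a • p + b • q) = ν • (a • p + b • q) := by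
  rw [actV_add, actV_smul, actV_smul, hp, hq, smul_add, smul_comm, smul_comm b]

theorem exists_actV_add_smul_outer_add (hp : actV (.of H) p = μ • p) (hq : actV (.of H) q = ν • q)
    (hpq : dot p q = 0) (hp0 : p ≠ 0) :
    ∃ t, μ + t * dot p p = ν ∧ actV (.of (H + t • outer p)) (p + q) = ν • (p + q) := by
  have ht : μ + (ν - μ) / dot p p * dot p p = ν := by
    rw [div_mul_cancel₀ _ (dot_self_eq_zero.not.2 hp0), add_sub_cancel]
  refine ⟨_, ht, ?_⟩
  rw [actV_add, actV_add_smul_outer_self hp ht, actV_add_smul_outer_of_dot_eq_zero hq hpq, smul_add]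

end Shift

namespace IsotropicNull

variable {f : V → V → T2 → V} (hf : IsotropicNull f) {H : T2} (hH : ∀ i j, H i j = H j i)
  {p q r : V} {μ ν κ : ℝ} (hp : actV (.of H) p = μ • p) (hq : actV (.of H) q = ν • q)
  (hpq : dot p q = 0)
include hf hH hp hq hpq

/-- Adding a multiple of `p ⊗ p` to `H` does not change the component along `p` and makes the
eigenvalues of `p` and `q` equal; then `|q|² p - |p|² q` is an eigenvector orthogonal to
`p + q + r`. -/
theorem dot_eq_zero_of_dot_add_eq_zero (hpr : dot p r = 0) (hqr : dot q r = 0) {t : ℝ}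
    (ht : μ + t * dot p p = ν) (h : dot (p + q) (f (p + q + r) 0 (H + t • outer p)) = 0) :
    dot p (f (p + q + r) 0 H) = 0 := by
  rcases eq_or_ne p 0 with rfl | hp0
  · exact zero_dot _
  have hn := actV_linear_combination (actV_add_smul_outer_self hp ht)
    (actV_add_smul_outer_of_dot_eq_zero hq hpq) (dot q q) (-dot p p)
  have hng : dot (dot q q • p + (-dot p p) • q) (p + q + r) = 0 := by
    simp only [add_dot, dot_add, smul_dot, hpq, hpr, hqr, dot_comm q p]
    ring
  have hnf := hf.isotropic.dot_eq_zero (add_smul_outer_symm hH t p) hn hng (dot_zero _)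
  rw [← hf.hess _ _ hH p t]
  have hpos : 0 < dot p p := (dot_self_nonneg p).lt_of_ne' (dot_self_eq_zero.not.2 hp0)
  have hne : dot p p + dot q q ≠ 0 := (add_pos_of_pos_of_nonneg hpos (dot_self_nonneg q)).ne'
  refine (mul_eq_zero.1 ?_).resolve_left hne
  rw [add_dot] at h
  rw [add_dot, smul_dot, smul_dot] at hnf
  linear_combination hnf + dot p p * h

theorem dot_apply_add_eq_zero : dot p (f (p + q) 0 H) = 0 := by
  rcases eq_or_ne p 0 with rfl | hp0
  · exact zero_dot _
  obtain ⟨t, ht, hsum⟩ := exists_actV_add_smul_outer_add hp hq hpq hp0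
  have h := hf.dot_eq_zero_of_eigenvector (add_smul_outer_symm hH _ p) hsum
  rw [← add_zero (p + q)] at h ⊢
  exact hf.dot_eq_zero_of_dot_add_eq_zero hH hp hq hpq (dot_zero p) (dot_zero q) ht
    (by rwa [add_zero (p + q)] at h ⊢)

theorem dot_apply_add_add_eq_zero (hr : actV (.of H) r = κ • r) (hpr : dot p r = 0)
    (hqr : dot q r = 0) : dot p (f (p + q + r) 0 H) = 0 := by
  rcases eq_or_ne p 0 with rfl | hp0
  · exact zero_dot _
  obtain ⟨t, ht, hsum⟩ := exists_actV_add_smul_outer_add hp hq hpq hp0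
  refine hf.dot_eq_zero_of_dot_add_eq_zero hH hp hq hpq hpr hqr ht ?_
  exact hf.dot_apply_add_eq_zero (add_smul_outer_symm hH _ p) hsum
    (actV_add_smul_outer_of_dot_eq_zero hr hpr) (by rw [add_dot, hpr, hqr, add_zero])

omit hp hq hpq

theorem apply_zero_eq_zero (g : V) : f g 0 H = 0 := by
  obtain ⟨u, μ, hu, hμ⟩ := exists_eigenframe hH
  refine hu.eq_zero_of_forall_dot_eq_zero fun k => ?_
  rcases eq_or_ne (dot (u k) g) 0 with hk | hk
  · exact hf.isotropic.dot_eq_zero hH (hμ k) hk (dot_zero _)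
  have hsplit : g = dot (u k) g • u k + dot (u (k + 1)) g • u (k + 1)
      + dot (u (k + 2)) g • u (k + 2) := by
    conv_lhs => rw [← hu.sum_dot_smul g]
    rw [Fin.sum_univ_three]
    fin_cases k <;> simp <;> abel
  have horth (i j : Fin 3) (hij : i ≠ j) : dot (dot (u i) g • u i) (dot (u j) g • u j) = 0 := by
    simp [smul_dot, dot_smul, hu i j, delta, hij]
  have heig (i : Fin 3) : actV (.of H) (dot (u i) g • u i) = μ i • dot (u i) g • u i := by
    rw [actV_smul, hμ, smul_comm]
  have h := hf.dot_apply_add_add_eq_zero hH (heig k) (heig (k + 1)) (horth _ _ (by simp))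
    (heig (k + 2)) (horth _ _ (by simp)) (horth _ _ (by simp))
  rw [← hsplit, smul_dot] at h
  exact (mul_eq_zero.1 h).resolve_left hk

theorem dot_apply_eq_neg (g x y : V) : dot x (f g y H) = -dot y (f g x H) := by
  have hself (z : V) : dot z (f g z H) = 0 := by
    simpa [hf.apply_zero_eq_zero hH, dot_zero] using hf.gradEps g 0 hH z
  have hx := hf.gradEps g y hH x
  have hy := hf.gradEps g x hH y
  have hsum := hself (y + x)
  rw [add_dot, hx, add_comm y x, hy] at hsum
  linarith

/-- Adding a multiple of `p ⊗ p` to `H` makes the eigenvalues of `p` and `q` equal. With `α = g · p`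
and `β = g · q`, the vector `α q - β p` is then an eigenvector orthogonal to `g` and to
`α p + β q`. -/
theorem dot_apply_eq_zero (hp : actV (.of H) p = μ • p) (hq : actV (.of H) q = ν • q)
    (hpp : dot p p = 1) (hqq : dot q q = 1) (hpq : dot p q = 0) (g : V) :
    dot p (f g q H) = 0 := by
  by_cases h0 : dot p g = 0 ∧ dot q g = 0
  · exact hf.isotropic.dot_eq_zero hH hp h0.1 hpq
  have hH' := add_smul_outer_symm hH (ν - μ) p
  have ht : μ + (ν - μ) * dot p p = ν := by rw [hpp]; ring
  have hn := actV_linear_combination (actV_add_smul_outer_self hp ht)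
    (actV_add_smul_outer_of_dot_eq_zero hq hpq) (-dot q g) (dot p g)
  have h := hf.isotropic.dot_eq_zero (g := g) (e := dot p g • p + dot q g • q) hH' hn
    (by rw [add_dot, smul_dot, smul_dot]; ring)
    (by simp only [add_dot, dot_add, smul_dot, dot_smul, hpp, hqq, hpq, dot_comm q p]; ring)
  have hanti := hf.dot_apply_eq_neg hH' g
  rw [hanti] at h
  simp only [add_dot, smul_dot] at h
  rw [hanti p, hanti q] at h
  simp only [add_dot, smul_dot] at h
  have hself (z : V) : dot z (f g z (H + (ν - μ) • outer p)) = 0 := by linarith [hanti z z]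
  rw [hself, hself, hanti q p, hf.hess _ _ hH] at h
  have hne : dot p g ^ 2 + dot q g ^ 2 ≠ 0 := fun h => h0 (by constructor <;> nlinarith)
  refine (mul_eq_zero.1 ?_).resolve_left hne
  linear_combination -h

theorem eq_zero (g e : V) : f g e H = 0 := by
  obtain ⟨u, μ, hu, hμ⟩ := exists_eigenframe hH
  have hone (i : Fin 3) : dot (u i) (u i) = 1 := (hu i i).trans (if_pos rfl)
  have hframe (i : Fin 3) : f g (u i) H = 0 := by
    refine hu.eq_zero_of_forall_dot_eq_zero fun j => ?_
    rcases eq_or_ne j i with rfl | hji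
    · linarith [hf.dot_apply_eq_neg hH g (u j) (u j)]
    · exact hf.dot_apply_eq_zero hH (hμ j) (hμ i) (hone j) (hone i)
        ((hu j i).trans (if_neg hji)) g
  refine hu.eq_zero_of_forall_dot_eq_zero fun i => ?_
  rw [hf.dot_apply_eq_neg hH, hframe, dot_zero, neg_zero]

end IsotropicNull

section Axis

theorem dot_single (i : Fin 3) (a : V) : dot (Pi.single i 1) a = a i := single_one_dotProduct i a

theorem diag_add_smul_outer_single (d : V) (i : Fin 3) (t : ℝ) :
    diag d + t • outer (Pi.single i 1) = diag (Function.update d i (d i + t)) := by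
  ext j k
  simp only [diag, outer, delta, Pi.add_apply, Pi.smul_apply, Pi.single_apply,
    Function.update_apply, smul_eq_mul]
  split_ifs <;> simp_all

theorem actV_diag_single (d : V) (i : Fin 3) :
    actV (.of (diag d)) (Pi.single i 1) = d i • Pi.single i 1 := by
  ext j
  rcases eq_or_ne j i with rfl | hj <;> simp [actV, diag, delta, Pi.single_apply, *]

theorem diag_column (d : V) (j : Fin 3) : (fun i => diag d i j) = d j • Pi.single j 1 := by
  ext i
  rcases eq_or_ne i j with rfl | hi <;> simp [diag, delta, *]

theorem tr_diag (d : V) : tr (diag d) = d 0 + d 1 + d 2 := by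
  simp [tr, diag, delta, Fin.sum_univ_three]

theorem tr_zero : tr 0 = 0 := by simp [tr]

theorem actT_zero (Q : Matrix (Fin 3) (Fin 3) ℝ) : actT Q 0 = 0 := by
  ext
  simp [actT]

variable {D : Set (ℝ × ℝ)} {m : MaterialFunctions} {J : State → V} {ρ ε : ℝ}

theorem isotropicMap_flux (hJiso : IsotropicVector D J) (h0 : (ρ, ε) ∈ D) :
    IsotropicMap fun g e H => J (ρ, ε, g, 0, e, H) := fun Q hQ g e H hH => by
  have h := hJiso Q hQ (ρ, ε, g, 0, e, H) ⟨h0, fun _ _ => rfl, hH⟩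
  rwa [actState, State.L, actT_zero] at h

/-- The flux along `∇ρ`, when `∇ρ` is an eigenvector of `∇∇ρ` and `L = 0`, `∇ε = 0`. By
`flux_axis_eq_axisFlux`, it depends only on the two eigenvalues of `∇∇ρ` transverse to `∇ρ`. -/
def axisFlux (J : State → V) (ρ ε γ b c : ℝ) : ℝ :=
  J (ρ, ε, γ • Pi.single 0 1, 0, 0, diag ![0, b, c]) 0

theorem axisFlux_zero (hJiso : IsotropicVector D J) (h0 : (ρ, ε) ∈ D) (b c : ℝ) :
    axisFlux J ρ ε 0 b c = 0 := by
  have h := (isotropicMap_flux hJiso h0).dot_eq_zero (e := 0) (g := (0 : ℝ) • Pi.single 0 1)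
    (diag_symm ![0, b, c]) (actV_diag_single _ 0) (by rw [zero_smul, dot_zero]) (dot_zero _)
  rwa [dot_single] at h

theorem flux_diag_update (hc : FluxConditions D m J) (hD : IsOpen D)
    (hJ : ContDiffOn ℝ ∞ J (State.region D)) (h0 : (ρ, ε) ∈ D) (g d : V) (i : Fin 3) (t : ℝ) :
    J (ρ, ε, g, 0, 0, diag (Function.update d i t)) i = J (ρ, ε, g, 0, 0, diag d) i := by
  have h := hc.flux_hess hD hJ h0 g 0 (diag_symm d) (Pi.single i 1) (t - d i)
  rwa [diag_add_smul_outer_single, dot_single, dot_single, add_sub_cancel] at h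

theorem flux_axis_eq_axisFlux (hc : FluxConditions D m J) (hD : IsOpen D)
    (hJ : ContDiffOn ℝ ∞ J (State.region D)) (h0 : (ρ, ε) ∈ D) (γ : ℝ) (d : V) :
    J (ρ, ε, γ • Pi.single 0 1, 0, 0, diag d) 0 = axisFlux J ρ ε γ (d 1) (d 2) := by
  have hd : Function.update d 0 0 = ![0, d 1, d 2] := by
    ext i
    fin_cases i <;> rfl
  rw [axisFlux, ← hd, flux_diag_update hc hD hJ h0]

theorem hasDerivAt_axisState {r : ℝ → ℝ} {g : ℝ → V} {r' s : ℝ} {g' : V} (ε : ℝ) (H : T2)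
    (hr : HasDerivAt r r' s) (hg : HasDerivAt g g' s) :
    HasDerivAt (fun s => ((r s, ε, g s, 0, 0, H) : State)) (r', 0, g', 0, 0, 0) s :=
  hr.prodMk <| (hasDerivAt_const s ε).prodMk <| hg.prodMk <| (hasDerivAt_const s 0).prodMk <|
    (hasDerivAt_const s 0).prodMk (hasDerivAt_const s H)

/-- The `i`-th component of the flux does not depend on `d i`, which may be replaced with `d 0`.
Then `e_i - s e_0` is an eigenvector of `diag d` orthogonal to `γ (e_0 + s e_i)`, hence to the flux
at that gradient; differentiate at `s = 0`. -/
theorem fderiv_flux_axis (hc : FluxConditions D m J) (hD : IsOpen D)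
    (hJ : ContDiffOn ℝ ∞ J (State.region D)) (hJiso : IsotropicVector D J) (h0 : (ρ, ε) ∈ D)
    (γ : ℝ) (d : V) {i : Fin 3} (hi : i ≠ 0) :
    fderiv ℝ J (ρ, ε, γ • Pi.single 0 1, 0, 0, diag d) (0, 0, γ • Pi.single i 1, 0, 0, 0) i
      = J (ρ, ε, γ • Pi.single 0 1, 0, 0, diag (Function.update d i (d 0))) 0 := by
  let g (s : ℝ) : V := γ • (Pi.single 0 1 + s • Pi.single i 1)
  have hg : HasDerivAt g (γ • Pi.single i 1) 0 :=
    ((((hasDerivAt_id (0 : ℝ)).smul_const (Pi.single i 1 : V)).const_add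
      (Pi.single 0 1)).fun_const_smul γ).congr_deriv (by rw [one_smul])
  have hg0 : g 0 = γ • Pi.single 0 1 := by simp [g]
  have hflux (H : T2) (k : Fin 3) := hasDerivAt_flux_comp hD hJ
    (hasDerivAt_axisState ε H (hasDerivAt_const (0 : ℝ) ρ) hg) h0 k
  have hmul (s : ℝ) : J (ρ, ε, g s, 0, 0, diag d) i
      = s * J (ρ, ε, g s, 0, 0, diag (Function.update d i (d 0))) 0 := by
    set d' := Function.update d i (d 0)
    have hi' : actV (.of (diag d')) (Pi.single i 1) = d 0 • Pi.single i 1 := by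
      simpa [d'] using actV_diag_single d' i
    have h0' : actV (.of (diag d')) (Pi.single 0 1) = d 0 • Pi.single 0 1 := by
      simpa [d', hi.symm] using actV_diag_single d' 0
    have h := (isotropicMap_flux hJiso h0).dot_eq_zero (g := g s) (e := 0) (diag_symm d')
      (actV_linear_combination hi' h0' 1 (-s))
      (by simp only [g, add_dot, smul_dot, dot_single]; simp [hi, hi.symm, mul_comm]) (dot_zero _)
    rw [← flux_diag_update hc hD hJ h0 (g s) d i (d 0)]
    simp only [add_dot, smul_dot, dot_single] at h
    linear_combination h
  have hprod := (hasDerivAt_id (0 : ℝ)).fun_mul (hflux (diag (Function.update d i (d 0))) 0)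
  rw [← hg0]
  refine (hflux (diag d) i).unique (hprod.congr_deriv ?_ |>.congr_of_eventuallyEq ?_)
  · simp
  · exact .of_forall hmul

theorem hasDerivAt_axisFlux_gamma (hc : FluxConditions D m J) (hD : IsOpen D)
    (hJ : ContDiffOn ℝ ∞ J (State.region D)) (h0 : (ρ, ε) ∈ D) (γ : ℝ) (d : V) :
    HasDerivAt (fun γ => axisFlux J ρ ε γ (d 1) (d 2))
      (fderiv ℝ J (ρ, ε, γ • Pi.single 0 1, 0, 0, diag d) (0, 0, Pi.single 0 1, 0, 0, 0) 0) γ := by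
  have hg : HasDerivAt (fun γ : ℝ => γ • (Pi.single 0 1 : V)) (Pi.single 0 1) γ := by
    simpa using (hasDerivAt_id γ).smul_const (Pi.single 0 1 : V)
  simp only [← flux_axis_eq_axisFlux hc hD hJ h0]
  exact hasDerivAt_flux_comp hD hJ (hasDerivAt_axisState ε (diag d) (hasDerivAt_const γ ρ) hg) h0 0

theorem hasDerivAt_axisFlux_rho (hc : FluxConditions D m J) (hD : IsOpen D)
    (hJ : ContDiffOn ℝ ∞ J (State.region D)) (h0 : (ρ, ε) ∈ D) (γ : ℝ) (d : V) :
    HasDerivAt (fun ρ => axisFlux J ρ ε γ (d 1) (d 2))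
      (fderiv ℝ J (ρ, ε, γ • Pi.single 0 1, 0, 0, diag d) (1, 0, 0, 0, 0, 0) 0) ρ := by
  refine (hasDerivAt_flux_comp hD hJ (hasDerivAt_axisState ε (diag d) (hasDerivAt_id ρ)
    (hasDerivAt_const ρ (γ • Pi.single 0 1))) h0 0).congr_of_eventuallyEq ?_
  have hnear : ∀ᶠ r in nhds ρ, (r, ε) ∈ D :=
    (Continuous.prodMk_left ε).continuousAt.preimage_mem_nhds (hD.mem_nhds h0)
  filter_upwards [hnear] with r hr
  exact (flux_axis_eq_axisFlux hc hD hJ hr γ d).symm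

theorem sum_fderiv_flux_axis (hc : FluxConditions D m J) (hD : IsOpen D)
    (hJ : ContDiffOn ℝ ∞ J (State.region D)) (hJiso : IsotropicVector D J) (h0 : (ρ, ε) ∈ D)
    {γ : ℝ} (hγ : γ ≠ 0) (a b c : ℝ) :
    ∑ j, fderiv ℝ J (ρ, ε, γ • Pi.single 0 1, 0, 0, diag ![a, b, c])
        ((γ • Pi.single 0 1 : V) j, (0 : V) j, fun i => diag ![a, b, c] i j, 0, 0, 0) j
      = γ * deriv (fun r => axisFlux J r ε γ b c) ρ
        + a * deriv (fun γ => axisFlux J ρ ε γ b c) γ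
        + b * axisFlux J ρ ε γ a c / γ + c * axisFlux J ρ ε γ b a / γ := by
  have haxis : ((γ, 0, a • Pi.single 0 1, 0, 0, 0) : State)
      = γ • (1, 0, 0, 0, 0, 0) + a • (0, 0, Pi.single 0 1, 0, 0, 0) := by simp
  have htrans (i : Fin 3) (x : ℝ) : ((0, 0, x • Pi.single i 1, 0, 0, 0) : State)
      = (x / γ) • (0, 0, γ • Pi.single i 1, 0, 0, 0) := by
    simp [smul_smul, div_mul_cancel₀ _ hγ]
  have hsecond : axisFlux J ρ ε γ a c = _ :=
    (flux_axis_eq_axisFlux hc hD hJ h0 γ (Function.update ![a, b, c] 1 a)).symm.trans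
      (fderiv_flux_axis hc hD hJ hJiso h0 γ ![a, b, c] one_ne_zero).symm
  have hthird : axisFlux J ρ ε γ b a = _ :=
    (flux_axis_eq_axisFlux hc hD hJ h0 γ (Function.update ![a, b, c] 2 a)).symm.trans
      (fderiv_flux_axis hc hD hJ hJiso h0 γ ![a, b, c] (by decide)).symm
  have hρ := (hasDerivAt_axisFlux_rho hc hD hJ h0 γ ![a, b, c]).deriv
  have hγ := (hasDerivAt_axisFlux_gamma hc hD hJ h0 γ ![a, b, c]).deriv
  rw [hsecond, hthird]
  change deriv (fun r => axisFlux J r ε γ b c) ρ = _ at hρ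
  change deriv (fun γ => axisFlux J ρ ε γ b c) γ = _ at hγ
  rw [hρ, hγ, Fin.sum_univ_three]
  simp only [diag_column]
  simp only [Pi.smul_apply, Pi.zero_apply, Pi.single_apply, smul_eq_mul, if_true, mul_one, mul_zero,
    Fin.reduceEq, if_false, one_ne_zero, Matrix.cons_val]
  rw [haxis, htrans 1 b, htrans 2 c]
  simp only [map_add, map_smul, Pi.add_apply, Pi.smul_apply, smul_eq_mul]
  ring

theorem axis_inequality (hc : FluxConditions D m J) (hD : IsOpen D)
    (hJ : ContDiffOn ℝ ∞ J (State.region D)) (hJiso : IsotropicVector D J) (h0 : (ρ, ε) ∈ D)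
    {γ : ℝ} (hγ : γ ≠ 0) (a b c : ℝ) :
    0 ≤ -coldness m ρ ε (γ • Pi.single 0 1)
          * (m.q2 ρ ε * (a + b + c) + dRho m.q2 ρ ε * γ ^ 2)
        + γ * deriv (fun r => axisFlux J r ε γ b c) ρ
        + a * deriv (fun γ => axisFlux J ρ ε γ b c) γ
        + b * axisFlux J ρ ε γ a c / γ + c * axisFlux J ρ ε γ b a / γ := by
  have h := hc.nonneg h0 (γ • Pi.single 0 1) 0 (L := 0) (fun _ _ => rfl) (diag_symm ![a, b, c])
  have hddot (T : T2) : ddot T 0 = 0 := by simp [ddot]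
  rw [residualProduction, sum_fderiv_flux_axis hc hD hJ hJiso h0 hγ] at h
  refine h.trans_eq ?_
  have hdiv : divHeatFlux m ρ ε (γ • Pi.single 0 1) 0 (diag ![a, b, c]) 0
      = m.q2 ρ ε * (a + b + c) + dRho m.q2 ρ ε * γ ^ 2 := by
    rw [divHeatFlux, tr_zero, tr_diag, dot_zero, dot_zero, smul_dot, dot_single, Pi.smul_apply,
      Pi.single_eq_same, smul_eq_mul, mul_one]
    simp only [Matrix.cons_val]
    ring
  rw [hdiv, tr_zero, hddot]
  simp only [Pi.zero_apply, mul_zero, add_zero, Finset.sum_const_zero]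
  ring

end Axis

section AxisFlux

variable {D : Set (ℝ × ℝ)} {m : MaterialFunctions} {J : State → V} {ρ ε : ℝ}

theorem flux_axis_update (hc : FluxConditions D m J) (hD : IsOpen D)
    (hJ : ContDiffOn ℝ ∞ J (State.region D)) (h0 : (ρ, ε) ∈ D) (g d : V) (i j : Fin 3) (t : ℝ) :
    J (ρ, ε, g, 0, 0, diag (Function.update d i t)) j
      = J (ρ, ε, g, 0, 0, diag (Function.update d i 0)) j
        + t * (J (ρ, ε, g, 0, 0, diag (Function.update d i 1)) j
          - J (ρ, ε, g, 0, 0, diag (Function.update d i 0)) j) := by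
  have hcont : Continuous fun t : ℝ => dot (Pi.single j 1)
      (J (ρ, ε, g, 0, 0, diag (Function.update d i 0) + t • outer (Pi.single i 1))) := by
    simp only [dot_single]
    have hJc : ContinuousOn (fun z => J z j) (State.region D) :=
      continuousOn_pi.1 hJ.continuousOn j
    exact hJc.comp_continuous (by fun_prop) fun _ => h0
  have h := dot_apply_add_smul_outer (f := fun H => J (ρ, ε, g, 0, 0, H))
    (fun hH ξ t => hc.flux_hess hD hJ h0 g 0 hH ξ t) (diag_symm (Function.update d i 0))
    (Pi.single j 1) (Pi.single i 1) hcont t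
  have hone := diag_add_smul_outer_single (Function.update d i 0) i 1
  rw [one_smul] at hone
  simpa only [diag_add_smul_outer_single, hone, dot_single, Function.update_self, zero_add,
    Function.update_idem] using h

theorem axisFlux_affine_left (hc : FluxConditions D m J) (hD : IsOpen D)
    (hJ : ContDiffOn ℝ ∞ J (State.region D)) (h0 : (ρ, ε) ∈ D) (γ b c : ℝ) :
    axisFlux J ρ ε γ b c
      = axisFlux J ρ ε γ 0 c + b * (axisFlux J ρ ε γ 1 c - axisFlux J ρ ε γ 0 c) := by
  have h := flux_axis_update hc hD hJ h0 (γ • Pi.single 0 1) ![0, 0, c] 1 0 b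
  simp only [flux_axis_eq_axisFlux hc hD hJ h0] at h
  exact h

theorem axisFlux_affine_right (hc : FluxConditions D m J) (hD : IsOpen D)
    (hJ : ContDiffOn ℝ ∞ J (State.region D)) (h0 : (ρ, ε) ∈ D) (γ b c : ℝ) :
    axisFlux J ρ ε γ b c
      = axisFlux J ρ ε γ b 0 + c * (axisFlux J ρ ε γ b 1 - axisFlux J ρ ε γ b 0) := by
  have h := flux_axis_update hc hD hJ h0 (γ • Pi.single 0 1) ![0, b, 0] 2 0 c
  simp only [flux_axis_eq_axisFlux hc hD hJ h0] at h
  exact h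

theorem deriv_axisFlux (hc : FluxConditions D m J) (hD : IsOpen D)
    (hJ : ContDiffOn ℝ ∞ J (State.region D)) (hJiso : IsotropicVector D J) (h0 : (ρ, ε) ∈ D)
    {γ : ℝ} (hγ : γ ≠ 0) (b c : ℝ) :
    deriv (fun γ => axisFlux J ρ ε γ b c) γ = coldness m ρ ε (γ • Pi.single 0 1) * m.q2 ρ ε
      - (axisFlux J ρ ε γ b c - axisFlux J ρ ε γ 0 c
        + (axisFlux J ρ ε γ b c - axisFlux J ρ ε γ b 0)) / γ := by
  rw [← sub_eq_zero]
  refine eq_zero_of_forall_affine_nonneg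
    (c := -coldness m ρ ε (γ • Pi.single 0 1) * (m.q2 ρ ε * (b + c) + dRho m.q2 ρ ε * γ ^ 2)
      + γ * deriv (fun r => axisFlux J r ε γ b c) ρ
      + b * axisFlux J ρ ε γ 0 c / γ + c * axisFlux J ρ ε γ b 0 / γ) fun a => ?_
  refine (axis_inequality hc hD hJ hJiso h0 hγ a b c).trans_eq ?_
  rw [axisFlux_affine_left hc hD hJ h0 γ a c, axisFlux_affine_right hc hD hJ h0 γ b a]
  linear_combination a / γ * (-axisFlux_affine_left hc hD hJ h0 γ b c
    - axisFlux_affine_right hc hD hJ h0 γ b c)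

theorem differentiable_axisFlux (hc : FluxConditions D m J) (hD : IsOpen D)
    (hJ : ContDiffOn ℝ ∞ J (State.region D)) (h0 : (ρ, ε) ∈ D) (b c : ℝ) :
    Differentiable ℝ fun γ => axisFlux J ρ ε γ b c :=
  fun γ => (hasDerivAt_axisFlux_gamma hc hD hJ h0 γ ![0, b, c]).differentiableAt

theorem axisFlux_eq_axisFlux_zero_zero_of_deriv (hc : FluxConditions D m J) (hD : IsOpen D)
    (hJ : ContDiffOn ℝ ∞ J (State.region D)) (hJiso : IsotropicVector D J) (h0 : (ρ, ε) ∈ D)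
    {b c : ℝ} (n : ℕ)
    (h : ∀ x, x ≠ 0 → axisFlux J ρ ε x b c - axisFlux J ρ ε x 0 c
        + (axisFlux J ρ ε x b c - axisFlux J ρ ε x b 0)
      = (n + 1) * (axisFlux J ρ ε x b c - axisFlux J ρ ε x 0 0))
    {γ : ℝ} (hγ : γ ≠ 0) : axisFlux J ρ ε γ b c = axisFlux J ρ ε γ 0 0 := by
  have hd := differentiable_axisFlux hc hD hJ h0
  refine sub_eq_zero.1 (eq_zero_of_euler_ode ((hd b c).fun_sub (hd 0 0)) n
    (by simp only [axisFlux_zero hJiso h0, sub_zero]) (fun x hx => ?_) hγ)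
  rw [deriv_fun_sub (hd b c x) (hd 0 0 x), deriv_axisFlux hc hD hJ hJiso h0 hx,
    deriv_axisFlux hc hD hJ hJiso h0 hx, h x hx]
  ring

/-- Since `axisFlux` is biaffine in the transverse eigenvalues, the difference
`axisFlux J ρ ε γ b c - axisFlux J ρ ε γ 0 0` solves an Euler equation in `γ`. -/
theorem axisFlux_eq_axisFlux_zero_zero (hc : FluxConditions D m J) (hD : IsOpen D)
    (hJ : ContDiffOn ℝ ∞ J (State.region D)) (hJiso : IsotropicVector D J) (h0 : (ρ, ε) ∈ D)
    {γ : ℝ} (hγ : γ ≠ 0) (b c : ℝ) : axisFlux J ρ ε γ b c = axisFlux J ρ ε γ 0 0 := by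
  have hb {x : ℝ} (hx : x ≠ 0) : axisFlux J ρ ε x b 0 = axisFlux J ρ ε x 0 0 :=
    axisFlux_eq_axisFlux_zero_zero_of_deriv hc hD hJ hJiso h0 0 (fun x _ => by simp) hx
  have hc' {x : ℝ} (hx : x ≠ 0) : axisFlux J ρ ε x 0 c = axisFlux J ρ ε x 0 0 :=
    axisFlux_eq_axisFlux_zero_zero_of_deriv hc hD hJ hJiso h0 0 (fun x _ => by simp) hx
  refine axisFlux_eq_axisFlux_zero_zero_of_deriv hc hD hJ hJiso h0 1 (fun x hx => ?_) hγ
  rw [hb hx, hc' hx]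
  push_cast
  ring

theorem axisFlux_eq (hc : FluxConditions D m J) (hD : IsOpen D)
    (hJ : ContDiffOn ℝ ∞ J (State.region D)) (hJiso : IsotropicVector D J) (h0 : (ρ, ε) ∈ D)
    (γ b c : ℝ) :
    axisFlux J ρ ε γ b c = coldness m ρ ε (γ • Pi.single 0 1) * (m.q2 ρ ε * γ) := by
  rcases eq_or_ne γ 0 with rfl | hγ
  · rw [axisFlux_zero hJiso h0, mul_zero, mul_zero]
  rw [axisFlux_eq_axisFlux_zero_zero hc hD hJ hJiso h0 hγ]
  have hderiv (b : ℝ) : deriv (fun r => axisFlux J r ε γ b 0) ρ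
      = deriv (fun r => axisFlux J r ε γ 0 0) ρ := by
    have hnear : ∀ᶠ r in nhds ρ, (r, ε) ∈ D :=
      (Continuous.prodMk_left ε).continuousAt.preimage_mem_nhds (hD.mem_nhds h0)
    refine Filter.EventuallyEq.deriv_eq ?_
    filter_upwards [hnear] with r hr
    exact axisFlux_eq_axisFlux_zero_zero hc hD hJ hJiso hr hγ b 0
  have h : axisFlux J ρ ε γ 0 0 / γ - coldness m ρ ε (γ • Pi.single 0 1) * m.q2 ρ ε = 0 := by
    refine eq_zero_of_forall_affine_nonneg
      (c := -coldness m ρ ε (γ • Pi.single 0 1) * (dRho m.q2 ρ ε * γ ^ 2)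
        + γ * deriv (fun r => axisFlux J r ε γ 0 0) ρ) fun b => ?_
    refine (axis_inequality hc hD hJ hJiso h0 hγ 0 b 0).trans_eq ?_
    rw [hderiv]
    ring
  rw [(div_eq_iff hγ).1 (sub_eq_zero.1 h)]
  ring

theorem isotropicNull_flux (hc : FluxConditions D m J) (hD : IsOpen D)
    (hJ : ContDiffOn ℝ ∞ J (State.region D)) (hJiso : IsotropicVector D J) (h0 : (ρ, ε) ∈ D) :
    IsotropicNull fun g e H => J (ρ, ε, g, 0, e, H)
      - coldness m ρ ε g • (m.q1 ρ ε • e + m.q2 ρ ε • g) where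
  isotropic Q hQ g e H hH := by
    have hcold : coldness m ρ ε (actV Q g) = coldness m ρ ε g := by
      rw [coldness, dot_actV hQ, coldness]
    have hflux : J (ρ, ε, actV Q g, 0, actV Q e, actT Q H) = actV Q (J (ρ, ε, g, 0, e, H)) :=
      isotropicMap_flux hJiso h0 Q hQ g e hH
    beta_reduce
    rw [hflux, hcold, ← actV_smul, ← actV_smul, ← actV_add,
      ← actV_smul, actV_eq_mulVec, actV_eq_mulVec, actV_eq_mulVec, Matrix.mulVec_sub]
  hess g e H hH ξ t := by
    have h := hc.flux_hess hD hJ h0 g e hH ξ t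
    simp only [sub_eq_add_neg, dot_add, h]
  gradEps g e H hH ξ := by
    have h := hc.flux_gradEps hD hJ h0 g e hH ξ
    simp only [sub_eq_add_neg, ← neg_smul, dot_add, dot_smul, h]
    ring
  axis γ d := by
    rw [Pi.sub_apply, flux_axis_eq_axisFlux hc hD hJ h0, axisFlux_eq hc hD hJ hJiso h0]
    simp

theorem flux_eq (hc : FluxConditions D m J) (hD : IsOpen D)
    (hJ : ContDiffOn ℝ ∞ J (State.region D)) (hJiso : IsotropicVector D J) (h0 : (ρ, ε) ∈ D)
    (g e : V) {L H : T2} (hL : ∀ i j, L i j = L j i) (hH : ∀ i j, H i j = H j i) (i : Fin 3) :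
    J (ρ, ε, g, L, e, H) i = coldness m ρ ε g * (m.q1 ρ ε * e i + m.q2 ρ ε * g i)
      + 2 * ρ ^ 2 * m.s1 ρ ε * tr L * g i := by
  have h := congrFun ((isotropicNull_flux hc hD hJ hJiso h0).eq_zero hH g e) i
  rw [hc.flux_L hD hJ h0 g e hL hH, sub_eq_zero.1 h]
  rfl

end AxisFlux

section Residual

variable {D : Set (ℝ × ℝ)} {m : MaterialFunctions} {J : State → V} {ρ ε : ℝ}

theorem hasDerivAt_coldness (hD : IsOpen D) (hm : m.SmoothOn D) {r : ℝ → ℝ} {g : ℝ → V}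
    {r' s : ℝ} {g' : V} (hr : HasDerivAt r r' s) (hg : HasDerivAt g g' s) (h : (r s, ε) ∈ D) :
    HasDerivAt (fun s => coldness m (r s) ε (g s))
      (dRho (dEps m.s0) (r s) ε * r' + (dRho (dEps m.s1) (r s) ε * r' * dot (g s) (g s)
        + dEps m.s1 (r s) ε * (2 * dot (g s) g'))) s := by
  have hε := hasDerivAt_const s ε
  have hdot : HasDerivAt (fun s => dot (g s) (g s)) (2 * dot (g s) g') s := by
    have hi := hasDerivAt_pi.1 hg
    refine (HasDerivAt.fun_sum fun i _ => (hi i).fun_mul (hi i)).congr_deriv ?_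
    rw [Finset.sum_add_distrib, two_mul]
    exact congrArg (· + dot (g s) g') (dot_comm g' (g s))
  exact (((hm.s0.dEps hD).hasDerivAt hD hr hε h).fun_add
    (((hm.s1.dEps hD).hasDerivAt hD hr hε h).fun_mul hdot)).congr_deriv (by ring)

theorem fderiv_flux (hc : FluxConditions D m J) (hD : IsOpen D) (hm : m.SmoothOn D)
    (hJ : ContDiffOn ℝ ∞ J (State.region D)) (hJiso : IsotropicVector D J) (h0 : (ρ, ε) ∈ D)
    (g : V) {L H : T2} (hL : ∀ i j, L i j = L j i) (hH : ∀ i j, H i j = H j i) (a : ℝ) (w : V)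
    (i : Fin 3) :
    fderiv ℝ J (ρ, ε, g, L, 0, H) (a, 0, w, 0, 0, 0) i
      = ((dRho (dEps m.s0) ρ ε * a + (dRho (dEps m.s1) ρ ε * a * dot g g
            + dEps m.s1 ρ ε * (2 * dot g w))) * m.q2 ρ ε
          + coldness m ρ ε g * (dRho m.q2 ρ ε * a)
          + 2 * (2 * ρ * m.s1 ρ ε + ρ ^ 2 * dRho m.s1 ρ ε) * tr L * a) * g i
        + (coldness m ρ ε g * m.q2 ρ ε + 2 * ρ ^ 2 * m.s1 ρ ε * tr L) * w i := by
  have hr : HasDerivAt (fun s : ℝ => ρ + s * a) a 0 := by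
    simpa using ((hasDerivAt_id (0 : ℝ)).mul_const a).const_add ρ
  have hg : HasDerivAt (fun s : ℝ => g + s • w) w 0 := by
    simpa using ((hasDerivAt_id (0 : ℝ)).smul_const w).const_add g
  have hε := hasDerivAt_const (0 : ℝ) ε
  have hz : (ρ + 0 * a, ε) ∈ D := by simpa using h0
  have hγ : HasDerivAt (fun s : ℝ => ((ρ + s * a, ε, g + s • w, L, 0, H) : State))
      (a, 0, w, 0, 0, 0) 0 :=
    hr.prodMk (hε.prodMk (hg.prodMk ((hasDerivAt_const 0 L).prodMk
      ((hasDerivAt_const 0 0).prodMk (hasDerivAt_const 0 H)))))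
  have hflux := ((((hasDerivAt_coldness hD hm hr hg hz).fun_mul
    (hm.q2.hasDerivAt hD hr hε hz)).fun_add ((((hr.fun_pow 2).const_mul 2).fun_mul
    (hm.s1.hasDerivAt hD hr hε hz)).mul_const (tr L))).fun_mul
    (hasDerivAt_pi.1 hg i)).congr_of_eventuallyEq
    (f₁ := fun s : ℝ => J (ρ + s * a, ε, g + s • w, L, 0, H) i) (by
      have hnear : ∀ᶠ s in nhds (0 : ℝ), (ρ + s * a, ε) ∈ D :=
        (hr.continuousAt.prodMk hε.continuousAt).preimage_mem_nhds (hD.mem_nhds hz)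
      filter_upwards [hnear] with s hs
      rw [flux_eq hc hD hJ hJiso hs (g + s • w) 0 hL hH i, Pi.zero_apply]
      ring)
  have h := (hasDerivAt_flux_comp hD hJ hγ hz i).unique hflux
  simp only [zero_mul, add_zero, zero_smul] at h
  rw [h]
  push_cast
  ring

theorem sum_fderiv_flux (hc : FluxConditions D m J) (hD : IsOpen D) (hm : m.SmoothOn D)
    (hJ : ContDiffOn ℝ ∞ J (State.region D)) (hJiso : IsotropicVector D J) (h0 : (ρ, ε) ∈ D)
    (g : V) {L H : T2} (hL : ∀ i j, L i j = L j i) (hH : ∀ i j, H i j = H j i) :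
    ∑ j, fderiv ℝ J (ρ, ε, g, L, 0, H) (g j, 0, fun i => H i j, 0, 0, 0) j
      = (dRho (dEps m.s0) ρ ε + dRho (dEps m.s1) ρ ε * dot g g) * m.q2 ρ ε * dot g g
        + 2 * dEps m.s1 ρ ε * m.q2 ρ ε * dot g (actV (.of H) g)
        + coldness m ρ ε g * (dRho m.q2 ρ ε * dot g g + m.q2 ρ ε * tr H)
        + 2 * tr L * ((2 * ρ * m.s1 ρ ε + ρ ^ 2 * dRho m.s1 ρ ε) * dot g g
          + ρ ^ 2 * m.s1 ρ ε * tr H) := by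
  simp only [fderiv_flux hc hD hm hJ hJiso h0 g hL hH]
  simp only [dot, tr, actV, Matrix.of_apply, Fin.sum_univ_three]
  ring

theorem ddot_stress (m : MaterialFunctions) (ρ ε : ℝ) (g : V) (L H : T2) :
    ddot (m.stress (ρ, ε, g, L, 0, H)) L
      = (-m.p ρ ε + m.α1 ρ ε * tr H + m.α2 ρ ε * dot g g + m.α5 ρ ε * tr L) * tr L
        + m.α3 ρ ε * dot g (actV (.of L) g) + m.α4 ρ ε * ddot H L + m.α6 ρ ε * ddot L L := by
  simp only [MaterialFunctions.stress, State.rho, State.eps, State.gradRho, State.L, State.hessRho,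
    tr, dot, ddot, actV, delta, Fin.sum_univ_three, Matrix.of_apply, mul_ite, mul_one, mul_zero,
    reduceIte, Fin.reduceEq, zero_ne_one, one_ne_zero]
  ring

/-- The entropy production that remains in the states with `∇ε = 0` once the flux is expressed
through the material functions. -/
noncomputable def reducedProduction (m : MaterialFunctions) (ρ ε : ℝ) (g : V) (L H : T2) : ℝ :=
  -ρ ^ 2 * (dRho m.s0 ρ ε + dRho m.s1 ρ ε * dot g g) * tr L
    + coldness m ρ ε g
      * ((-m.p ρ ε + m.α1 ρ ε * tr H + m.α2 ρ ε * dot g g + m.α5 ρ ε * tr L) * tr L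
        + m.α3 ρ ε * dot g (actV (.of L) g) + m.α4 ρ ε * ddot H L + m.α6 ρ ε * ddot L L)
    - 2 * ρ * m.s1 ρ ε * dot g (actV (.of L) g)
    + 2 * tr L * ((ρ * m.s1 ρ ε + ρ ^ 2 * dRho m.s1 ρ ε) * dot g g + ρ ^ 2 * m.s1 ρ ε * tr H)
    + m.q2 ρ ε * ((dRho (dEps m.s0) ρ ε + dRho (dEps m.s1) ρ ε * dot g g) * dot g g
      + 2 * dEps m.s1 ρ ε * dot g (actV (.of H) g))

theorem reducedProduction_nonneg (hc : FluxConditions D m J) (hD : IsOpen D) (hm : m.SmoothOn D)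
    (hJ : ContDiffOn ℝ ∞ J (State.region D)) (hJiso : IsotropicVector D J) (h0 : (ρ, ε) ∈ D)
    (g : V) {L H : T2} (hL : ∀ i j, L i j = L j i) (hH : ∀ i j, H i j = H j i) :
    0 ≤ reducedProduction m ρ ε g L H := by
  have h := hc.nonneg h0 g 0 hL hH
  have hdiv : divHeatFlux m ρ ε g 0 H 0 = m.q2 ρ ε * tr H + dRho m.q2 ρ ε * dot g g := by
    rw [divHeatFlux, tr_zero, dot_zero, dot_zero]
    ring
  have hsum : ∑ i, g i * ∑ j, (g j * L j i + g i * L j j)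
      = dot g (actV (.of L) g) + dot g g * tr L := by
    simp only [dot, tr, actV, Matrix.of_apply, Fin.sum_univ_three]
    ring
  simp only [residualProduction, Pi.zero_apply] at h
  rw [sum_fderiv_flux hc hD hm hJ hJiso h0 g hL hH, ddot_stress, hdiv, hsum] at h
  rw [reducedProduction]
  linear_combination h

theorem reducedProduction_smul_hess (m : MaterialFunctions) (ρ ε : ℝ) (g : V) (L H : T2) (t : ℝ) :
    reducedProduction m ρ ε g L (t • H) = reducedProduction m ρ ε g L 0
      + t * (coldness m ρ ε g * (m.α1 ρ ε * tr H * tr L + m.α4 ρ ε * ddot H L)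
        + 2 * ρ ^ 2 * m.s1 ρ ε * tr H * tr L
        + 2 * m.q2 ρ ε * dEps m.s1 ρ ε * dot g (actV (.of H) g)) := by
  simp only [reducedProduction, tr, ddot, dot, actV, Matrix.of_apply, Fin.sum_univ_three,
    Pi.smul_apply, Pi.zero_apply, smul_eq_mul]
  ring

theorem hess_coefficient_eq_zero (hc : FluxConditions D m J) (hD : IsOpen D) (hm : m.SmoothOn D)
    (hJ : ContDiffOn ℝ ∞ J (State.region D)) (hJiso : IsotropicVector D J) (h0 : (ρ, ε) ∈ D)
    (g : V) {L H : T2} (hL : ∀ i j, L i j = L j i) (hH : ∀ i j, H i j = H j i) :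
    coldness m ρ ε g * (m.α1 ρ ε * tr H * tr L + m.α4 ρ ε * ddot H L)
      + 2 * ρ ^ 2 * m.s1 ρ ε * tr H * tr L
      + 2 * m.q2 ρ ε * dEps m.s1 ρ ε * dot g (actV (.of H) g) = 0 := by
  refine eq_zero_of_forall_affine_nonneg (c := reducedProduction m ρ ε g L 0) fun t => ?_
  rw [← reducedProduction_smul_hess]
  exact reducedProduction_nonneg hc hD hm hJ hJiso h0 g hL
    fun i j => congrArg (t * ·) (hH i j)

theorem ddot_diag (a b : V) : ddot (diag a) (diag b) = dot a b := by
  simp [ddot, dot, diag, delta, Fin.sum_univ_three]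

theorem coldness_zero (m : MaterialFunctions) (ρ ε : ℝ) : coldness m ρ ε 0 = dEps m.s0 ρ ε := by
  rw [coldness, dot_zero, mul_zero, add_zero]

theorem α4_eq_zero (hc : FluxConditions D m J) (hD : IsOpen D) (hm : m.SmoothOn D)
    (hJ : ContDiffOn ℝ ∞ J (State.region D)) (hJiso : IsotropicVector D J) (h0 : (ρ, ε) ∈ D)
    (hs0 : dEps m.s0 ρ ε ≠ 0) : m.α4 ρ ε = 0 := by
  have h := hess_coefficient_eq_zero hc hD hm hJ hJiso h0 0 (diag_symm ![1, -1, 0])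
    (diag_symm ![1, -1, 0])
  rw [coldness_zero, tr_diag, ddot_diag, zero_dot] at h
  simpa [dot, Fin.sum_univ_three, hs0] using h

theorem α1_eq (hc : FluxConditions D m J) (hD : IsOpen D) (hm : m.SmoothOn D)
    (hJ : ContDiffOn ℝ ∞ J (State.region D)) (hJiso : IsotropicVector D J) (h0 : (ρ, ε) ∈ D)
    (hs0 : dEps m.s0 ρ ε ≠ 0) : m.α1 ρ ε = -2 * ρ ^ 2 * m.s1 ρ ε / dEps m.s0 ρ ε := by
  have h := hess_coefficient_eq_zero hc hD hm hJ hJiso h0 0 (diag_symm ![1, 0, 0])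
    (diag_symm ![0, 1, 0])
  rw [coldness_zero, tr_diag, tr_diag, ddot_diag, zero_dot] at h
  simp only [dot, Fin.sum_univ_three, Matrix.cons_val] at h
  rw [eq_div_iff hs0]
  linear_combination h

theorem dEps_s1_eq_zero (hc : FluxConditions D m J) (hD : IsOpen D) (hm : m.SmoothOn D)
    (hJ : ContDiffOn ℝ ∞ J (State.region D)) (hJiso : IsotropicVector D J)
    (hs0 : ∀ ρ ε, (ρ, ε) ∈ D → dEps m.s0 ρ ε ≠ 0)
    (hcap : D ⊆ closure {z : ℝ × ℝ | z ∈ D ∧ m.α1 z.1 z.2 + m.α4 z.1 z.2 ≠ 0})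
    (h0 : (ρ, ε) ∈ D) : dEps m.s1 ρ ε = 0 := by
  refine (hm.s1.dEps hD).eq_zero_of_mul_eq_zero (A := fun z => m.α1 z.1 z.2 + m.α4 z.1 z.2)
    hD hcap (fun ρ ε h => ?_) h0
  have hs1 := hess_coefficient_eq_zero hc hD hm hJ hJiso h (Pi.single 0 1)
    (diag_symm ![0, 1, 0]) (diag_symm ![0, 0, 1])
  rw [coldness, tr_diag, tr_diag, ddot_diag, actV_diag_single, dot_single, dot_single] at hs1
  simp only [dot, Fin.sum_univ_three, Matrix.cons_val, Pi.single_eq_same, Pi.smul_apply,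
    smul_eq_mul] at hs1
  have hα1 := (eq_div_iff (hs0 ρ ε h)).1 (α1_eq hc hD hm hJ hJiso h (hs0 ρ ε h))
  rw [α4_eq_zero hc hD hm hJ hJiso h (hs0 ρ ε h)]
  linear_combination hs1 - hα1

theorem eq_zero_of_forall_quadratic_nonneg {c d : ℝ} (h : ∀ t : ℝ, 0 ≤ t * d + t ^ 2 * c) :
    d = 0 := by
  have hmin : IsLocalMin (fun t : ℝ => t * d + t ^ 2 * c) 0 :=
    .of_forall fun t => by simpa using h t
  have hderiv : HasDerivAt (fun t : ℝ => t * d + t ^ 2 * c) d 0 := by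
    simpa using ((hasDerivAt_id (0 : ℝ)).mul_const d).fun_add
      ((hasDerivAt_pow 2 (0 : ℝ)).mul_const c)
  exact hmin.hasDerivAt_eq_zero hderiv

theorem nonneg_of_forall_sq_nonneg {c d : ℝ} (h : ∀ t : ℝ, 0 ≤ c + t ^ 2 * d) : 0 ≤ d := by
  by_contra! hd
  have hbot : Filter.Tendsto (fun t : ℝ => c + t ^ 2 * d) Filter.atTop Filter.atBot :=
    Filter.tendsto_atBot_add_const_left _ c
      ((Filter.tendsto_pow_atTop two_ne_zero).atTop_mul_const_of_neg hd)
  obtain ⟨t, ht⟩ := (hbot.eventually_lt_atBot 0).exists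
  exact (h t).not_gt ht

theorem p_eq (hc : FluxConditions D m J) (hD : IsOpen D) (hm : m.SmoothOn D)
    (hJ : ContDiffOn ℝ ∞ J (State.region D)) (hJiso : IsotropicVector D J) (h0 : (ρ, ε) ∈ D)
    (hs0 : dEps m.s0 ρ ε ≠ 0) : m.p ρ ε = -ρ ^ 2 * dRho m.s0 ρ ε / dEps m.s0 ρ ε := by
  have h : -ρ ^ 2 * dRho m.s0 ρ ε - dEps m.s0 ρ ε * m.p ρ ε = 0 := by
    refine eq_zero_of_forall_quadratic_nonneg (c := dEps m.s0 ρ ε * (m.α5 ρ ε + m.α6 ρ ε))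
      fun t => (reducedProduction_nonneg hc hD hm hJ hJiso h0 0 (diag_symm ![t, 0, 0])
        (H := 0) fun _ _ => rfl).trans_eq ?_
    rw [reducedProduction, coldness_zero, tr_diag, ddot_diag, tr_zero]
    simp only [dot, ddot, Fin.sum_univ_three, Matrix.cons_val, Pi.zero_apply]
    ring
  rw [eq_div_iff hs0]
  linear_combination -h

theorem capillary_inequality (hc : FluxConditions D m J) (hD : IsOpen D) (hm : m.SmoothOn D)
    (hJ : ContDiffOn ℝ ∞ J (State.region D)) (hJiso : IsotropicVector D J)
    (hs1 : ∀ ρ ε, (ρ, ε) ∈ D → dEps m.s1 ρ ε = 0) (h0 : (ρ, ε) ∈ D) (x y : ℝ) :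
    0 ≤ (ρ ^ 2 * dRho m.s1 ρ ε + 2 * ρ * m.s1 ρ ε + dEps m.s0 ρ ε * m.α2 ρ ε) * y
      + (dEps m.s0 ρ ε * m.α3 ρ ε - 2 * ρ * m.s1 ρ ε) * x
      + m.q2 ρ ε * dRho (dEps m.s0) ρ ε := by
  refine nonneg_of_forall_sq_nonneg (c := -ρ ^ 2 * dRho m.s0 ρ ε * y
      + dEps m.s0 ρ ε * (-m.p ρ ε * y + m.α5 ρ ε * y ^ 2 + m.α6 ρ ε * (x ^ 2 + (y - x) ^ 2)))
    fun γ => (reducedProduction_nonneg hc hD hm hJ hJiso h0 (γ • Pi.single 0 1)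
      (diag_symm ![x, y - x, 0]) (H := 0) fun _ _ => rfl).trans_eq ?_
  rw [reducedProduction, coldness, hs1 ρ ε h0, dRho_eq_zero hD hs1 h0, tr_diag, ddot_diag, tr_zero,
    actV_smul, actV_diag_single]
  simp only [smul_dot, dot_smul, dot_single, Pi.single_eq_same]
  simp only [dot, ddot, Fin.sum_univ_three, Matrix.cons_val, Pi.zero_apply]
  ring

theorem α2_eq (hc : FluxConditions D m J) (hD : IsOpen D) (hm : m.SmoothOn D)
    (hJ : ContDiffOn ℝ ∞ J (State.region D)) (hJiso : IsotropicVector D J)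
    (hs1 : ∀ ρ ε, (ρ, ε) ∈ D → dEps m.s1 ρ ε = 0) (h0 : (ρ, ε) ∈ D)
    (hs0 : dEps m.s0 ρ ε ≠ 0) :
    m.α2 ρ ε = -ρ * (ρ * dRho m.s1 ρ ε + 2 * m.s1 ρ ε) / dEps m.s0 ρ ε := by
  have h : ρ ^ 2 * dRho m.s1 ρ ε + 2 * ρ * m.s1 ρ ε + dEps m.s0 ρ ε * m.α2 ρ ε = 0 :=
    eq_zero_of_forall_affine_nonneg (c := m.q2 ρ ε * dRho (dEps m.s0) ρ ε) fun t =>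
      (capillary_inequality hc hD hm hJ hJiso hs1 h0 0 t).trans_eq (by ring)
  rw [eq_div_iff hs0]
  linear_combination h

theorem α3_eq (hc : FluxConditions D m J) (hD : IsOpen D) (hm : m.SmoothOn D)
    (hJ : ContDiffOn ℝ ∞ J (State.region D)) (hJiso : IsotropicVector D J)
    (hs1 : ∀ ρ ε, (ρ, ε) ∈ D → dEps m.s1 ρ ε = 0) (h0 : (ρ, ε) ∈ D)
    (hs0 : dEps m.s0 ρ ε ≠ 0) : m.α3 ρ ε = 2 * ρ * m.s1 ρ ε / dEps m.s0 ρ ε := by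
  have h : dEps m.s0 ρ ε * m.α3 ρ ε - 2 * ρ * m.s1 ρ ε = 0 :=
    eq_zero_of_forall_affine_nonneg (c := m.q2 ρ ε * dRho (dEps m.s0) ρ ε) fun t =>
      (capillary_inequality hc hD hm hJ hJiso hs1 h0 t 0).trans_eq (by ring)
  rw [eq_div_iff hs0]
  linear_combination h

theorem entropy_eq (hs : ∀ ρ ε, (ρ, ε) ∈ D →
      m.s2 ρ ε = 0 ∧ m.s3 ρ ε = 0 ∧ m.s4 ρ ε = 0 ∧ m.s5 ρ ε = 0)
    {z : State} (hz : (z.rho, z.eps) ∈ D) :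
    m.entropy z
      = m.s0 z.rho z.eps + m.s1 z.rho z.eps * dot z.gradRho z.gradRho := by
  obtain ⟨h2, h3, h4, h5⟩ := hs z.rho z.eps hz
  rw [MaterialFunctions.entropy, h2, h3, h4, h5]
  ring

theorem flux_eq_of_dEps_s1_eq_zero (hc : FluxConditions D m J) (hD : IsOpen D)
    (hJ : ContDiffOn ℝ ∞ J (State.region D)) (hJiso : IsotropicVector D J)
    (hs1 : ∀ ρ ε, (ρ, ε) ∈ D → dEps m.s1 ρ ε = 0) {z : State} (hz : z.Admissible D) (i : Fin 3) :
    J z i = m.heatFlux z i * dEps m.s0 z.rho z.eps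
      + 2 * z.rho ^ 2 * m.s1 z.rho z.eps * tr z.L * z.gradRho i := by
  refine (flux_eq hc hD hJ hJiso hz.1 z.gradRho z.gradEps hz.2.1 hz.2.2 i).trans ?_
  rw [coldness, hs1 _ _ hz.1, MaterialFunctions.heatFlux]
  ring

end Residual

section Slices

variable {D : Set (ℝ × ℝ)} {f : ℝ → ℝ → ℝ}

theorem eq_of_dEps_eq_zero (hD : IsOpen D) (hDslice : ∀ ρ : ℝ, IsPreconnected {ε : ℝ | (ρ, ε) ∈ D})
    (hf : Smooth2 D f) (h : ∀ ρ ε, (ρ, ε) ∈ D → dEps f ρ ε = 0) {ρ ε₁ ε₂ : ℝ}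
    (h₁ : (ρ, ε₁) ∈ D) (h₂ : (ρ, ε₂) ∈ D) : f ρ ε₁ = f ρ ε₂ := by
  have hopen : IsOpen {ε : ℝ | (ρ, ε) ∈ D} := hD.preimage (Continuous.prodMk_right ρ)
  have hderiv (ε : ℝ) (hε : (ρ, ε) ∈ D) : HasDerivAt (f ρ) 0 ε := by
    simpa [h ρ ε hε] using hf.hasDerivAt hD (hasDerivAt_const ε ρ) (hasDerivAt_id ε) hε
  exact hopen.is_const_of_deriv_eq_zero (hDslice ρ)
    (fun ε hε => (hderiv ε hε).differentiableAt.differentiableWithinAt)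
    (fun ε hε => (hderiv ε hε).deriv) h₁ h₂

theorem exists_eq_of_dEps_eq_zero (hD : IsOpen D)
    (hDslice : ∀ ρ : ℝ, IsPreconnected {ε : ℝ | (ρ, ε) ∈ D})
    (hf : Smooth2 D f) (h : ∀ ρ ε, (ρ, ε) ∈ D → dEps f ρ ε = 0) :
    ∃ S : ℝ → ℝ, ContDiffOn ℝ ∞ S (Prod.fst '' D) ∧
      ∀ ρ ε, (ρ, ε) ∈ D → f ρ ε = S ρ ∧ dRho f ρ ε = deriv S ρ := by
  classical
  let S (ρ : ℝ) : ℝ := if hρ : ∃ ε, (ρ, ε) ∈ D then f ρ hρ.choose else 0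
  have hS (ρ ε : ℝ) (hz : (ρ, ε) ∈ D) : f ρ ε = S ρ := by
    have hρ : ∃ ε, (ρ, ε) ∈ D := ⟨ε, hz⟩
    simp only [S, dif_pos hρ]
    exact eq_of_dEps_eq_zero hD hDslice hf h hz hρ.choose_spec
  have hlocal (ρ ε : ℝ) (hz : (ρ, ε) ∈ D) : S =ᶠ[nhds ρ] fun r => f r ε := by
    have hnear : ∀ᶠ r in nhds ρ, (r, ε) ∈ D :=
      (Continuous.prodMk_left ε).continuousAt.preimage_mem_nhds (hD.mem_nhds hz)
    filter_upwards [hnear] with r hr using (hS r ε hr).symm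
  refine ⟨S, ?_, fun ρ ε hz => ⟨hS ρ ε hz, (hlocal ρ ε hz).deriv_eq.symm⟩⟩
  rintro _ ⟨⟨ρ, ε⟩, hz, rfl⟩
  have hsmooth : ContDiffAt ℝ ∞ (fun r => f r ε) ρ :=
    ContDiffAt.comp (g := fun z : ℝ × ℝ => f z.1 z.2) (f := fun r : ℝ => (r, ε)) ρ
      (hf.contDiffAt hD hz) (contDiffAt_id.prodMk contDiffAt_const)
  exact (hsmooth.congr_of_eventuallyEq (hlocal ρ ε hz)).contDiffWithinAt

end Slices

end Korteweg

theorem mainTheorem1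
    (D : Set (ℝ × ℝ)) (hD : IsOpen D) (hDpos : ∀ z ∈ D, 0 < z.1)
    (hDslice : ∀ ρ : ℝ, IsPreconnected {ε : ℝ | (ρ, ε) ∈ D})
    (m : Korteweg.MaterialFunctions) (hm : m.SmoothOn D)
    (J : Korteweg.State → Korteweg.V)
    (hJ : ContDiffOn ℝ ∞ J (Korteweg.State.region D))
    (hJiso : Korteweg.IsotropicVector D J)
    (hs0 : ∀ ρ ε : ℝ, (ρ, ε) ∈ D → Korteweg.dEps m.s0 ρ ε ≠ 0)
    (hcap : D ⊆ closure {z : ℝ × ℝ | z ∈ D ∧ m.α1 z.1 z.2 + m.α4 z.1 z.2 ≠ 0})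
    (hent : Korteweg.ExtendedEntropyPrinciple D m J) :
    ∃ S1 : ℝ → ℝ, ContDiffOn ℝ ∞ S1 (Prod.fst '' D) ∧
      (∀ z : Korteweg.State, z.Admissible D →
        m.entropy z
            = m.s0 z.rho z.eps + S1 z.rho * Korteweg.dot z.gradRho z.gradRho ∧
        (∀ i, J z i = m.heatFlux z i * Korteweg.dEps m.s0 z.rho z.eps
            + 2 * z.rho ^ 2 * S1 z.rho * Korteweg.tr z.L * z.gradRho i)) ∧
      (∀ ρ ε : ℝ, (ρ, ε) ∈ D →
        (m.s1 ρ ε = S1 ρ ∧ m.s2 ρ ε = 0 ∧ m.s3 ρ ε = 0 ∧ m.s4 ρ ε = 0 ∧ m.s5 ρ ε = 0) ∧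
        m.p ρ ε = -ρ ^ 2 * Korteweg.dRho m.s0 ρ ε / Korteweg.dEps m.s0 ρ ε ∧
        m.α1 ρ ε = -2 * ρ ^ 2 * S1 ρ / Korteweg.dEps m.s0 ρ ε ∧
        m.α2 ρ ε = -ρ * (ρ * deriv S1 ρ + 2 * S1 ρ) / Korteweg.dEps m.s0 ρ ε ∧
        m.α3 ρ ε = 2 * ρ * S1 ρ / Korteweg.dEps m.s0 ρ ε ∧
        m.α4 ρ ε = 0) := by
  have hs := fun ρ ε h =>
    Korteweg.entropy_coefficients_eq_zero (ρ := ρ) (ε := ε) hD hm hDpos hJ hent hcap h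
  have hc := Korteweg.fluxConditions hD hDpos hm hJ hent hs
  have hs1 : ∀ ρ ε, (ρ, ε) ∈ D → Korteweg.dEps m.s1 ρ ε = 0 := fun ρ ε h =>
    Korteweg.dEps_s1_eq_zero hc hD hm hJ hJiso hs0 hcap h
  obtain ⟨S, hS, hS1⟩ := Korteweg.exists_eq_of_dEps_eq_zero hD hDslice hm.s1 hs1
  refine ⟨S, hS, fun z hz => ?_, fun ρ ε h => ⟨⟨(hS1 ρ ε h).1, hs ρ ε h⟩, ?_⟩⟩
  · rw [← (hS1 _ _ hz.1).1]
    exact ⟨Korteweg.entropy_eq hs hz.1, Korteweg.flux_eq_of_dEps_s1_eq_zero hc hD hJ hJiso hs1 hz⟩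
  · rw [← (hS1 ρ ε h).1, ← (hS1 ρ ε h).2]
    exact ⟨Korteweg.p_eq hc hD hm hJ hJiso h (hs0 ρ ε h),
      Korteweg.α1_eq hc hD hm hJ hJiso h (hs0 ρ ε h),
      Korteweg.α2_eq hc hD hm hJ hJiso hs1 h (hs0 ρ ε h),
      Korteweg.α3_eq hc hD hm hJ hJiso hs1 h (hs0 ρ ε h),
      Korteweg.α4_eq_zero hc hD hm hJ hJiso h (hs0 ρ ε h)⟩
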